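/- **Setting.** For every $n$ let $k=k_n$, $d=d_n$, $b=b_n$ be positive integers and let $\lambda>0$ be fixed. Let $\mathbf X_i=(\mathbf V_i,\mathbf Y_i)$, $i\le n$, be i.i.d. random elements of $\mathbb R^d\times\mathbb R^b$, let $\phi_{ij}=(\pi_{ij},\tau_{ij})$, $i\le n$, $j\le k$, be i.i.d. random pairs of measurable maps of $\mathbb R^d$ and $\mathbb R^b$, independent of the $\mathbf X_i$ (all laws may depend on $n$), and put $\phi_{ij}\mathbf X_i=(\pi_{ij}\mathbf V_i,\tau_{ij}\mathbf Y_i)$, $\Phi_i\mathbf X_i=(\phi_{i1}\mathbf X_i,\dots,\phi_{ik}\mathbf X_i)\in\mathbb R^{k(d+b)}$, $\Phi\mathcal X=(\Phi_1\mathbf X_1,\dots,\Phi_n\mathbf X_n)$. For data $(\mathbf v_{ij},\mathbf y_{ij})_{i\le n,j\le k}$ the ridge estimator is $$\hat B=\Big(\sum_{i,j}\mathbf v_{ij}\mathbf v_{ij}^\top+nk\lambda \mathbf I_d\Big)^{-1}\sum_{i,j}\mathbf v_{ij}\mathbf y_{ij}^\top\in\mathbb R^{d\times b},$$ and its risk is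 $R(\hat B)=\mathbb E_{\mathrm{new}}\|\mathbf Y_{\mathrm{new}}-\hat B^\top\mathbf V_{\mathrm{new}}\|^2$, the expectation being over $(\mathbf V_{\mathrm{new}},\mathbf Y_{\mathrm{new}})\sim\nu_n$ only. **Surrogates ($\delta=0$).** $\mathbf Z_1,\dots,\mathbf Z_n$ are i.i.d. Gaussian in $\mathbb R^{k(d+b)}$, independent of the data, with mean $\mathbf 1_{k\times1}\otimes\mathbb E[\phi_{11}\mathbf X_1]$ and covariance $\mathbf I_k\otimes\Sigma_{11}+(\mathbf 1_{k\times k}-\mathbf I_k)\otimes\Sigma_{12}$, where $\Sigma_{11}=\mathrm{Var}[\phi_{11}\mathbf X_1]$ and $\Sigma_{12}=\mathrm{Cov}[\phi_{11}\mathbf X_1,\phi_{12}\mathbf X_1]$ ($\phi_{12}$ an independent copy of $\phi_{11}$). In the unaugmented case the data are $\tilde{\mathbf X}_i=(\mathbf X_i,\dots,\mathbf X_i)\in\mathbb R^{k(d+b)}$ and $\tilde{\mathbf Z}_1,\dots,\tilde{\mathbf Z}_n$ are i.i.d. Gaussian, independent of the data, with mean $\mathbf 1_{k\times1}\otimes\mathbb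 E\mathbf X_1$ and covariance $\mathbf 1_{k\times k}\otimes\mathrm{Var}[\mathbf X_1]$. **Noise stability.** For a three times differentiable $f$ of $n$ blocks in $\mathbb R^{k(d+b)}$, let $D_i^rf$ be the $r$-th derivative in block $i$, $\|\cdot\|$ the flattened Euclidean norm, $\mathbf W_i(\mathbf w)=(\Phi_1\mathbf X_1,\dots,\Phi_{i-1}\mathbf X_{i-1},\mathbf w,\mathbf Z_{i+1},\dots,\mathbf Z_n)$, and $$\alpha^r_m=\max_{i\le n}\max\Big\{\Big\|\sup_{\mathbf w\in[\mathbf 0,\Phi_i\mathbf X_i]}\|D_i^rf(\mathbf W_i(\mathbf w))\|\Big\|_{L_m},\ \Big\|\sup_{\mathbf w\in[\mathbf 0,\mathbf Z_i]}\|D_i^rf(\mathbf W_i(\mathbf w))\|\Big\|_{L_m}\Big\},$$ with $[\mathbf 0,\mathbf x]$ the line segment. Condition $(\lambda_2)$ for $f$ says that these numbers ($r\le3$, $m\le6$) are finite for large $n$ and $$(\alpha^1_6)^3,\ \alpha^0_6\alpha^1_6\alpha^2_6,\ (\alpha^0_6)^2\alpha^3_6,\ \alpha^1_4\alpha^2_4,\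 \alpha^0_4\alpha^3_4,\ \alpha^3_2\ =\ o\big(1/(nk^{3/2})\big).$$ In the unaugmented case the same definitions are used with $\tilde{\mathbf X}_i,\tilde{\mathbf Z}_i$ in place of $\Phi_i\mathbf X_i,\mathbf Z_i$. For three times differentiable $h:\mathbb R\to\mathbb R$ put $\eta^r(h)=|h^{(r)}(0)|$, $\gamma^3(h)=\sup|h'''|$, $$\lambda_2=\gamma^3(h)\big((\alpha^1_6)^3+3\alpha^0_6\alpha^1_6\alpha^2_6+(\alpha^0_6)^2\alpha^3_6\big)+\eta^2(h)\big(3\alpha^1_4\alpha^2_4+\alpha^0_4\alpha^3_4\big)+\eta^1(h)\alpha^3_2,$$ $\mathcal H=\{h:\eta^1(h),\eta^2(h),\gamma^3(h)\le1\}$ and $d_{\mathcal H}(S,T)=\sup_{h\in\mathcal H}|\mathbb Eh(S)-\mathbb Eh(T)|$. **Lemma (ridge regression).** Assume that, as $n\to\infty$, $(b+d)^{3/2}k^{1/2}=o(n)$, and that almost surely, uniformly in $n,i,j$ and in the coordinate, each coordinate of $\pi_{ij}\mathbf V_i$ is $O(d^{-1/2})$ and each coordinate of $\tau_{ij}\mathbf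 Y_i$ is $O(b^{-1/2})$. (i) $f=\hat B$ is three times continuously differentiable and satisfies $(\lambda_2)$; $\hat B(\Phi\mathcal X)$ and $\hat B(\mathbf Z_1,\dots,\mathbf Z_n)$ are square integrable, and $\|\mathrm{Var}\,\hat B(\Phi\mathcal X)-\mathrm{Var}\,\hat B(\mathbf Z_1,\dots,\mathbf Z_n)\|\to0$ in Frobenius norm. (ii) Assume in addition $b+d=o(nk^{1/4})$, and that $\mathbb E\|\mathbf V_{\mathrm{new}}\|^2$ and $\mathbb E\|\mathbf Y_{\mathrm{new}}\|^2$ are $O(1)$. Then $f=R(\hat B)$ is three times continuously differentiable and satisfies $(\lambda_2)$, and $d_{\mathcal H}\big(f(\Phi\mathcal X),f(\mathbf Z_1,\dots,\mathbf Z_n)\big)\to0$, all expectations being finite. If moreover the coordinates of the unaugmented $\mathbf V_i$ and $\mathbf Y_i$ are almost surely $O(d^{-1/2})$ and $O(b^{-1/2})$, then $f=R(\hat B)$ also satisfies $(\lambda_2)$ in the unaugmented case; for every $n\ge1$ and every three times differentiable $h:\mathbb R\to\mathbb R$ with $\gamma^3(h)<\infty$, $$\big|\mathbb Eh(f(\tilde{\mathbf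 X}_1,\dots,\tilde{\mathbf X}_n))-\mathbb Eh(f(\tilde{\mathbf Z}_1,\dots,\tilde{\mathbf Z}_n))\big|\le nk^{3/2}\lambda_2\Big(\sqrt{\mathbb E\|\mathbf X_1\|^6}+\tfrac1{k^3}\sqrt{\mathbb E\|\tilde{\mathbf Z}_1\|^6}\Big),$$ with finite expectations and $\tfrac1{k^3}\sqrt{\mathbb E\|\tilde{\mathbf Z}_1\|^6}=O(1)$; and $d_{\mathcal H}\big(f(\tilde{\mathbf X}_1,\dots,\tilde{\mathbf X}_n),f(\tilde{\mathbf Z}_1,\dots,\tilde{\mathbf Z}_n)\big)\to0$. -/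

import Mathlib

open MeasureTheory ProbabilityTheory Filter Topology
open scoped ENNReal Kronecker

noncomputable section

/-- Vectors in `ℝᵐ` with the Euclidean norm. -/
abbrev Vec (m : ℕ) : Type := EuclideanSpace ℝ (Fin m)

/-- A data point `x = (v, y) ∈ ℝ^{d+b}` as one Euclidean vector: covariate coordinates `inl l`,
response coordinates `inr l`. -/
abbrev Point (d b : ℕ) : Type := EuclideanSpace ℝ (Fin d ⊕ Fin b)

/-- A block `(x_{i1}, …, x_{ik}) ∈ ℝ^{k(d+b)}`; coordinate `(j, a)` is coordinate `a` of `x_{ij}`. -/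
abbrev Block (k d b : ℕ) : Type := EuclideanSpace ℝ (Fin k × (Fin d ⊕ Fin b))

/-- The pair `(v, y)` as a single vector. -/
def toPoint {d b : ℕ} (x : Vec d × Vec b) : Point d b :=
  WithLp.toLp 2 (Sum.elim (fun l => x.1 l) (fun l => x.2 l))

/-- The augmented data point `φ x = (π v, τ y)`, where `t` labels the transformation
`φ = (π t, τ t)`. -/
def augPoint {Θ : Type*} {d b : ℕ} (π : Θ → Vec d → Vec d) (τ : Θ → Vec b → Vec b)
    (t : Θ) (x : Vec d × Vec b) : Point d b :=
  toPoint (π t x.1, τ t x.2)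

/-- The augmented data `Φ_i X_i = (φ_{i1} X_i, …, φ_{ik} X_i)`, for `i = 1, …, n`. -/
def augData {Ω Θ : Type*} {n k d b : ℕ} (π : Θ → Vec d → Vec d) (τ : Θ → Vec b → Vec b)
    (X : Fin n → Ω → Vec d × Vec b) (φ : Fin n → Fin k → Ω → Θ) :
    Fin n → Ω → Block k d b :=
  fun i ω => WithLp.toLp 2 (fun p => augPoint π τ (φ i p.1 ω) (X i ω) p.2)

/-- The unaugmented data, replicated `k` times: `X̃_i = (X_i, …, X_i)`. -/
def repData {Ω : Type*} {n d b : ℕ} (k : ℕ) (X : Fin n → Ω → Vec d × Vec b) :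
    Fin n → Ω → Block k d b :=
  fun i ω => WithLp.toLp 2 (fun p => toPoint (X i ω) p.2)

/-- `X_1, …, X_n` i.i.d. with law `μ`, and independently of them `φ_{11}, …, φ_{nk}` i.i.d. with
law `ρ`. -/
structure IsAugmentedSample {Ω Θ : Type*} [MeasurableSpace Ω] [MeasurableSpace Θ] {n k d b : ℕ}
    (P : Measure Ω) (μ : Measure (Vec d × Vec b)) (ρ : Measure Θ)
    (X : Fin n → Ω → Vec d × Vec b) (φ : Fin n → Fin k → Ω → Θ) : Prop where
  law_X : ∀ i, HasLaw (X i) μ P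
  indep_X : iIndepFun X P
  law_φ : ∀ i j, HasLaw (φ i j) ρ P
  indep_φ : iIndepFun (fun p : Fin n × Fin k => φ p.1 p.2) P
  indep_X_φ : IndepFun (fun ω i => X i ω) (fun ω i j => φ i j ω) P

/-- Covariance matrix of a random vector. -/
def covMat {Ω ι : Type*} [MeasurableSpace Ω] (P : Measure Ω) (U : Ω → EuclideanSpace ℝ ι) :
    Matrix ι ι ℝ :=
  fun a a' => cov[fun ω => U ω a, fun ω => U ω a'; P]

/-- `𝔼[φ₁₁ X₁]` -/
def augMean {Θ : Type*} [MeasurableSpace Θ] {d b : ℕ} (μ : Measure (Vec d × Vec b))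
    (ρ : Measure Θ) (π : Θ → Vec d → Vec d) (τ : Θ → Vec b → Vec b) : Fin d ⊕ Fin b → ℝ :=
  fun a => ∫ p : Θ × (Vec d × Vec b), augPoint π τ p.1 p.2 a ∂(ρ.prod μ)

/-- `Σ₁₁ = Var[φ₁₁ X₁]` -/
def sigma11 {Θ : Type*} [MeasurableSpace Θ] {d b : ℕ} (μ : Measure (Vec d × Vec b))
    (ρ : Measure Θ) (π : Θ → Vec d → Vec d) (τ : Θ → Vec b → Vec b) :
    Matrix (Fin d ⊕ Fin b) (Fin d ⊕ Fin b) ℝ :=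
  covMat (ρ.prod μ) (fun p : Θ × (Vec d × Vec b) => augPoint π τ p.1 p.2)

/-- `Σ₁₂ = Cov[φ₁₁ X₁, φ₁₂ X₁]` -/
def sigma12 {Θ : Type*} [MeasurableSpace Θ] {d b : ℕ} (μ : Measure (Vec d × Vec b))
    (ρ : Measure Θ) (π : Θ → Vec d → Vec d) (τ : Θ → Vec b → Vec b) :
    Matrix (Fin d ⊕ Fin b) (Fin d ⊕ Fin b) ℝ :=
  fun a a' =>
    cov[fun p : (Θ × Θ) × (Vec d × Vec b) => augPoint π τ p.1.1 p.2 a,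
        fun p : (Θ × Θ) × (Vec d × Vec b) => augPoint π τ p.1.2 p.2 a'; (ρ.prod ρ).prod μ]

/-- `Z_1, …, Z_n` are i.i.d. Gaussian vectors in `ℝ^{k(d+b)}`, independent of the data blocks
`U_1, …, U_n`, with mean `1_{k×1} ⊗ m` and covariance `I_k ⊗ S₁₁ + (1_{k×k} - I_k) ⊗ S₁₂`. -/
structure IsGaussianSurrogate {Ω : Type*} [MeasurableSpace Ω] {n k d b : ℕ} (P : Measure Ω)
    (U Z : Fin n → Ω → Block k d b) (m : Fin d ⊕ Fin b → ℝ)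
    (S₁₁ S₁₂ : Matrix (Fin d ⊕ Fin b) (Fin d ⊕ Fin b) ℝ) : Prop where
  gaussian : ∀ i, HasGaussianLaw (Z i) P
  indep : iIndepFun Z P
  indep_data : IndepFun (fun ω i => U i ω) (fun ω i => Z i ω) P
  mean : ∀ i j a, ∫ ω, Z i ω (j, a) ∂P = m a
  covariance : ∀ i, covMat P (Z i) =
    (1 : Matrix (Fin k) (Fin k) ℝ) ⊗ₖ S₁₁ + (Matrix.of (fun _ _ => (1 : ℝ)) - 1) ⊗ₖ S₁₂

/-- Flattened Euclidean norm of the `r`-th derivative at `w` of `g : ℝ^ι → F`, that is, of the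
array of all partial derivatives of order `r`; for `r = 0` it is `‖g w‖`. -/
def derivNorm {ι F : Type*} [Fintype ι] [DecidableEq ι] [NormedAddCommGroup F] [NormedSpace ℝ F]
    (r : ℕ) (g : EuclideanSpace ℝ ι → F) (w : EuclideanSpace ℝ ι) : ℝ :=
  Real.sqrt (∑ a : Fin r → ι,
    ‖iteratedFDeriv ℝ r g w (fun s => EuclideanSpace.single (a s) (1 : ℝ))‖ ^ 2)

/-- `W_i(w) = (U_1, …, U_{i-1}, w, Z_{i+1}, …, Z_n)` -/
def interp {n : ℕ} {E : Type*} (u z : Fin n → E) (i : Fin n) (w : E) : Fin n → E :=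
  fun j => if j < i then u j else if j = i then w else z j

/-- `sup_{w ∈ [0, e]} ‖D_i^r f(W_i(w))‖` -/
def supDeriv {n k d b : ℕ} {F : Type*} [NormedAddCommGroup F] [NormedSpace ℝ F]
    (f : (Fin n → Block k d b) → F) (r : ℕ) (u z : Fin n → Block k d b) (i : Fin n)
    (e : Block k d b) : ℝ≥0∞ :=
  ⨆ w ∈ segment ℝ 0 e, ENNReal.ofReal (derivNorm r (fun w' => f (interp u z i w')) w)

/-- The noise stability `α^r_m` of `f`, with data blocks `U_i` and surrogates `Z_i`. -/
def alpha {Ω : Type*} [MeasurableSpace Ω] {n k d b : ℕ} {F : Type*} [NormedAddCommGroup F]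
    [NormedSpace ℝ F] (P : Measure Ω) (f : (Fin n → Block k d b) → F)
    (U Z : Fin n → Ω → Block k d b) (r : ℕ) (m : ℝ≥0∞) : ℝ≥0∞ :=
  ⨆ i : Fin n, max
    (eLpNorm (fun ω => supDeriv f r (fun j => U j ω) (fun j => Z j ω) i (U i ω)) m P)
    (eLpNorm (fun ω => supDeriv f r (fun j => U j ω) (fun j => Z j ω) i (Z i ω)) m P)

/-- The smoothness condition: for `a n r m = α^r_m` at sample size `n`, these numbers are finite
for large `n`, and the six products are `o(1 / (n k^{3/2}))`. -/
def SmoothnessCondition (k : ℕ → ℕ) (a : ℕ → ℕ → ℝ≥0∞ → ℝ≥0∞) : Prop :=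
  let s : ℕ → ℝ≥0∞ := fun n => ENNReal.ofReal ((n : ℝ) * (k n : ℝ) ^ (3 / 2 : ℝ))
  (∀ᶠ n in atTop, ∀ r ≤ 3, ∀ m ≤ 6, a n r m ≠ ∞) ∧
  Tendsto (fun n => s n * (a n 1 6) ^ 3) atTop (𝓝 0) ∧
  Tendsto (fun n => s n * (a n 0 6 * a n 1 6 * a n 2 6)) atTop (𝓝 0) ∧
  Tendsto (fun n => s n * ((a n 0 6) ^ 2 * a n 3 6)) atTop (𝓝 0) ∧
  Tendsto (fun n => s n * (a n 1 4 * a n 2 4)) atTop (𝓝 0) ∧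
  Tendsto (fun n => s n * (a n 0 4 * a n 3 4)) atTop (𝓝 0) ∧
  Tendsto (fun n => s n * a n 3 2) atTop (𝓝 0)

/-- `h : ℝ → ℝ` is three times differentiable. -/
def ThriceDifferentiable (h : ℝ → ℝ) : Prop := ∀ r < 3, Differentiable ℝ (iteratedDeriv r h)

/-- `γ³(h) = sup_x |h'''(x)|` -/
def gammaThree (h : ℝ → ℝ) : ℝ≥0∞ := ⨆ x : ℝ, ‖iteratedDeriv 3 h x‖ₑ

/-- `η^r(h) = |h^{(r)}(0)|` -/
def eta (r : ℕ) (h : ℝ → ℝ) : ℝ≥0∞ := ‖iteratedDeriv r h 0‖ₑ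

/-- The class `ℋ` of test functions on `ℝ`. -/
def testClass : Set (ℝ → ℝ) :=
  {h | ThriceDifferentiable h ∧ eta 1 h ≤ 1 ∧ eta 2 h ≤ 1 ∧ gammaThree h ≤ 1}

/-- `λ₂ = γ³(h) ((α¹₆)³ + 3 α⁰₆ α¹₆ α²₆ + (α⁰₆)² α³₆) + η²(h) (3 α¹₄ α²₄ + α⁰₄ α³₄) + η¹(h) α³₂` -/
def lambdaTwo (h : ℝ → ℝ) (a : ℕ → ℝ≥0∞ → ℝ≥0∞) : ℝ≥0∞ :=
  gammaThree h * ((a 1 6) ^ 3 + 3 * (a 0 6 * a 1 6 * a 2 6) + (a 0 6) ^ 2 * a 3 6) +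
    eta 2 h * (3 * (a 1 4 * a 2 4) + a 0 4 * a 3 4) + eta 1 h * a 3 2

/-- `d_ℋ(S, T) = sup_{h ∈ ℋ} |𝔼 h(S) - 𝔼 h(T)|` for real random variables. -/
def distH {Ω : Type*} [MeasurableSpace Ω] (P : Measure Ω) (S T : Ω → ℝ) : ℝ≥0∞ :=
  ⨆ h ∈ testClass, ENNReal.ofReal |(∫ ω, h (S ω) ∂P) - ∫ ω, h (T ω) ∂P|

/-- All expectations in `d_ℋ(S_n, T_n)` exist, and `d_ℋ(S_n, T_n) → 0`. -/
def DistHTendstoZero {Ω : ℕ → Type*} [∀ n, MeasurableSpace (Ω n)] (P : ∀ n, Measure (Ω n))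
    (S T : ∀ n, Ω n → ℝ) : Prop :=
  (∀ n, ∀ h ∈ testClass,
    Integrable (fun ω => h (S n ω)) (P n) ∧ Integrable (fun ω => h (T n ω)) (P n)) ∧
  Tendsto (fun n => distH (P n) (S n) (T n)) atTop (𝓝 0)

/-- Covariate `v_{ij}` of the data `x`. -/
def covariate {n k d b : ℕ} (x : Fin n → Block k d b) (i : Fin n) (j : Fin k) : Fin d → ℝ :=
  fun l => x i (j, Sum.inl l)

/-- Response `y_{ij}` of the data `x`. -/
def response {n k d b : ℕ} (x : Fin n → Block k d b) (i : Fin n) (j : Fin k) : Fin b → ℝ :=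
  fun l => x i (j, Sum.inr l)

/-- The ridge estimator
`B̂ = (∑_{ij} v_{ij} v_{ij}ᵀ + n k λ I_d)⁻¹ ∑_{ij} v_{ij} y_{ij}ᵀ ∈ ℝ^{d×b}`. -/
def ridge {n k d b : ℕ} (lam : ℝ) (x : Fin n → Block k d b) : Matrix (Fin d) (Fin b) ℝ :=
  ((∑ i, ∑ j, Matrix.vecMulVec (covariate x i j) (covariate x i j)) +
      ((n : ℝ) * (k : ℝ) * lam) • (1 : Matrix (Fin d) (Fin d) ℝ))⁻¹ *
    ∑ i, ∑ j, Matrix.vecMulVec (covariate x i j) (response x i j)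

/-- `B̂` flattened to a vector, whose Euclidean norm is the Frobenius norm of `B̂`. -/
def ridgeVec {n k d b : ℕ} (lam : ℝ) (x : Fin n → Block k d b) :
    EuclideanSpace ℝ (Fin d × Fin b) :=
  WithLp.toLp 2 (fun p => ridge lam x p.1 p.2)

/-- The risk `R(B) = 𝔼 ‖Y_new - Bᵀ V_new‖²`, where `(V_new, Y_new) ∼ ν`. -/
def risk {d b : ℕ} (ν : Measure (Vec d × Vec b)) (B : Matrix (Fin d) (Fin b) ℝ) : ℝ :=
  ∫ p : Vec d × Vec b, ∑ s, (p.2 s - (B.transpose.mulVec (fun l => p.1 l)) s) ^ 2 ∂ν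

/-- The risk `R(B̂)` as a function of the data. -/
def ridgeRisk {n k d b : ℕ} (lam : ℝ) (ν : Measure (Vec d × Vec b)) (x : Fin n → Block k d b) : ℝ :=
  risk ν (ridge lam x)

/-- Frobenius norm. -/
def frob {ι : Type*} [Fintype ι] (A : Matrix ι ι ℝ) : ℝ :=
  Real.sqrt (∑ a, ∑ a', A a a' ^ 2)

/-- Coordinate decay: with the constant `C`, almost surely every covariate coordinate of every
`U_i` is at most `C d^{-1/2}` and every response coordinate at most `C b^{-1/2}` in absolute
value. -/
def CoordinateDecay {Ω : Type*} [MeasurableSpace Ω] {n k d b : ℕ} (P : Measure Ω)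
    (U : Fin n → Ω → Block k d b) (C : ℝ) : Prop :=
  ∀ i j, ∀ᵐ ω ∂P, (∀ l, |U i ω (j, Sum.inl l)| ≤ C * (d : ℝ) ^ (-(1 / 2) : ℝ)) ∧
    (∀ l, |U i ω (j, Sum.inr l)| ≤ C * (b : ℝ) ^ (-(1 / 2) : ℝ))

end

/-! The estimator solves a linear equation M B̂ = A, where M = ∑ v vᵀ + nkλ I and A = ∑ v yᵀ are
quadratic in every block and M ≥ nkλ I whatever the data. Differentiating this equation bounds the
partial derivatives of B̂ of order at most three: a coordinate direction at a point x_ij enters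
either alone, with weight ‖x_ij‖/(nkλ), or paired with a second direction at the same point, with
weight 1/(nkλ); directions at different points never pair. `DerivShape` records this pattern
(`derivShape_ridgeVec`). The pattern survives sums, linear maps and bilinear maps, so it holds for
every quadratic function of B̂, and the risk is one (`isQuadraticBounded_flatRisk`).

Put D = d + b. Summing squares over coordinates, the flattened derivatives in one block have the
orders 1, √(Dk)/(nk), D√k/(nk) and D^{3/2}k/(nk)² (`derivRate`), up to a random factor (`envelope`)
whose L⁶ norm is bounded uniformly, both for data with decaying coordinates and for their Gaussian
surrogates. Multiplied by nk^{3/2}, each of the six products in the smoothness condition is then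
O(D^{3/2}k^{1/2}/n), which tends to zero by the growth assumption (`smoothnessCondition_of_le`).

The comparison of laws is Lindeberg's argument (`GaussianMatch.lindeberg`). Blocks are exchanged one
at a time, and h ∘ f is expanded to second order around 0 in the exchanged block. The coefficients
are independent of that block, and the data block and its surrogate share their first two moments,
so both Taylor polynomials have the same expectation. Hölder's inequality bounds the remainders by
λ₂ times the root of a sixth moment. The sixth moment of the Gaussian block is controlled by that of
the data block (`GaussianMatch.lintegral_pow_six_le`), which is O(k³), so the n exchanges cost
O(nk^{3/2}λ₂) in total.

The variance statement follows by duality. A Frobenius norm is attained at a unit matrix, so the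
difference of the covariance matrices is controlled by differences of expectations of linear and
quadratic functions of B̂ with coefficients of norm at most 1 (`exists_frob_covMat_sub_le`). These
functions may depend on n, the derivative bounds are uniform over them, and the Lindeberg estimate
with h(y) = y applies. -/

/-! ### Iterated directional derivatives, and the bounds inherited by sums, products and solutions
of linear equations. -/

section DirectionalDerivatives

variable {E F G H : Type*} [NormedAddCommGroup E] [NormedSpace ℝ E]
  [NormedAddCommGroup F] [NormedSpace ℝ F] [NormedAddCommGroup G] [NormedSpace ℝ G]
  [NormedAddCommGroup H] [NormedSpace ℝ H]

/-- The derivative of `g` in the fixed direction `e`, as a function of the base point. -/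
noncomputable def dirDeriv (e : E) (g : E → F) : E → F := fun w => fderiv ℝ g w e

theorem ContDiff.dirDeriv {n : ℕ} {g : E → F} (hg : ContDiff ℝ (n + 1 : ℕ) g) (e : E) :
    ContDiff ℝ n (dirDeriv e g) := by
  have h : ContDiff ℝ n (fderiv ℝ g) := hg.fderiv_right (by norm_cast)
  exact h.clm_apply contDiff_const

theorem dirDeriv_bilinear (m : F →L[ℝ] G →L[ℝ] H) {g : E → F} {h : E → G}
    (hg : Differentiable ℝ g) (hh : Differentiable ℝ h) (e : E) :
    dirDeriv e (fun w => m (g w) (h w)) =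
      fun w => m (dirDeriv e g w) (h w) + m (g w) (dirDeriv e h w) := by
  funext w
  simp only [dirDeriv]
  rw [m.fderiv_of_bilinear (hg w) (hh w)]
  simp [add_comm]

theorem dirDeriv_clm (l : F →L[ℝ] G) {g : E → F} (hg : Differentiable ℝ g) (e : E) :
    dirDeriv e (fun w => l (g w)) = fun w => l (dirDeriv e g w) := by
  funext w
  simp only [dirDeriv]
  have h := (l.hasFDerivAt.comp w (hg w).hasFDerivAt).fderiv
  change fderiv ℝ (l ∘ g) w e = _
  rw [h]; rfl

theorem dirDeriv_add {g h : E → F} (hg : Differentiable ℝ g) (hh : Differentiable ℝ h) (e : E) :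
    dirDeriv e (fun w => g w + h w) = fun w => dirDeriv e g w + dirDeriv e h w := by
  funext w
  simp only [dirDeriv]
  rw [fderiv_fun_add (hg w) (hh w)]; rfl

theorem dirDeriv_const (c : F) (e : E) : dirDeriv e (fun _ : E => c) = fun _ => 0 := by
  funext w
  simp [dirDeriv]

/-- The slot `m 0` is the derivative taken last. Iterating turns partial derivatives into nested
`dirDeriv`, to which the Leibniz rule applies directly. -/
theorem iteratedFDeriv_succ_eq_dirDeriv {r : ℕ} {g : E → F} (hg : ContDiff ℝ (r + 1 : ℕ) g)
    (m : Fin (r + 1) → E) :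
    (fun w => iteratedFDeriv ℝ (r + 1) g w m) =
      dirDeriv (m 0) (fun w => iteratedFDeriv ℝ r g w (Fin.tail m)) := by
  funext w
  rw [iteratedFDeriv_succ_apply_left, dirDeriv, fderiv_continuousMultilinear_apply_const_apply]
  exact (hg.differentiable_iteratedFDeriv (by norm_cast; omega)) w

theorem iteratedFDeriv_one_eq_dirDeriv {g : E → F} (hg : ContDiff ℝ 1 g) (m : Fin 1 → E) (w : E) :
    iteratedFDeriv ℝ 1 g w m = dirDeriv (m 0) g w := by
  have h := congrFun (iteratedFDeriv_succ_eq_dirDeriv (r := 0) (by simpa using hg) m) w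
  simpa using h

theorem iteratedFDeriv_two_eq_dirDeriv {g : E → F} (hg : ContDiff ℝ 2 g) (m : Fin 2 → E) (w : E) :
    iteratedFDeriv ℝ 2 g w m = dirDeriv (m 0) (dirDeriv (m 1) g) w := by
  have h := congrFun (iteratedFDeriv_succ_eq_dirDeriv (r := 1) (by simpa using hg) m) w
  rw [h]
  congr 1
  funext v
  exact iteratedFDeriv_one_eq_dirDeriv (hg.of_le (by norm_num)) _ v

theorem iteratedFDeriv_three_eq_dirDeriv {g : E → F} (hg : ContDiff ℝ 3 g) (m : Fin 3 → E)
    (w : E) :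
    iteratedFDeriv ℝ 3 g w m = dirDeriv (m 0) (dirDeriv (m 1) (dirDeriv (m 2) g)) w := by
  have h := congrFun (iteratedFDeriv_succ_eq_dirDeriv (r := 2) (by simpa using hg) m) w
  rw [h]
  congr 1
  funext v
  exact iteratedFDeriv_two_eq_dirDeriv (hg.of_le (by norm_num)) _ v

/-- Bounds on the derivatives of order at most three of `g` at `w`, in the directions `e p`. They
have the form of the partial derivatives of a function of quadratic forms: every direction enters
either alone, with weight `t p`, or paired with another one, with weight `Δ p q`. -/
structure DerivShape {ι : Type*} (e : ι → E) (t : ι → ℝ) (Δ : ι → ι → ℝ) (g : E → F) (w : E)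
    (κ : ℝ) : Prop where
  zero : ‖g w‖ ≤ κ
  one : ∀ p, ‖dirDeriv (e p) g w‖ ≤ κ * t p
  two : ∀ p q, ‖dirDeriv (e p) (dirDeriv (e q) g) w‖ ≤ κ * (t p * t q + Δ p q)
  three : ∀ p q s, ‖dirDeriv (e p) (dirDeriv (e q) (dirDeriv (e s) g)) w‖ ≤
    κ * (t p * t q * t s + Δ p q * t s + Δ p s * t q + Δ q s * t p)

namespace DerivShape

variable {ι : Type*} {e : ι → E} {t : ι → ℝ} {Δ : ι → ι → ℝ}

theorem nonneg {g : E → F} {w : E} {κ : ℝ} (h : DerivShape e t Δ g w κ) : 0 ≤ κ :=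
  (norm_nonneg _).trans h.zero

theorem const (ht : ∀ p, 0 ≤ t p) (hΔ : ∀ p q, 0 ≤ Δ p q) (c : F) (w : E) :
    DerivShape e t Δ (fun _ : E => c) w ‖c‖ where
  zero := le_rfl
  one p := by rw [dirDeriv_const]; have := ht p; simp; positivity
  two p q := by
    rw [dirDeriv_const, dirDeriv_const]
    have := ht p; have := ht q; have := hΔ p q; simp; positivity
  three p q s := by
    rw [dirDeriv_const, dirDeriv_const, dirDeriv_const]
    have := ht p; have := ht q; have := ht s; have := hΔ p q; have := hΔ p s; have := hΔ q s
    simp; positivity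

theorem add {g h : E → F} (hgC : ContDiff ℝ 3 g) (hhC : ContDiff ℝ 3 h) {w : E} {κ₁ κ₂ : ℝ}
    (hg : DerivShape e t Δ g w κ₁) (hh : DerivShape e t Δ h w κ₂) :
    DerivShape e t Δ (fun v => g v + h v) w (κ₁ + κ₂) := by
  have g1 := fun p => ContDiff.dirDeriv (n := 2) hgC (e p)
  have h1 := fun p => ContDiff.dirDeriv (n := 2) hhC (e p)
  have g2 := fun p q => ContDiff.dirDeriv (n := 1) (g1 q) (e p)
  have h2 := fun p q => ContDiff.dirDeriv (n := 1) (h1 q) (e p)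
  have E1 := fun p => dirDeriv_add (hgC.differentiable (by norm_num))
    (hhC.differentiable (by norm_num)) (e p)
  have E2 := fun p q => dirDeriv_add ((g1 q).differentiable (by norm_num))
    ((h1 q).differentiable (by norm_num)) (e p)
  have E3 := fun p q s => dirDeriv_add ((g2 q s).differentiable (by norm_num))
    ((h2 q s).differentiable (by norm_num)) (e p)
  refine ⟨(norm_add_le _ _).trans (add_le_add hg.zero hh.zero), fun p => ?_, fun p q => ?_,
    fun p q s => ?_⟩
  · rw [E1, add_mul]
    exact (norm_add_le _ _).trans (add_le_add (hg.one p) (hh.one p))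
  · rw [E1, E2, add_mul]
    exact (norm_add_le _ _).trans (add_le_add (hg.two p q) (hh.two p q))
  · rw [E1, E2, E3, add_mul]
    exact (norm_add_le _ _).trans (add_le_add (hg.three p q s) (hh.three p q s))

theorem clm (l : F →L[ℝ] G) {K : ℝ} (hl : ‖l‖ ≤ K) {g : E → F} (hgC : ContDiff ℝ 3 g) {w : E}
    {κ : ℝ} (hg : DerivShape e t Δ g w κ) :
    DerivShape e t Δ (fun v => l (g v)) w (K * κ) := by
  have g1 := fun p => ContDiff.dirDeriv (n := 2) hgC (e p)
  have g2 := fun p q => ContDiff.dirDeriv (n := 1) (g1 q) (e p)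
  have E1 := fun p => dirDeriv_clm l (hgC.differentiable (by norm_num)) (e p)
  have E2 := fun p q => dirDeriv_clm l ((g1 q).differentiable (by norm_num)) (e p)
  have E3 := fun p q s => dirDeriv_clm l ((g2 q s).differentiable (by norm_num)) (e p)
  have hK : 0 ≤ K := (norm_nonneg _).trans hl
  have key : ∀ {x : F} {c : ℝ}, ‖x‖ ≤ c → ‖l x‖ ≤ K * c := fun {x c} hx =>
    (l.le_opNorm x).trans (mul_le_mul hl hx (norm_nonneg _) hK)
  refine ⟨key hg.zero, fun p => ?_, fun p q => ?_, fun p q s => ?_⟩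
  · rw [E1, mul_assoc]; exact key (hg.one p)
  · rw [E1, E2, mul_assoc]; exact key (hg.two p q)
  · rw [E1, E2, E3, mul_assoc]; exact key (hg.three p q s)

end DerivShape

/-- Second derivatives of a bilinear expression. -/
theorem dirDeriv_dirDeriv_bilinear (m : F →L[ℝ] G →L[ℝ] H) {g : E → F} {h : E → G}
    (hg : ContDiff ℝ 2 g) (hh : ContDiff ℝ 2 h) (e e' : E) :
    dirDeriv e (dirDeriv e' (fun w => m (g w) (h w))) = fun w =>
      m (dirDeriv e (dirDeriv e' g) w) (h w) + m (dirDeriv e' g w) (dirDeriv e h w) +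
      (m (dirDeriv e g w) (dirDeriv e' h w) + m (g w) (dirDeriv e (dirDeriv e' h) w)) := by
  have g0 : Differentiable ℝ g := hg.differentiable (by norm_num)
  have h0 : Differentiable ℝ h := hh.differentiable (by norm_num)
  have g1 := (ContDiff.dirDeriv (n := 1) hg e')
  have h1 := (ContDiff.dirDeriv (n := 1) hh e')
  have g1' := g1.differentiable (by norm_num)
  have h1' := h1.differentiable (by norm_num)
  rw [dirDeriv_bilinear m g0 h0, dirDeriv_add (by fun_prop) (by fun_prop),
    dirDeriv_bilinear m g1' h0, dirDeriv_bilinear m g0 h1']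

/-- Third derivatives of a bilinear expression. -/
theorem dirDeriv_dirDeriv_dirDeriv_bilinear (m : F →L[ℝ] G →L[ℝ] H) {g : E → F} {h : E → G}
    (hg : ContDiff ℝ 3 g) (hh : ContDiff ℝ 3 h) (e e' e'' : E) (w : E) :
    dirDeriv e (dirDeriv e' (dirDeriv e'' (fun w => m (g w) (h w)))) w =
      m (dirDeriv e (dirDeriv e' (dirDeriv e'' g)) w) (h w) +
      m (dirDeriv e' (dirDeriv e'' g) w) (dirDeriv e h w) +
      m (dirDeriv e (dirDeriv e'' g) w) (dirDeriv e' h w) +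
      m (dirDeriv e'' g w) (dirDeriv e (dirDeriv e' h) w) +
      m (dirDeriv e (dirDeriv e' g) w) (dirDeriv e'' h w) +
      m (dirDeriv e' g w) (dirDeriv e (dirDeriv e'' h) w) +
      m (dirDeriv e g w) (dirDeriv e' (dirDeriv e'' h) w) +
      m (g w) (dirDeriv e (dirDeriv e' (dirDeriv e'' h)) w) := by
  have g0 : Differentiable ℝ g := hg.differentiable (by norm_num)
  have h0 : Differentiable ℝ h := hh.differentiable (by norm_num)
  have g1 : ContDiff ℝ 2 (dirDeriv e'' g) := ContDiff.dirDeriv (n := 2) hg e''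
  have h1 : ContDiff ℝ 2 (dirDeriv e'' h) := ContDiff.dirDeriv (n := 2) hh e''
  rw [dirDeriv_bilinear m g0 h0]
  have hA : ContDiff ℝ 2 (fun w => m (dirDeriv e'' g w) (h w)) :=
    (m.contDiff.comp g1).clm_apply (hh.of_le (by norm_num))
  have hB : ContDiff ℝ 2 (fun w => m (g w) (dirDeriv e'' h w)) :=
    (m.contDiff.comp (hg.of_le (by norm_num))).clm_apply h1
  have hA1 := (ContDiff.dirDeriv (n := 1) hA e').differentiable (by norm_num)
  have hB1 := (ContDiff.dirDeriv (n := 1) hB e').differentiable (by norm_num)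
  rw [dirDeriv_add (hA.differentiable (by norm_num)) (hB.differentiable (by norm_num)),
    dirDeriv_add hA1 hB1, dirDeriv_dirDeriv_bilinear m g1 (hh.of_le (by norm_num)),
    dirDeriv_dirDeriv_bilinear m (hg.of_le (by norm_num)) h1]
  simp only [add_assoc]

namespace DerivShape

variable {ι : Type*} {e : ι → E} {t : ι → ℝ} {Δ : ι → ι → ℝ}

/-- The Leibniz rule produces at most 2³ = 8 products. In each of them the weights of the two
factors multiply to a sum of monomials already present in the bound for the full derivative, so the
shape is closed under products; 8 serves for all orders. -/
theorem bilinear (ht : ∀ p, 0 ≤ t p) (hΔ : ∀ p q, 0 ≤ Δ p q)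
    (m : F →L[ℝ] G →L[ℝ] H) {K : ℝ} (hm : ‖m‖ ≤ K) {g : E → F} {h : E → G}
    (hgC : ContDiff ℝ 3 g) (hhC : ContDiff ℝ 3 h) {w : E} {κ₁ κ₂ : ℝ}
    (hg : DerivShape e t Δ g w κ₁) (hh : DerivShape e t Δ h w κ₂) :
    DerivShape e t Δ (fun v => m (g v) (h v)) w (8 * K * (κ₁ * κ₂)) := by
  have hK : 0 ≤ K := m.opNorm_nonneg.trans hm
  have k1 := hg.nonneg
  have k2 := hh.nonneg
  set c := K * (κ₁ * κ₂) with hc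
  have hc0 : 0 ≤ c := by positivity
  have key : ∀ {x : F} {y : G} {a b : ℝ}, ‖x‖ ≤ κ₁ * a → ‖y‖ ≤ κ₂ * b →
      ‖m x y‖ ≤ c * (a * b) := by
    intro x y a b hx hy
    calc ‖m x y‖ ≤ ‖m‖ * ‖x‖ * ‖y‖ := m.le_opNorm₂ x y
      _ ≤ K * (κ₁ * a) * (κ₂ * b) := by
        have := (norm_nonneg _).trans hx
        gcongr
      _ = _ := by rw [hc]; ring
  have z1 : ‖g w‖ ≤ κ₁ * 1 := by simpa using hg.zero
  have z2 : ‖h w‖ ≤ κ₂ * 1 := by simpa using hh.zero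
  have g2C : ContDiff ℝ 2 g := hgC.of_le (by norm_num)
  have h2C : ContDiff ℝ 2 h := hhC.of_le (by norm_num)
  refine ⟨?_, fun p => ?_, fun p q => ?_, fun p q s => ?_⟩
  · refine (key z1 z2).trans ?_
    have : 8 * K * (κ₁ * κ₂) = 8 * c := by rw [hc]; ring
    rw [this]; linarith
  · rw [dirDeriv_bilinear m (hgC.differentiable (by norm_num))
      (hhC.differentiable (by norm_num))]
    refine (norm_add_le _ _).trans
      ((add_le_add (key (hg.one p) z2) (key z1 (hh.one p))).trans ?_)
    have : 8 * K * (κ₁ * κ₂) * t p = 8 * (c * t p) := by rw [hc]; ring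
    have := mul_nonneg hc0 (ht p)
    nlinarith
  · rw [dirDeriv_dirDeriv_bilinear m g2C h2C]
    refine (norm_add_le _ _).trans ((add_le_add
      ((norm_add_le _ _).trans (add_le_add (key (hg.two p q) z2) (key (hg.one q) (hh.one p))))
      ((norm_add_le _ _).trans
        (add_le_add (key (hg.one p) (hh.one q)) (key z1 (hh.two p q))))).trans ?_)
    have e1 : 8 * K * (κ₁ * κ₂) * (t p * t q + Δ p q) =
      8 * (c * (t p * t q)) + 8 * (c * Δ p q) := by rw [hc]; ring
    have := mul_nonneg hc0 (mul_nonneg (ht p) (ht q))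
    have := mul_nonneg hc0 (hΔ p q)
    linarith
  · rw [dirDeriv_dirDeriv_dirDeriv_bilinear m hgC hhC]
    have b1 := key (hg.three p q s) z2
    have b2 := key (hg.two q s) (hh.one p)
    have b3 := key (hg.two p s) (hh.one q)
    have b4 := key (hg.one s) (hh.two p q)
    have b5 := key (hg.two p q) (hh.one s)
    have b6 := key (hg.one q) (hh.two p s)
    have b7 := key (hg.one p) (hh.two q s)
    have b8 := key z1 (hh.three p q s)
    refine (norm_add_le_of_le (norm_add_le_of_le (norm_add_le_of_le (norm_add_le_of_le
      (norm_add_le_of_le (norm_add_le_of_le (norm_add_le_of_le b1 b2) b3) b4) b5) b6) b7)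
      b8).trans ?_
    have e1 : 8 * K * (κ₁ * κ₂) * (t p * t q * t s + Δ p q * t s + Δ p s * t q + Δ q s * t p) =
      8 * (c * (t p * t q * t s)) + 8 * (c * (Δ p q * t s)) + 8 * (c * (Δ p s * t q)) +
        8 * (c * (Δ q s * t p)) := by rw [hc]; ring
    have := mul_nonneg hc0 (mul_nonneg (mul_nonneg (ht p) (ht q)) (ht s))
    have := mul_nonneg hc0 (mul_nonneg (hΔ p q) (ht s))
    have := mul_nonneg hc0 (mul_nonneg (hΔ p s) (ht q))
    have := mul_nonneg hc0 (mul_nonneg (hΔ q s) (ht p))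
    linarith

/-- Derivatives of the solution `B` of a linear equation `M B = A` whose coefficient and right-hand
side are quadratic. -/
theorem of_linear_equation (ht : ∀ p, 0 ≤ t p) (hΔ : ∀ p q, 0 ≤ Δ p q)
    {M : E → F →L[ℝ] F} {A B : E → F} (hM : ContDiff ℝ 3 M)
    (hB : ContDiff ℝ 3 B) (hMB : ∀ v, M v (B v) = A v) {w : E} {ε β : ℝ} (hε : 0 ≤ ε)
    (hcoer : ∀ x, ‖x‖ ≤ ε * ‖M w x‖) (hβ : 1 + ‖B w‖ ≤ β)
    (hM1 : ∀ p, ε * ‖dirDeriv (e p) M w‖ ≤ 2 * t p)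
    (hM2 : ∀ p q, ε * ‖dirDeriv (e p) (dirDeriv (e q) M) w‖ ≤ 2 * Δ p q)
    (hM3 : ∀ p q s, dirDeriv (e p) (dirDeriv (e q) (dirDeriv (e s) M)) w = 0)
    (hA1 : ∀ p, ε * ‖dirDeriv (e p) A w‖ ≤ 2 * t p)
    (hA2 : ∀ p q, ε * ‖dirDeriv (e p) (dirDeriv (e q) A) w‖ ≤ 2 * Δ p q)
    (hA3 : ∀ p q s, dirDeriv (e p) (dirDeriv (e q) (dirDeriv (e s) A)) w = 0) :
    DerivShape e t Δ B w (48 * β) := by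
  have hMB' : (fun v => ContinuousLinearMap.id ℝ (F →L[ℝ] F) (M v) (B v)) = A := funext hMB
  have E1 := fun p => congrFun (hMB' ▸ dirDeriv_bilinear (ContinuousLinearMap.id ℝ (F →L[ℝ] F))
    (hM.differentiable (by norm_num)) (hB.differentiable (by norm_num)) (e p)) w
  have E2 := fun p q => congrFun (hMB' ▸ dirDeriv_dirDeriv_bilinear
    (ContinuousLinearMap.id ℝ (F →L[ℝ] F)) (hM.of_le (by norm_num)) (hB.of_le (by norm_num))
    (e p) (e q)) w
  have E3 := fun p q s => hMB' ▸ dirDeriv_dirDeriv_dirDeriv_bilinear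
    (ContinuousLinearMap.id ℝ (F →L[ℝ] F)) hM hB (e p) (e q) (e s) w
  simp only [ContinuousLinearMap.coe_id', id_eq] at E1 E2 E3
  have hβ1 : 1 ≤ β := le_trans (by have := norm_nonneg (B w); linarith) hβ
  have hBβ : ‖B w‖ ≤ β - 1 := by linarith
  have key : ∀ {L : F →L[ℝ] F} {x : F} {a b : ℝ}, ε * ‖L‖ ≤ a → ‖x‖ ≤ b →
      ε * ‖L x‖ ≤ a * b := by
    intro L x a b hL hx
    calc ε * ‖L x‖ ≤ ε * (‖L‖ * ‖x‖) := by gcongr; exact L.le_opNorm x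
      _ = (ε * ‖L‖) * ‖x‖ := by ring
      _ ≤ a * b := by
        have := (mul_nonneg hε (norm_nonneg L)).trans hL
        gcongr
  have tri : ∀ {x y : F} {a b : ℝ}, ε * ‖x‖ ≤ a → ε * ‖y‖ ≤ b → ε * ‖x - y‖ ≤ a + b := by
    intro x y a b hx hy
    have := mul_le_mul_of_nonneg_left (norm_sub_le x y) hε
    linarith
  -- At each order, the differentiated equation isolates M applied to the highest derivative of B,
  -- and coercivity inverts M at the cost ε. The summand 1 in β absorbs the derivative of A: 2t +
  -- 2t(β - 1) = 2βt.
  have B1 : ∀ p, ‖dirDeriv (e p) B w‖ ≤ 2 * β * t p := by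
    intro p
    refine (hcoer _).trans ?_
    have : M w (dirDeriv (e p) B w) = dirDeriv (e p) A w - dirDeriv (e p) M w (B w) := by
      rw [E1]; abel
    rw [this]
    refine (tri (hA1 p) (key (hM1 p) hBβ)).trans (le_of_eq (by ring))
  have B2 : ∀ p q, ‖dirDeriv (e p) (dirDeriv (e q) B) w‖ ≤
      2 * β * Δ p q + 8 * β * (t p * t q) := by
    intro p q
    refine (hcoer _).trans ?_
    have : M w (dirDeriv (e p) (dirDeriv (e q) B) w) = dirDeriv (e p) (dirDeriv (e q) A) w -
        dirDeriv (e p) (dirDeriv (e q) M) w (B w) - dirDeriv (e q) M w (dirDeriv (e p) B w) -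
        dirDeriv (e p) M w (dirDeriv (e q) B w) := by
      rw [E2]; abel
    rw [this]
    refine (tri (tri (tri (hA2 p q) (key (hM2 p q) hBβ)) (key (hM1 q) (B1 p)))
      (key (hM1 p) (B1 q))).trans (le_of_eq (by ring))
  refine ⟨by linarith, fun p => (B1 p).trans ?_, fun p q => (B2 p q).trans ?_, fun p q s => ?_⟩
  · have := ht p
    gcongr; norm_num
  · have := mul_nonneg (ht p) (ht q)
    have := hΔ p q
    nlinarith [mul_nonneg (by linarith : 0 ≤ β) (hΔ p q),
      mul_nonneg (by linarith : 0 ≤ β) (mul_nonneg (ht p) (ht q))]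
  · refine (hcoer _).trans ?_
    -- Third derivatives of M and A vanish, so six products remain: three pair a second derivative
    -- of M with ∂B, three pair ∂M with ∂²B. They add up to 48 β ttt and 8 β for each term Δt,
    -- whence the constant 48.
    have : M w (dirDeriv (e p) (dirDeriv (e q) (dirDeriv (e s) B)) w) =
        0 -
        dirDeriv (e q) (dirDeriv (e s) M) w (dirDeriv (e p) B w) -
        dirDeriv (e p) (dirDeriv (e s) M) w (dirDeriv (e q) B w) -
        dirDeriv (e s) M w (dirDeriv (e p) (dirDeriv (e q) B) w) -
        dirDeriv (e p) (dirDeriv (e q) M) w (dirDeriv (e s) B w) -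
        dirDeriv (e q) M w (dirDeriv (e p) (dirDeriv (e s) B) w) -
        dirDeriv (e p) M w (dirDeriv (e q) (dirDeriv (e s) B) w) := by
      rw [← hA3 p q s, E3, hM3]; simp only [_root_.zero_apply]; abel
    rw [this]
    have z : ε * ‖(0 : F)‖ ≤ 0 := by simp
    refine (tri (tri (tri (tri (tri (tri z (key (hM2 q s) (B1 p))) (key (hM2 p s) (B1 q)))
      (key (hM1 s) (B2 p q))) (key (hM2 p q) (B1 s))) (key (hM1 q) (B2 p s)))
      (key (hM1 p) (B2 q s))).trans ?_
    have hb : 0 ≤ β := by linarith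
    have := mul_nonneg hb (mul_nonneg (mul_nonneg (ht p) (ht q)) (ht s))
    have := mul_nonneg hb (mul_nonneg (hΔ p q) (ht s))
    have := mul_nonneg hb (mul_nonneg (hΔ p s) (ht q))
    have := mul_nonneg hb (mul_nonneg (hΔ q s) (ht p))
    nlinarith

end DerivShape

end DirectionalDerivatives

/-! ### The flattened norm of a derivative and its evaluation for the derivative shape. -/

section FlattenedNorm

variable {ι F : Type*} [Fintype ι] [DecidableEq ι] [NormedAddCommGroup F] [NormedSpace ℝ F]

theorem derivNorm_nonneg (r : ℕ) (g : EuclideanSpace ℝ ι → F) (w : EuclideanSpace ℝ ι) :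
    0 ≤ derivNorm r g w := Real.sqrt_nonneg _

theorem derivNorm_zero (g : EuclideanSpace ℝ ι → F) (w : EuclideanSpace ℝ ι) :
    derivNorm 0 g w = ‖g w‖ := by
  simp [derivNorm]

theorem norm_iteratedFDeriv_single_le_derivNorm (r : ℕ) (g : EuclideanSpace ℝ ι → F)
    (w : EuclideanSpace ℝ ι) (a : Fin r → ι) :
    ‖iteratedFDeriv ℝ r g w (fun s => EuclideanSpace.single (a s) (1 : ℝ))‖ ≤ derivNorm r g w := by
  refine Real.le_sqrt_of_sq_le ?_
  exact Finset.single_le_sum (f := fun a : Fin r → ι =>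
    ‖iteratedFDeriv ℝ r g w (fun s => EuclideanSpace.single (a s) (1 : ℝ))‖ ^ 2)
    (fun _ _ => by positivity) (Finset.mem_univ a)

theorem EuclideanSpace.eq_sum_smul_single (x : EuclideanSpace ℝ ι) :
    x = ∑ p, x p • EuclideanSpace.single p (1 : ℝ) := by
  ext q
  simp [Pi.single_apply]

theorem iteratedFDeriv_diag_eq_sum (r : ℕ) (g : EuclideanSpace ℝ ι → F)
    (w x : EuclideanSpace ℝ ι) :
    iteratedFDeriv ℝ r g w (fun _ => x) = ∑ a : Fin r → ι, (∏ s, x (a s)) •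
      iteratedFDeriv ℝ r g w (fun s => EuclideanSpace.single (a s) (1 : ℝ)) := by
  conv_lhs => rw [EuclideanSpace.eq_sum_smul_single x]
  rw [ContinuousMultilinearMap.map_sum]
  refine Finset.sum_congr rfl fun a _ => ?_
  exact ContinuousMultilinearMap.map_smul_univ _ (fun s => x (a s)) _

omit [DecidableEq ι] in
theorem sum_prod_sq_eq_norm_pow (r : ℕ) (x : EuclideanSpace ℝ ι) :
    ∑ a : Fin r → ι, (∏ s, x (a s)) ^ 2 = (‖x‖ ^ r) ^ 2 := by
  have h := Finset.prod_univ_sum (fun _ : Fin r => (Finset.univ : Finset ι))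
    (fun _ p => x p ^ 2)
  rw [Fintype.piFinset_univ] at h
  simp only [Finset.prod_pow] at h
  rw [← h, ← pow_mul, mul_comm, pow_mul, EuclideanSpace.norm_sq_eq]
  simp

/-- Cauchy–Schwarz for the flattened norm. -/
theorem norm_iteratedFDeriv_diag_le (r : ℕ) (g : EuclideanSpace ℝ ι → F)
    (w x : EuclideanSpace ℝ ι) :
    ‖iteratedFDeriv ℝ r g w (fun _ => x)‖ ≤ derivNorm r g w * ‖x‖ ^ r := by
  rw [iteratedFDeriv_diag_eq_sum]
  refine (norm_sum_le _ _).trans ?_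
  simp only [norm_smul]
  refine (Real.sum_mul_le_sqrt_mul_sqrt _ _ _).trans (le_of_eq ?_)
  rw [mul_comm]
  congr 1
  simp only [Real.norm_eq_abs, sq_abs]
  rw [sum_prod_sq_eq_norm_pow, Real.sqrt_sq (by positivity)]

omit [DecidableEq ι] in
theorem sum_fin_succ_arrow {r : ℕ} (f : (Fin (r + 1) → ι) → ℝ) :
    ∑ a, f a = ∑ p, ∑ a : Fin r → ι, f (Fin.cons p a) := by
  rw [← Fintype.sum_prod_type']
  exact (Fintype.sum_equiv (Fin.consEquiv (fun _ => ι)) _ _ (fun _ => rfl)).symm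

omit [DecidableEq ι] in
theorem sum_fin_zero_arrow (f : (Fin 0 → ι) → ℝ) : ∑ a, f a = f Fin.elim0 := by
  rw [Fintype.sum_unique]
  congr 1

namespace DerivShape

variable {t : ι → ℝ} {Δ : ι → ι → ℝ} {g : EuclideanSpace ℝ ι → F} {w : EuclideanSpace ℝ ι} {κ : ℝ}

theorem derivNorm_one_le (hg : ContDiff ℝ 1 g)
    (h : DerivShape (fun p => EuclideanSpace.single p (1 : ℝ)) t Δ g w κ) :
    derivNorm 1 g w ≤ κ * √(∑ p, t p ^ 2) := by
  have hκ := h.nonneg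
  rw [derivNorm, sum_fin_succ_arrow]
  refine Real.sqrt_le_iff.2 ⟨by positivity, ?_⟩
  rw [mul_pow, Real.sq_sqrt (Finset.sum_nonneg fun _ _ => sq_nonneg _), Finset.mul_sum]
  refine Finset.sum_le_sum fun p _ => ?_
  rw [sum_fin_zero_arrow, iteratedFDeriv_one_eq_dirDeriv hg, ← mul_pow]
  exact pow_le_pow_left₀ (norm_nonneg _) (h.one p) 2

theorem derivNorm_two_le (hg : ContDiff ℝ 2 g)
    (h : DerivShape (fun p => EuclideanSpace.single p (1 : ℝ)) t Δ g w κ) :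
    derivNorm 2 g w ≤ κ * √(2 * ((∑ p, t p ^ 2) ^ 2 + ∑ p, ∑ q, Δ p q ^ 2)) := by
  have hκ := h.nonneg
  set T := ∑ p, t p ^ 2 with hT
  set W := ∑ p, ∑ q, Δ p q ^ 2 with hW
  have hT0 : 0 ≤ T := Finset.sum_nonneg fun _ _ => sq_nonneg _
  have hW0 : 0 ≤ W := Finset.sum_nonneg fun _ _ => Finset.sum_nonneg fun _ _ => sq_nonneg _
  rw [derivNorm, sum_fin_succ_arrow]
  refine Real.sqrt_le_iff.2 ⟨by positivity, ?_⟩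
  rw [mul_pow, Real.sq_sqrt (by positivity)]
  have e1 : 2 * (T ^ 2 + W) = ∑ p, ∑ q, 2 * (t p ^ 2 * t q ^ 2 + Δ p q ^ 2) := by
    simp only [← Finset.mul_sum, Finset.sum_add_distrib]
    rw [← Finset.sum_mul, sq T]
  rw [e1, Finset.mul_sum]
  refine Finset.sum_le_sum fun p _ => ?_
  rw [sum_fin_succ_arrow, Finset.mul_sum]
  refine Finset.sum_le_sum fun q _ => ?_
  rw [sum_fin_zero_arrow, iteratedFDeriv_two_eq_dirDeriv hg]
  refine (pow_le_pow_left₀ (norm_nonneg _) (h.two p q) 2).trans ?_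
  rw [mul_pow]
  refine mul_le_mul_of_nonneg_left ?_ (sq_nonneg _)
  -- (x + y)² ≤ 2(x² + y²), the source of the factor 2 under the root.
  nlinarith [sq_nonneg (t p * t q - Δ p q)]

/-- The square of a sum of four terms is at most four times the sum of squares; the three mixed sums
agree after relabelling indices, which gives the factor 3. -/
theorem derivNorm_three_le (hg : ContDiff ℝ 3 g)
    (h : DerivShape (fun p => EuclideanSpace.single p (1 : ℝ)) t Δ g w κ) :
    derivNorm 3 g w ≤ κ * √(4 * ((∑ p, t p ^ 2) ^ 3 +
      3 * ((∑ p, ∑ q, Δ p q ^ 2) * ∑ p, t p ^ 2))) := by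
  have hκ := h.nonneg
  set T := ∑ p, t p ^ 2 with hT
  set W := ∑ p, ∑ q, Δ p q ^ 2 with hW
  have hT0 : 0 ≤ T := Finset.sum_nonneg fun _ _ => sq_nonneg _
  have hW0 : 0 ≤ W := Finset.sum_nonneg fun _ _ => Finset.sum_nonneg fun _ _ => sq_nonneg _
  rw [derivNorm, sum_fin_succ_arrow]
  refine Real.sqrt_le_iff.2 ⟨by positivity, ?_⟩
  rw [mul_pow, Real.sq_sqrt (by positivity)]
  have a1 : ∑ p, ∑ q, ∑ s, t p ^ 2 * t q ^ 2 * t s ^ 2 = T ^ 3 := by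
    simp only [← Finset.mul_sum, ← Finset.sum_mul, ← hT]; ring
  have a2 : ∑ p, ∑ q, ∑ s, Δ p q ^ 2 * t s ^ 2 = W * T := by
    simp only [← Finset.mul_sum, ← Finset.sum_mul, ← hT, ← hW]
  have a3 : ∑ p, ∑ q, ∑ s, Δ p s ^ 2 * t q ^ 2 = W * T := by
    rw [← a2]
    exact Finset.sum_congr rfl fun p _ => Finset.sum_comm
  have a4 : ∑ p, ∑ q, ∑ s, Δ q s ^ 2 * t p ^ 2 = W * T := by
    simp only [← Finset.sum_mul, ← hW, ← Finset.mul_sum]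
    rw [← hT]
  have e1 : 4 * (T ^ 3 + 3 * (W * T)) = ∑ p, ∑ q, ∑ s,
      4 * (t p ^ 2 * t q ^ 2 * t s ^ 2 + Δ p q ^ 2 * t s ^ 2 + Δ p s ^ 2 * t q ^ 2 +
        Δ q s ^ 2 * t p ^ 2) := by
    simp only [← Finset.mul_sum, Finset.sum_add_distrib]
    simp only [← Finset.mul_sum] at a1 a2 a3 a4
    rw [a1, a2, a3, a4]; ring
  rw [e1, Finset.mul_sum]
  refine Finset.sum_le_sum fun p _ => ?_
  rw [sum_fin_succ_arrow, Finset.mul_sum]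
  refine Finset.sum_le_sum fun q _ => ?_
  rw [sum_fin_succ_arrow, Finset.mul_sum]
  refine Finset.sum_le_sum fun s _ => ?_
  rw [sum_fin_zero_arrow, iteratedFDeriv_three_eq_dirDeriv hg]
  refine (pow_le_pow_left₀ (norm_nonneg _) (h.three p q s) 2).trans ?_
  rw [mul_pow]
  refine mul_le_mul_of_nonneg_left ?_ (sq_nonneg _)
  generalize hA : t p * t q * t s = A
  generalize hB : Δ p q * t s = B
  generalize hC : Δ p s * t q = C
  generalize hD : Δ q s * t p = D
  simp only [← mul_pow, hA, hB, hC, hD]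
  nlinarith [sq_nonneg (A - B), sq_nonneg (A - C), sq_nonneg (A - D), sq_nonneg (B - C),
    sq_nonneg (B - D), sq_nonneg (C - D)]

end DerivShape

end FlattenedNorm

/-! ### Orders of magnitude of the derivatives in one block. -/

/-- The order of magnitude of the flattened `r`-th derivative, `r ≤ 3`, of the ridge estimator in
one block, for `n` blocks of `k` points in dimension `D`. -/
noncomputable def derivRate (n k D : ℝ) : ℕ → ℝ
  | 0 => 1
  | 1 => √(D * k) / (n * k)
  | 2 => D * √k / (n * k)
  | _ => D * √D * k / (n * k) ^ 2

theorem derivRate_nonneg {n k D : ℝ} (hn : 0 ≤ n) (hk : 0 ≤ k) (hD : 0 ≤ D) (r : ℕ) :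
    0 ≤ derivRate n k D r := by
  rcases r with _ | _ | _ | r <;> simp only [derivRate] <;> positivity

/-- Let N = nk, T = ∑ t², W = ∑ Δ², and let q be the average of the x_j². Then T = L²Dkq/N² and W =
L²D²k/N²: pairs occur only within one point, which leaves D²k pairs instead of (Dk)². Since k ≤ N²,
the term T² is of no larger order than W, and T³ of no larger order than WT. So √W and √(WT) fix the
rates of orders two and three. -/
theorem DerivShape.derivNorm_le_rate {σ F : Type*} [Fintype σ] [DecidableEq σ]
    [NormedAddCommGroup F] [NormedSpace ℝ F] {n k : ℕ} (hn : 0 < n) (hk : 0 < k)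
    {L κ : ℝ} (hL : 0 ≤ L) {x : Fin k → ℝ} {g : EuclideanSpace ℝ (Fin k × σ) → F}
    {w : EuclideanSpace ℝ (Fin k × σ)} (hg : ContDiff ℝ 3 g)
    (h : DerivShape (fun p => EuclideanSpace.single p (1 : ℝ))
      (fun p => L / ((n : ℝ) * k) * x p.1)
      (fun p q => if p.1 = q.1 then L / ((n : ℝ) * k) else 0) g w κ)
    {r : ℕ} (hr : r ≤ 3) :
    derivNorm r g w ≤ κ * (4 * (1 + L) ^ 3) * derivRate n k (Fintype.card σ) r *
      (1 + (∑ j, x j ^ 2) / k) ^ 2 := by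
  have hκ := h.nonneg
  have hn' : (1 : ℝ) ≤ n := by exact_mod_cast hn
  have hk' : (1 : ℝ) ≤ k := by exact_mod_cast hk
  set N : ℝ := (n : ℝ) * k with hN
  have hN0 : 0 < N := by positivity
  set D : ℝ := (Fintype.card σ : ℝ) with hD
  have hD0 : 0 ≤ D := by positivity
  set q : ℝ := (∑ j, x j ^ 2) / k with hq
  have hq0 : 0 ≤ q := div_nonneg (Finset.sum_nonneg fun _ _ => sq_nonneg _) (by positivity)
  have hsum : ∑ j, x j ^ 2 = k * q := by rw [hq]; field_simp
  have hT : ∑ p : Fin k × σ, (L / N * x p.1) ^ 2 = D * (L / N) ^ 2 * (k * q) := by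
    rw [Fintype.sum_prod_type]
    simp only [Finset.sum_const, Finset.card_univ, nsmul_eq_mul, mul_pow, ← Finset.mul_sum]
    rw [hsum, ← hD]; ring
  have hW : ∑ p : Fin k × σ, ∑ s : Fin k × σ, (if p.1 = s.1 then L / N else 0) ^ 2 =
      D ^ 2 * (L / N) ^ 2 * k := by
    simp only [Fintype.sum_prod_type, ite_pow]
    simp
    ring
  have hkN : k / N ^ 2 ≤ 1 := by
    rw [div_le_one (by positivity), hN]
    have : (k : ℝ) * 1 ≤ k * (n ^ 2 * k) := by
      gcongr
      nlinarith [mul_self_nonneg ((n : ℝ) - 1)]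
    nlinarith
  have hkN0 : 0 ≤ k / N ^ 2 := by positivity
  have hL1 : 1 ≤ 1 + L := by linarith
  have hq1 : 1 ≤ 1 + q := by linarith
  interval_cases r
  · rw [derivNorm_zero]
    refine h.zero.trans ?_
    rw [derivRate, mul_one, mul_assoc]
    refine le_mul_of_one_le_right hκ ?_
    have h1 : 1 ≤ (1 + L) ^ 3 := one_le_pow₀ hL1
    have h2 : 1 ≤ (1 + q) ^ 2 := one_le_pow₀ hq1
    nlinarith
  · refine (h.derivNorm_one_le (hg.of_le (by norm_num))).trans ?_
    rw [hT]
    have hrr := derivRate_nonneg (n := n) (k := k) (D := D) (by positivity) (by positivity) hD0 1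
    have : √(D * (L / N) ^ 2 * (k * q)) ≤
        (4 * (1 + L) ^ 3) * derivRate n k D 1 * (1 + q) ^ 2 := by
      refine Real.sqrt_le_iff.2 ⟨by positivity, ?_⟩
      have : (4 * (1 + L) ^ 3 * derivRate n k D 1 * (1 + q) ^ 2) ^ 2 =
          (D * k / N ^ 2) * (16 * (1 + L) ^ 6 * (1 + q) ^ 4) := by
        simp only [derivRate, ← hN]
        rw [mul_pow, mul_pow, div_pow, Real.sq_sqrt (by positivity)]; ring
      rw [this]
      have : D * (L / N) ^ 2 * (k * q) = (D * k / N ^ 2) * (L ^ 2 * q) := by field_simp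
      rw [this]
      refine mul_le_mul_of_nonneg_left ?_ (by positivity)
      calc L ^ 2 * q ≤ (1 + L) ^ 6 * (1 + q) ^ 4 := by
            refine mul_le_mul ?_ ?_ hq0 (by positivity)
            · exact (pow_le_pow_left₀ hL (by linarith) 2).trans
                (pow_le_pow_right₀ hL1 (by norm_num))
            · exact (by linarith : q ≤ 1 + q).trans (le_self_pow₀ hq1 (by norm_num))
        _ ≤ 16 * (1 + L) ^ 6 * (1 + q) ^ 4 := by
            have : 0 ≤ (1 + L) ^ 6 * (1 + q) ^ 4 := by positivity
            linarith
    calc _ ≤ κ * ((4 * (1 + L) ^ 3) * derivRate n k D 1 * (1 + q) ^ 2) := by gcongr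
      _ = _ := by ring
  · refine (h.derivNorm_two_le (hg.of_le (by norm_num))).trans ?_
    rw [hT, hW]
    have hrr := derivRate_nonneg (n := n) (k := k) (D := D) (by positivity) (by positivity) hD0 2
    have : √(2 * ((D * (L / N) ^ 2 * (k * q)) ^ 2 + D ^ 2 * (L / N) ^ 2 * k)) ≤
        (4 * (1 + L) ^ 3) * derivRate n k D 2 * (1 + q) ^ 2 := by
      refine Real.sqrt_le_iff.2 ⟨by positivity, ?_⟩
      have : (4 * (1 + L) ^ 3 * derivRate n k D 2 * (1 + q) ^ 2) ^ 2 =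
          (D ^ 2 * k / N ^ 2) * (16 * (1 + L) ^ 6 * (1 + q) ^ 4) := by
        simp only [derivRate, ← hN]
        rw [mul_pow, mul_pow, div_pow, mul_pow, mul_pow D, Real.sq_sqrt (by positivity)]; ring
      rw [this]
      have : 2 * ((D * (L / N) ^ 2 * (k * q)) ^ 2 + D ^ 2 * (L / N) ^ 2 * k) =
          (D ^ 2 * k / N ^ 2) * (2 * (L ^ 4 * (k / N ^ 2) * q ^ 2 + L ^ 2)) := by field_simp
      rw [this]
      refine mul_le_mul_of_nonneg_left ?_ (by positivity)
      have h1 : L ^ 4 * (k / N ^ 2) * q ^ 2 ≤ (1 + L) ^ 6 * (1 + q) ^ 4 := by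
        refine mul_le_mul ?_ ?_ (by positivity) (by positivity)
        · exact (mul_le_of_le_one_right (by positivity) hkN).trans
            ((pow_le_pow_left₀ hL (by linarith) 4).trans (pow_le_pow_right₀ hL1 (by norm_num)))
        · exact (pow_le_pow_left₀ hq0 (by linarith) 2).trans (pow_le_pow_right₀ hq1 (by norm_num))
      have h2 : L ^ 2 ≤ (1 + L) ^ 6 * (1 + q) ^ 4 := by
        refine le_trans ?_ (le_mul_of_one_le_right (by positivity) (one_le_pow₀ hq1))
        exact (pow_le_pow_left₀ hL (by linarith) 2).trans (pow_le_pow_right₀ hL1 (by norm_num))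
      have : 0 ≤ (1 + L) ^ 6 * (1 + q) ^ 4 := by positivity
      linarith
    calc _ ≤ κ * ((4 * (1 + L) ^ 3) * derivRate n k D 2 * (1 + q) ^ 2) := by gcongr
      _ = _ := by ring
  · refine (h.derivNorm_three_le hg).trans ?_
    rw [hT, hW]
    have hrr := derivRate_nonneg (n := n) (k := k) (D := D) (by positivity) (by positivity) hD0 3
    have : √(4 * ((D * (L / N) ^ 2 * (k * q)) ^ 3 + 3 * (D ^ 2 * (L / N) ^ 2 * k *
        (D * (L / N) ^ 2 * (k * q))))) ≤
        (4 * (1 + L) ^ 3) * derivRate n k D 3 * (1 + q) ^ 2 := by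
      refine Real.sqrt_le_iff.2 ⟨by positivity, ?_⟩
      have : (4 * (1 + L) ^ 3 * derivRate n k D 3 * (1 + q) ^ 2) ^ 2 =
          (D ^ 3 * k ^ 2 / N ^ 4) * (16 * (1 + L) ^ 6 * (1 + q) ^ 4) := by
        simp only [derivRate, ← hN]
        rw [mul_pow, mul_pow, div_pow, mul_pow (D * √D), mul_pow D, Real.sq_sqrt (by positivity)]; ring
      rw [this]
      have : 4 * ((D * (L / N) ^ 2 * (k * q)) ^ 3 + 3 * (D ^ 2 * (L / N) ^ 2 * k *
          (D * (L / N) ^ 2 * (k * q)))) =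
          (D ^ 3 * k ^ 2 / N ^ 4) * (4 * (L ^ 6 * (k / N ^ 2) * q ^ 3 + 3 * (L ^ 4 * q))) := by
        field_simp
      rw [this]
      refine mul_le_mul_of_nonneg_left ?_ (by positivity)
      have h1 : L ^ 6 * (k / N ^ 2) * q ^ 3 ≤ (1 + L) ^ 6 * (1 + q) ^ 4 := by
        refine mul_le_mul ?_ ?_ (by positivity) (by positivity)
        · exact (mul_le_of_le_one_right (by positivity) hkN).trans
            (pow_le_pow_left₀ hL (by linarith) 6)
        · exact (pow_le_pow_left₀ hq0 (by linarith) 3).trans (pow_le_pow_right₀ hq1 (by norm_num))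
      have h2 : L ^ 4 * q ≤ (1 + L) ^ 6 * (1 + q) ^ 4 := by
        refine mul_le_mul ?_ ?_ (by positivity) (by positivity)
        · exact (pow_le_pow_left₀ hL (by linarith) 4).trans (pow_le_pow_right₀ hL1 (by norm_num))
        · exact (by linarith : q ≤ 1 + q).trans (le_self_pow₀ hq1 (by norm_num))
      linarith
    calc _ ≤ κ * ((4 * (1 + L) ^ 3) * derivRate n k D 3 * (1 + q) ^ 2) := by gcongr
      _ = _ := by ring

/-! ### Derivatives of a constant plus a quadratic form. -/

section QuadraticMaps

variable {E F : Type*} [NormedAddCommGroup E] [NormedSpace ℝ E]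
  [NormedAddCommGroup F] [NormedSpace ℝ F]

theorem contDiff_const_add_quadratic (c : F) (q : E →L[ℝ] E →L[ℝ] F) {n : WithTop ℕ∞} :
    ContDiff ℝ n (fun w => c + q w w) :=
  contDiff_const.add (q.contDiff.clm_apply contDiff_id)

theorem dirDeriv_const_add_quadratic (c : F) (q : E →L[ℝ] E →L[ℝ] F) (e : E) :
    dirDeriv e (fun w => c + q w w) = fun w => (q e + q.flip e) w := by
  funext w
  have h : HasFDerivAt (fun w => c + q w w) (q.flip w + q w) w := by
    have := (q.hasFDerivAt (x := w)).clm_apply (hasFDerivAt_id w)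
    refine (this.const_add c).congr_fderiv ?_
    ext v; simp [add_comm]
  rw [dirDeriv, h.fderiv]
  simp

theorem dirDeriv_dirDeriv_const_add_quadratic (c : F) (q : E →L[ℝ] E →L[ℝ] F) (e e' : E) :
    dirDeriv e (dirDeriv e' (fun w => c + q w w)) = fun _ => q e' e + q e e' := by
  rw [dirDeriv_const_add_quadratic]
  funext w
  change fderiv ℝ (⇑(q e' + q.flip e')) w e = _
  rw [ContinuousLinearMap.fderiv]
  simp

theorem dirDeriv_dirDeriv_dirDeriv_const_add_quadratic (c : F) (q : E →L[ℝ] E →L[ℝ] F)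
    (e e' e'' : E) (w : E) :
    dirDeriv e (dirDeriv e' (dirDeriv e'' (fun w => c + q w w))) w = 0 := by
  rw [dirDeriv_dirDeriv_const_add_quadratic, dirDeriv_const]

end QuadraticMaps

/-! ### The bilinear forms behind ∑ v vᵀ and ∑ v yᵀ. -/

section RidgeForms

variable {d b : ℕ}

/-- The matrix `u (vᵀ X)`, for a `d × b` matrix `X`. -/
def rankOneApply (u v : Vec d) (X : EuclideanSpace ℝ (Fin d × Fin b)) :
    EuclideanSpace ℝ (Fin d × Fin b) :=
  WithLp.toLp 2 (fun p => u p.1 * ∑ m, v m * X (m, p.2))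

theorem norm_rankOneApply_le (u v : Vec d) (X : EuclideanSpace ℝ (Fin d × Fin b)) :
    ‖rankOneApply u v X‖ ≤ ‖u‖ * ‖v‖ * ‖X‖ := by
  refine le_of_sq_le_sq ?_ (by positivity)
  rw [mul_pow, mul_pow, EuclideanSpace.norm_sq_eq, EuclideanSpace.norm_sq_eq u,
    EuclideanSpace.norm_sq_eq X, Fintype.sum_prod_type, Fintype.sum_prod_type_right,
    Finset.sum_mul, Finset.sum_mul]
  refine Finset.sum_le_sum fun l _ => ?_
  rw [mul_assoc, Finset.mul_sum, Finset.mul_sum]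
  refine Finset.sum_le_sum fun s _ => ?_
  simp only [rankOneApply, Real.norm_eq_abs, sq_abs, mul_pow]
  refine mul_le_mul_of_nonneg_left ?_ (sq_nonneg _)
  refine (Finset.sum_mul_sq_le_sq_mul_sq _ _ _).trans (le_of_eq ?_)
  rw [EuclideanSpace.norm_sq_eq]
  simp

/-- `rankOneApply` as a continuous bilinear map into the operators on `d × b` matrices. -/
noncomputable def rankOneOp : Vec d →L[ℝ] Vec d →L[ℝ]
    (EuclideanSpace ℝ (Fin d × Fin b) →L[ℝ] EuclideanSpace ℝ (Fin d × Fin b)) :=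
  LinearMap.mkContinuous₂ (LinearMap.mk₂ ℝ
    (fun u v => LinearMap.mkContinuous
      { toFun := rankOneApply u v
        map_add' := fun X Y => by
          ext p; simp [rankOneApply, mul_add, Finset.sum_add_distrib]
        map_smul' := fun c X => by
          ext p
          simp only [rankOneApply, PiLp.smul_apply, smul_eq_mul, Finset.mul_sum, RingHom.id_apply]
          exact Finset.sum_congr rfl fun m _ => by ring }
      (‖u‖ * ‖v‖) (norm_rankOneApply_le u v))
    (fun u u' v => by ext X p; simp [rankOneApply, add_mul])
    (fun c u v => by ext X p; simp [rankOneApply, mul_assoc])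
    (fun u v v' => by ext X p; simp [rankOneApply, add_mul, mul_add, Finset.sum_add_distrib])
    (fun c u v => by
      ext X p
      simp only [rankOneApply, LinearMap.mkContinuous_apply, LinearMap.coe_mk, AddHom.coe_mk,
        PiLp.smul_apply, smul_eq_mul, FunLike.coe_smul, Pi.smul_apply, Finset.mul_sum]
      exact Finset.sum_congr rfl fun m _ => by ring)) 1
    (fun u v => by
      rw [one_mul]
      exact LinearMap.mkContinuous_norm_le _ (by positivity) (norm_rankOneApply_le u v))

theorem rankOneOp_apply (u v : Vec d) (X : EuclideanSpace ℝ (Fin d × Fin b)) :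
    rankOneOp u v X = rankOneApply u v X := rfl

theorem norm_rankOneOp_le (u v : Vec d) :
    ‖(rankOneOp u v : EuclideanSpace ℝ (Fin d × Fin b) →L[ℝ] _)‖ ≤ ‖u‖ * ‖v‖ :=
  ContinuousLinearMap.opNorm_le_bound _ (by positivity) (norm_rankOneApply_le u v)

/-- The inner product is the sum over the columns X_s of the squares (vᵀX_s)². This is why the data
can only improve the coercivity due to the ridge penalty. -/
theorem inner_rankOneApply_self_nonneg (v : Vec d) (X : EuclideanSpace ℝ (Fin d × Fin b)) :
    0 ≤ inner ℝ X (rankOneApply v v X) := by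
  rw [PiLp.inner_apply, Fintype.sum_prod_type_right]
  refine Finset.sum_nonneg fun s _ => ?_
  simp only [rankOneApply, RCLike.inner_apply, conj_trivial]
  have : ∀ l, v l * (∑ m, v m * X (m, s)) * X (l, s) =
      (v l * X (l, s)) * (∑ m, v m * X (m, s)) := fun l => by ring
  simp only [this]
  rw [← Finset.sum_mul]
  exact mul_self_nonneg _

/-- The `d × b` matrix `u yᵀ`. -/
def outerVec (u : Vec d) (y : Vec b) : EuclideanSpace ℝ (Fin d × Fin b) :=
  WithLp.toLp 2 (fun p => u p.1 * y p.2)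

theorem norm_outerVec_le (u : Vec d) (y : Vec b) : ‖outerVec u y‖ ≤ ‖u‖ * ‖y‖ := by
  refine le_of_sq_le_sq (le_of_eq ?_) (by positivity)
  rw [mul_pow, EuclideanSpace.norm_sq_eq, EuclideanSpace.norm_sq_eq u, EuclideanSpace.norm_sq_eq y,
    Fintype.sum_prod_type, Finset.sum_mul_sum]
  simp [outerVec, mul_pow]

/-- `outerVec` as a continuous bilinear map. -/
noncomputable def outerVecL : Vec d →L[ℝ] Vec b →L[ℝ] EuclideanSpace ℝ (Fin d × Fin b) :=
  LinearMap.mkContinuous₂ (LinearMap.mk₂ ℝ outerVec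
    (fun u u' y => by ext p; simp [outerVec, add_mul])
    (fun c u y => by ext p; simp [outerVec, mul_assoc])
    (fun u y y' => by ext p; simp [outerVec, mul_add])
    (fun c u y => by ext p; simp [outerVec]; ring)) 1
    (fun u y => by rw [one_mul]; exact norm_outerVec_le u y)

theorem outerVecL_apply (u : Vec d) (y : Vec b) : outerVecL u y = outerVec u y := rfl

variable {k : ℕ}

/-- The norm of the `j`-th point of a block. -/
noncomputable def pointNorm (j : Fin k) (w : Block k d b) : ℝ := √(∑ a, w (j, a) ^ 2)

theorem pointNorm_nonneg (j : Fin k) (w : Block k d b) : 0 ≤ pointNorm j w := Real.sqrt_nonneg _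

theorem sum_pointNorm_sq (w : Block k d b) : ∑ j, pointNorm j w ^ 2 = ‖w‖ ^ 2 := by
  rw [EuclideanSpace.norm_sq_eq, Fintype.sum_prod_type]
  refine Finset.sum_congr rfl fun j _ => ?_
  rw [pointNorm, Real.sq_sqrt (Finset.sum_nonneg fun _ _ => sq_nonneg _)]
  simp

theorem pointNorm_single (j : Fin k) (p : Fin k × (Fin d ⊕ Fin b)) :
    pointNorm j (EuclideanSpace.single p (1 : ℝ)) = if p.1 = j then 1 else 0 := by
  obtain ⟨j', a⟩ := p
  rw [pointNorm]
  simp only [PiLp.single_apply, Prod.mk.injEq, ite_pow]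
  by_cases h : j' = j
  · subst h; simp [-Fintype.sum_sum_type]
  · simp [h, Ne.symm h]

/-- The `j`-th covariate of a block. -/
noncomputable def covariateL (j : Fin k) : Block k d b →L[ℝ] Vec d :=
  LinearMap.toContinuousLinearMap
    { toFun := fun w => WithLp.toLp 2 (fun l => w (j, Sum.inl l))
      map_add' := fun _ _ => rfl
      map_smul' := fun _ _ => rfl }

/-- The `j`-th response of a block. -/
noncomputable def responseL (j : Fin k) : Block k d b →L[ℝ] Vec b :=
  LinearMap.toContinuousLinearMap
    { toFun := fun w => WithLp.toLp 2 (fun l => w (j, Sum.inr l))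
      map_add' := fun _ _ => rfl
      map_smul' := fun _ _ => rfl }

theorem covariateL_apply (j : Fin k) (w : Block k d b) (l : Fin d) :
    covariateL j w l = w (j, Sum.inl l) := rfl

theorem responseL_apply (j : Fin k) (w : Block k d b) (l : Fin b) :
    responseL j w l = w (j, Sum.inr l) := rfl

theorem norm_covariateL_le (j : Fin k) (w : Block k d b) : ‖covariateL j w‖ ≤ pointNorm j w := by
  refine Real.le_sqrt_of_sq_le ?_
  rw [EuclideanSpace.norm_sq_eq, Fintype.sum_sum_type]
  simp only [covariateL_apply, Real.norm_eq_abs, sq_abs]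
  have : 0 ≤ ∑ a, w (j, Sum.inr a) ^ 2 := Finset.sum_nonneg fun _ _ => sq_nonneg _
  linarith

theorem norm_responseL_le (j : Fin k) (w : Block k d b) : ‖responseL j w‖ ≤ pointNorm j w := by
  refine Real.le_sqrt_of_sq_le ?_
  rw [EuclideanSpace.norm_sq_eq, Fintype.sum_sum_type]
  simp only [responseL_apply, Real.norm_eq_abs, sq_abs]
  have : 0 ≤ ∑ a, w (j, Sum.inl a) ^ 2 := Finset.sum_nonneg fun _ _ => sq_nonneg _
  linarith

/-- The sum over the `k` points of a block of bilinear forms in these points. -/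
noncomputable def blockForm {U V H : Type*} [NormedAddCommGroup U] [NormedSpace ℝ U]
    [NormedAddCommGroup V] [NormedSpace ℝ V] [NormedAddCommGroup H] [NormedSpace ℝ H]
    (m : U →L[ℝ] V →L[ℝ] H) (α : Fin k → Block k d b →L[ℝ] U) (β : Fin k → Block k d b →L[ℝ] V) :
    Block k d b →L[ℝ] Block k d b →L[ℝ] H :=
  ∑ j, m.bilinearComp (α j) (β j)

theorem blockForm_apply {U V H : Type*} [NormedAddCommGroup U] [NormedSpace ℝ U]
    [NormedAddCommGroup V] [NormedSpace ℝ V] [NormedAddCommGroup H] [NormedSpace ℝ H]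
    (m : U →L[ℝ] V →L[ℝ] H) (α : Fin k → Block k d b →L[ℝ] U) (β : Fin k → Block k d b →L[ℝ] V)
    (w w' : Block k d b) : blockForm m α β w w' = ∑ j, m (α j w) (β j w') := by
  simp [blockForm, _root_.sum_apply]

/-- `(w, w') ↦ ∑ⱼ vⱼ (v'ⱼ)ᵀ`, acting on `d × b` matrices. -/
noncomputable def gramForm : Block k d b →L[ℝ] Block k d b →L[ℝ]
    (EuclideanSpace ℝ (Fin d × Fin b) →L[ℝ] EuclideanSpace ℝ (Fin d × Fin b)) :=
  blockForm rankOneOp covariateL covariateL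

/-- `(w, w') ↦ ∑ⱼ vⱼ (y'ⱼ)ᵀ`. -/
noncomputable def crossForm : Block k d b →L[ℝ] Block k d b →L[ℝ]
    EuclideanSpace ℝ (Fin d × Fin b) :=
  blockForm outerVecL covariateL responseL

theorem gramForm_apply (w w' : Block k d b) :
    gramForm w w' = ∑ j, rankOneOp (covariateL j w) (covariateL j w') :=
  blockForm_apply _ _ _ _ _

theorem crossForm_apply (w w' : Block k d b) :
    crossForm w w' = ∑ j, outerVecL (covariateL j w) (responseL j w') :=
  blockForm_apply _ _ _ _ _

theorem norm_gramForm_le (w w' : Block k d b) :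
    ‖gramForm w w'‖ ≤ ∑ j, pointNorm j w * pointNorm j w' := by
  rw [gramForm_apply]
  refine norm_sum_le_of_le _ fun j _ => (norm_rankOneOp_le _ _).trans ?_
  exact mul_le_mul (norm_covariateL_le j w) (norm_covariateL_le j w') (norm_nonneg _)
    (pointNorm_nonneg _ _)

theorem norm_crossForm_le (w w' : Block k d b) :
    ‖crossForm w w'‖ ≤ ∑ j, pointNorm j w * pointNorm j w' := by
  rw [crossForm_apply]
  refine norm_sum_le_of_le _ fun j _ => (norm_outerVec_le _ _).trans ?_
  exact mul_le_mul (norm_covariateL_le j w) (norm_responseL_le j w') (norm_nonneg _)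
    (pointNorm_nonneg _ _)

/-- A coordinate direction touches one point of the block only. Against w this leaves the norm of
that point; against a second coordinate direction it leaves the indicator that both touch the same
point. -/
theorem sum_pointNorm_single_mul (p : Fin k × (Fin d ⊕ Fin b)) (w : Block k d b) :
    ∑ j, pointNorm j (EuclideanSpace.single p (1 : ℝ)) * pointNorm j w = pointNorm p.1 w := by
  simp [pointNorm_single]

theorem sum_pointNorm_mul_single (p : Fin k × (Fin d ⊕ Fin b)) (w : Block k d b) :
    ∑ j, pointNorm j w * pointNorm j (EuclideanSpace.single p (1 : ℝ)) = pointNorm p.1 w := by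
  simp [pointNorm_single]

end RidgeForms

/-! ### The ridge estimator as the solution of a coercive linear equation. -/

section Ridge

variable {n k d b : ℕ} {lam : ℝ}

/-- `∑ᵢⱼ vᵢⱼ vᵢⱼᵀ + n k λ I`, acting on `d × b` matrices. -/
noncomputable def gramOp (lam : ℝ) (x : Fin n → Block k d b) :
    EuclideanSpace ℝ (Fin d × Fin b) →L[ℝ] EuclideanSpace ℝ (Fin d × Fin b) :=
  ((n : ℝ) * k * lam) • ContinuousLinearMap.id ℝ _ + ∑ i, gramForm (x i) (x i)

/-- `∑ᵢⱼ vᵢⱼ yᵢⱼᵀ`. -/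
noncomputable def crossVec (x : Fin n → Block k d b) : EuclideanSpace ℝ (Fin d × Fin b) :=
  ∑ i, crossForm (x i) (x i)

/-- The Gram part is positive semidefinite, so ⟨X, MX⟩ ≥ nkλ‖X‖², and Cauchy–Schwarz bounds the left
side by ‖X‖ ‖MX‖. -/
theorem norm_le_mul_norm_gramOp (hn : 0 < n) (hk : 0 < k) (hlam : 0 < lam)
    (x : Fin n → Block k d b) (X : EuclideanSpace ℝ (Fin d × Fin b)) :
    ‖X‖ ≤ lam⁻¹ / ((n : ℝ) * k) * ‖gramOp lam x X‖ := by
  have hN : 0 < (n : ℝ) * k * lam := by positivity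
  have h1 : ((n : ℝ) * k * lam) * ‖X‖ ^ 2 ≤ inner ℝ X (gramOp lam x X) := by
    have e1 : gramOp lam x X = ((n : ℝ) * k * lam) • X +
        ∑ i, ∑ j, rankOneApply (covariateL j (x i)) (covariateL j (x i)) X := by
      simp [gramOp, gramForm_apply, _root_.sum_apply, rankOneOp_apply]
    rw [e1, inner_add_right, inner_smul_right, real_inner_self_eq_norm_sq, inner_sum]
    have : 0 ≤ ∑ i, inner ℝ X
        (∑ j, rankOneApply (covariateL j (x i)) (covariateL j (x i)) X) := by
      refine Finset.sum_nonneg fun i _ => ?_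
      rw [inner_sum]
      exact Finset.sum_nonneg fun j _ => inner_rankOneApply_self_nonneg _ _
    linarith
  have h2 := h1.trans (real_inner_le_norm X (gramOp lam x X))
  rcases (norm_nonneg X).eq_or_lt with h0 | h0
  · rw [← h0]; positivity
  · have h3 : ((n : ℝ) * k * lam) * ‖X‖ ≤ ‖gramOp lam x X‖ := by
      by_contra hcon
      push Not at hcon
      nlinarith [mul_lt_mul_of_pos_left hcon h0]
    have : lam⁻¹ / ((n : ℝ) * k) * ‖gramOp lam x X‖ = ‖gramOp lam x X‖ / ((n : ℝ) * k * lam) := by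
      field_simp
    rw [this, le_div_iff₀ hN]
    linarith

theorem isInvertible_gramOp (hn : 0 < n) (hk : 0 < k) (hlam : 0 < lam)
    (x : Fin n → Block k d b) : (gramOp lam x).IsInvertible := by
  have hinj : Function.Injective (gramOp lam x).toLinearMap := by
    rw [← LinearMap.ker_eq_bot, LinearMap.ker_eq_bot']
    intro X hX
    have := norm_le_mul_norm_gramOp hn hk hlam x X
    rw [show gramOp lam x X = 0 from hX] at this
    simpa using this
  refine ⟨(LinearEquiv.ofInjectiveEndo _ hinj).toContinuousLinearEquiv, ?_⟩
  ext X : 1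
  rfl

theorem det_ridge_ne_zero (hn : 0 < n) (hk : 0 < k) (hlam : 0 < lam) (x : Fin n → Block k d b) :
    IsUnit ((∑ i, ∑ j, Matrix.vecMulVec (covariate x i j) (covariate x i j)) +
      ((n : ℝ) * (k : ℝ) * lam) • (1 : Matrix (Fin d) (Fin d) ℝ)).det := by
  have hN : 0 < (n : ℝ) * k * lam := by positivity
  rw [← Matrix.isUnit_iff_isUnit_det]
  refine Matrix.PosDef.isUnit ?_
  refine Matrix.PosDef.posSemidef_add ?_ (Matrix.PosDef.one.smul hN)
  refine Matrix.posSemidef_sum _ fun i _ => Matrix.posSemidef_sum _ fun j _ => ?_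
  simpa using Matrix.posSemidef_vecMulVec_self_star (covariate x i j)

theorem gramOp_ridgeVec (hn : 0 < n) (hk : 0 < k) (hlam : 0 < lam) (x : Fin n → Block k d b) :
    gramOp lam x (ridgeVec lam x) = crossVec x := by
  have h := Matrix.mul_nonsing_inv_cancel_left _
    (∑ i, ∑ j, Matrix.vecMulVec (covariate x i j) (response x i j)) (det_ridge_ne_zero hn hk hlam x)
  ext ⟨l, s⟩
  have h1 := congrFun (congrFun h l) s
  rw [← ridge, Matrix.add_mul, Matrix.smul_mul, Matrix.one_mul, Matrix.add_apply, Matrix.mul_apply]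
    at h1
  simp only [Matrix.sum_apply, Matrix.vecMulVec_apply, Matrix.smul_apply, smul_eq_mul] at h1
  simp only [gramOp, crossVec, gramForm_apply, crossForm_apply, _root_.add_apply,
    _root_.smul_apply, _root_.sum_apply, rankOneOp_apply,
    outerVecL_apply, PiLp.add_apply, PiLp.smul_apply, ContinuousLinearMap.id_apply, smul_eq_mul,
    WithLp.ofLp_sum, Finset.sum_apply, rankOneApply, outerVec, covariateL_apply, responseL_apply]
  have e2 : ∀ i j, covariate x i j l * response x i j s =
    (x i) (j, Sum.inl l) * (x i) (j, Sum.inr s) := fun _ _ => rfl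
  simp only [e2] at h1
  rw [← h1, add_comm]
  congr 1
  simp only [Finset.sum_mul]
  symm
  rw [Finset.sum_comm]
  refine Finset.sum_congr rfl fun i _ => ?_
  rw [Finset.sum_comm]
  refine Finset.sum_congr rfl fun j _ => ?_
  rw [Finset.mul_sum]
  refine Finset.sum_congr rfl fun m _ => ?_
  simp only [covariate, ridgeVec]
  ring

theorem contDiff_ridgeVec (hk : 0 < k) (hlam : 0 < lam) {m : WithTop ℕ∞} :
    ContDiff ℝ m (ridgeVec lam : (Fin n → Block k d b) → EuclideanSpace ℝ (Fin d × Fin b)) := by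
  -- For n = 0 the penalty nkλ vanishes and invertibility is lost, but there is only one data set,
  -- so the function is constant.
  rcases Nat.eq_zero_or_pos n with rfl | hn
  · rw [show (ridgeVec lam : (Fin 0 → Block k d b) → _) = fun _ => ridgeVec lam 0 from
      funext fun x => congrArg _ (Subsingleton.elim _ _)]
    exact contDiff_const
  have h : (ridgeVec lam : (Fin n → Block k d b) → EuclideanSpace ℝ (Fin d × Fin b)) =
      fun x => (gramOp lam x).inverse (crossVec x) := by
    funext x
    rw [← gramOp_ridgeVec hn hk hlam x]
    obtain ⟨M, hM⟩ := isInvertible_gramOp hn hk hlam x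
    rw [← hM]
    simp
  rw [h]
  have hG : ContDiff ℝ m (gramOp lam : (Fin n → Block k d b) → _) := by
    refine contDiff_const.add (ContDiff.sum fun i _ => ?_)
    exact (gramForm.contDiff.comp (contDiff_apply ℝ _ i)).clm_apply (contDiff_apply ℝ _ i)
  have hA : ContDiff ℝ m (crossVec : (Fin n → Block k d b) → _) := by
    refine ContDiff.sum fun i _ => ?_
    exact (crossForm.contDiff.comp (contDiff_apply ℝ _ i)).clm_apply (contDiff_apply ℝ _ i)
  refine ContDiff.clm_apply ?_ hA
  rw [contDiff_iff_contDiffAt]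
  intro x
  exact (isInvertible_gramOp hn hk hlam x).contDiffAt_map_inverse.comp x hG.contDiffAt

/-- The average of the squared norms of the points of the data. -/
noncomputable def meanSq (x : Fin n → Block k d b) : ℝ := (∑ i, ‖x i‖ ^ 2) / ((n : ℝ) * k)

theorem meanSq_nonneg (x : Fin n → Block k d b) : 0 ≤ meanSq x :=
  div_nonneg (Finset.sum_nonneg fun _ _ => sq_nonneg _) (by positivity)

/-- Coercivity applied to M B̂ = A, with ‖A‖ ≤ ∑ ‖v‖ ‖y‖ ≤ ∑ ‖x_ij‖². Gaussian surrogates are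
unbounded, so a bound in terms of the data is needed. -/
theorem norm_ridgeVec_le (hk : 0 < k) (hlam : 0 < lam) (x : Fin n → Block k d b) :
    ‖ridgeVec lam x‖ ≤ lam⁻¹ * meanSq x := by
  rcases Nat.eq_zero_or_pos n with rfl | hn
  · have : ridgeVec lam x = 0 := by
      ext p; simp [ridgeVec, ridge]
    rw [this, norm_zero]
    exact mul_nonneg (by positivity) (meanSq_nonneg x)
  refine (norm_le_mul_norm_gramOp hn hk hlam x _).trans ?_
  rw [gramOp_ridgeVec hn hk hlam, meanSq, div_mul_eq_mul_div, mul_div_assoc]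
  gcongr
  refine norm_sum_le_of_le _ fun i _ => (norm_crossForm_le _ _).trans (le_of_eq ?_)
  rw [← sum_pointNorm_sq]
  exact Finset.sum_congr rfl fun j _ => (sq _).symm

/-- The sum over the other blocks does not see what sits in slot i, so `w₀` is arbitrary there. With
`w₀ = 0` this displays M and A as a constant plus a quadratic form in w. -/
theorem sum_interp {E V : Type*} [AddCommMonoid V] (f : E → V) (u z : Fin n → E) (i : Fin n)
    (w w₀ : E) :
    ∑ j, f (interp u z i w j) = (∑ j ∈ Finset.univ.erase i, f (interp u z i w₀ j)) + f w := by
  rw [← Finset.sum_erase_add _ _ (Finset.mem_univ i)]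
  congr 1
  · refine Finset.sum_congr rfl fun j hj => ?_
    have := Finset.ne_of_mem_erase hj
    simp [interp, this]
  · simp [interp]

theorem contDiff_interp {E : Type*} [NormedAddCommGroup E] [NormedSpace ℝ E] (u z : Fin n → E)
    (i : Fin n) {m : WithTop ℕ∞} : ContDiff ℝ m (interp u z i) := by
  rw [contDiff_pi]
  intro j
  simp only [interp]
  split_ifs
  · exact contDiff_const
  · exact contDiff_id
  · exact contDiff_const

/-- This is `DerivShape.of_linear_equation` with ε = 1/(λnk). The 2 in its hypotheses comes from the
two slots of the bilinear forms `gramForm` and `crossForm`. -/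
theorem derivShape_ridgeVec (hn : 0 < n) (hk : 0 < k) (hlam : 0 < lam)
    (u z : Fin n → Block k d b) (i : Fin n) (w : Block k d b) :
    DerivShape (fun p => EuclideanSpace.single p (1 : ℝ))
      (fun p => lam⁻¹ / ((n : ℝ) * k) * pointNorm p.1 w)
      (fun p q => if p.1 = q.1 then lam⁻¹ / ((n : ℝ) * k) else 0)
      (fun w => ridgeVec lam (interp u z i w)) w
      (48 * (1 + lam⁻¹ * meanSq (interp u z i w))) := by
  have hε : 0 ≤ lam⁻¹ / ((n : ℝ) * k) := by positivity
  have eM : (fun w => gramOp lam (interp u z i w)) = fun w => (((n : ℝ) * k * lam) •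
      ContinuousLinearMap.id ℝ (EuclideanSpace ℝ (Fin d × Fin b)) +
      ∑ j ∈ Finset.univ.erase i, gramForm (interp u z i 0 j) (interp u z i 0 j)) +
      gramForm w w := by
    funext w
    rw [gramOp, sum_interp (fun y => gramForm y y) u z i w 0, add_assoc]
  have eA : (fun w => crossVec (interp u z i w)) = fun w =>
      (∑ j ∈ Finset.univ.erase i, crossForm (interp u z i 0 j) (interp u z i 0 j)) +
      crossForm w w := by
    funext w
    rw [crossVec, sum_interp (fun y => crossForm y y) u z i w 0]
  have two : ∀ {V : Type} [NormedAddCommGroup V] (x y : V) (c : ℝ), ‖x‖ ≤ c → ‖y‖ ≤ c →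
      lam⁻¹ / ((n : ℝ) * k) * ‖x + y‖ ≤ 2 * (lam⁻¹ / ((n : ℝ) * k) * c) := by
    intro V _ x y c hx hy
    have : ‖x + y‖ ≤ 2 * c := (norm_add_le _ _).trans (by linarith)
    calc _ ≤ lam⁻¹ / ((n : ℝ) * k) * (2 * c) := by gcongr
      _ = _ := by ring
  have hss : ∀ p q : Fin k × (Fin d ⊕ Fin b),
      pointNorm p.1 (EuclideanSpace.single q (1 : ℝ) : Block k d b) = if p.1 = q.1 then 1 else 0 := by
    intro p q
    rw [pointNorm_single]
    simp only [eq_comm]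
  have hΔ : ∀ p q : Fin k × (Fin d ⊕ Fin b), (if p.1 = q.1 then lam⁻¹ / ((n : ℝ) * k) else 0) =
      lam⁻¹ / ((n : ℝ) * k) * (if p.1 = q.1 then 1 else 0) := by
    intro p q; split_ifs <;> simp
  refine DerivShape.of_linear_equation (M := fun w => gramOp lam (interp u z i w))
    (A := fun w => crossVec (interp u z i w)) (ε := lam⁻¹ / ((n : ℝ) * k))
    (fun p => mul_nonneg hε (pointNorm_nonneg _ _)) (fun p q => by split_ifs <;> positivity)
    ?_ ?_ (fun v => gramOp_ridgeVec hn hk hlam _) hε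
    (norm_le_mul_norm_gramOp hn hk hlam _) ?_ ?_ ?_ ?_ ?_ ?_ ?_
  · rw [eM]; exact contDiff_const_add_quadratic _ _
  · exact (contDiff_ridgeVec hk hlam).comp (contDiff_interp u z i)
  · have := norm_ridgeVec_le hk hlam (interp u z i w)
    linarith
  · intro p
    rw [eM, dirDeriv_const_add_quadratic]
    refine two _ _ _ ((norm_gramForm_le _ _).trans ?_) ((norm_gramForm_le _ _).trans ?_)
    · rw [sum_pointNorm_single_mul]
    · rw [sum_pointNorm_mul_single]
  · intro p q
    rw [eM, dirDeriv_dirDeriv_const_add_quadratic, hΔ]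
    refine two _ _ _ ((norm_gramForm_le _ _).trans ?_) ((norm_gramForm_le _ _).trans ?_)
    · rw [sum_pointNorm_mul_single, hss]
    · rw [sum_pointNorm_single_mul, hss]
  · intro p q s
    rw [eM, dirDeriv_dirDeriv_dirDeriv_const_add_quadratic]
  · intro p
    rw [eA, dirDeriv_const_add_quadratic]
    refine two _ _ _ ((norm_crossForm_le _ _).trans ?_) ((norm_crossForm_le _ _).trans ?_)
    · rw [sum_pointNorm_single_mul]
    · rw [sum_pointNorm_mul_single]
  · intro p q
    rw [eA, dirDeriv_dirDeriv_const_add_quadratic, hΔ]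
    refine two _ _ _ ((norm_crossForm_le _ _).trans ?_) ((norm_crossForm_le _ _).trans ?_)
    · rw [sum_pointNorm_mul_single, hss]
    · rw [sum_pointNorm_single_mul, hss]
  · intro p q s
    rw [eA, dirDeriv_dirDeriv_dirDeriv_const_add_quadratic]

end Ridge

/-! ### Derivative bounds for quadratic functions of the ridge estimator. -/

section QuadraticOfRidge

/-- `Q` is a quadratic map whose constant, linear and bilinear parts have norms at most `K`. -/
def IsQuadraticBounded {V H : Type*} [NormedAddCommGroup V] [NormedSpace ℝ V]
    [NormedAddCommGroup H] [NormedSpace ℝ H] (Q : V → H) (K : ℝ) : Prop :=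
  ∃ (c : H) (l : V →L[ℝ] H) (q : V →L[ℝ] V →L[ℝ] H), ‖c‖ ≤ K ∧ ‖l‖ ≤ K ∧ ‖q‖ ≤ K ∧
    ∀ B, Q B = c + l B + q B B

variable {n k d b : ℕ} {lam : ℝ} {H : Type*} [NormedAddCommGroup H] [NormedSpace ℝ H]
  {Q : EuclideanSpace ℝ (Fin d × Fin b) → H} {K : ℝ}

theorem IsQuadraticBounded.contDiff (hQ : IsQuadraticBounded Q K) {m : WithTop ℕ∞} :
    ContDiff ℝ m Q := by
  obtain ⟨c, l, q, -, -, -, h⟩ := hQ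
  rw [show Q = _ from funext h]
  exact (contDiff_const.add l.contDiff).add (q.contDiff.clm_apply contDiff_id)

theorem IsQuadraticBounded.nonneg (hQ : IsQuadraticBounded Q K) : 0 ≤ K := by
  obtain ⟨c, -, -, hc, -⟩ := hQ
  exact (norm_nonneg c).trans hc

theorem IsQuadraticBounded.contDiff_ridge (hQ : IsQuadraticBounded Q K) (hk : 0 < k)
    (hlam : 0 < lam) {m : WithTop ℕ∞} :
    ContDiff ℝ m (fun x : Fin n → Block k d b => Q (ridgeVec lam x)) :=
  hQ.contDiff.comp (contDiff_ridgeVec hk hlam)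

/-- A bound, up to constants, for the derivatives of the ridge estimator in block `i`. -/
noncomputable def envelope (i : Fin n) (x : Fin n → Block k d b) : ℝ :=
  (1 + ‖x i‖ ^ 2 / k) ^ 4 + (∑ j, (1 + ‖x j‖ ^ 2 / k) ^ 4) / n

theorem one_le_envelope (i : Fin n) (x : Fin n → Block k d b) : 1 ≤ envelope i x := by
  have h1 : (1 : ℝ) ≤ (1 + ‖x i‖ ^ 2 / k) ^ 4 := by
    refine one_le_pow₀ ?_
    have : 0 ≤ ‖x i‖ ^ 2 / k := by positivity
    linarith
  have h2 : (0 : ℝ) ≤ (∑ j, (1 + ‖x j‖ ^ 2 / k) ^ 4) / n := by positivity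
  rw [envelope]; linarith

/-- The product of a global average and a term of block i is decoupled by 2ab ≤ a² + b², so that
afterwards norms only need to be added. -/
theorem sq_mul_sq_le_envelope (i : Fin n) (x : Fin n → Block k d b) :
    (1 + meanSq x) ^ 2 * (1 + ‖x i‖ ^ 2 / k) ^ 2 ≤ envelope i x := by
  have hn : (0 : ℝ) < n := by exact_mod_cast i.pos
  -- Jensen's inequality for the fourth power, with uniform weights 1/n.
  have h1 : (1 + meanSq x) ^ 4 ≤ (∑ j, (1 + ‖x j‖ ^ 2 / k) ^ 4) / n := by
    have := Real.pow_arith_mean_le_arith_mean_pow (Finset.univ : Finset (Fin n))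
      (fun _ => (n : ℝ)⁻¹) (fun j => 1 + ‖x j‖ ^ 2 / k) (fun _ _ => by positivity)
      (by simp [hn.ne']) (fun _ _ => by positivity) 4
    rw [← Finset.mul_sum, ← Finset.mul_sum, Finset.sum_add_distrib, ← Finset.sum_div] at this
    rw [div_eq_inv_mul (∑ j, (1 + ‖x j‖ ^ 2 / k) ^ 4)]
    refine le_trans (le_of_eq ?_) this
    rw [meanSq]
    congr 1
    simp only [Finset.sum_const, Finset.card_univ, Fintype.card_fin, nsmul_eq_mul, mul_one]
    rw [mul_add, inv_mul_cancel₀ hn.ne', div_mul_eq_div_div]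
    congr 1
    rw [div_div, mul_comm (n : ℝ) k, ← div_div, div_eq_inv_mul _ (n : ℝ)]
  rw [envelope]
  nlinarith [sq_nonneg ((1 + meanSq x) ^ 2 - (1 + ‖x i‖ ^ 2 / k) ^ 2),
    sq_nonneg ((1 + meanSq x) ^ 2), sq_nonneg ((1 + ‖x i‖ ^ 2 / k) ^ 2)]

/-- The constant in the bounds for the derivatives of a quadratic function of the ridge
estimator. -/
noncomputable def ridgeConst (lam K : ℝ) : ℝ := 92160 * (1 + lam⁻¹) ^ 5 * K

theorem derivNorm_quadratic_ridge_le (hQ : IsQuadraticBounded Q K) (hk : 0 < k) (hlam : 0 < lam)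
    (u z : Fin n → Block k d b) (i : Fin n) (w : Block k d b) {r : ℕ} (hr : r ≤ 3) :
    derivNorm r (fun w => Q (ridgeVec lam (interp u z i w))) w ≤
      ridgeConst lam K * derivRate n k (d + b) r * envelope i (interp u z i w) := by
  have hK := hQ.nonneg
  have hB := derivShape_ridgeVec i.pos hk hlam u z i w
  have hBC : ContDiff ℝ 3 (fun w => ridgeVec lam (interp u z i w)) :=
    (contDiff_ridgeVec hk hlam).comp (contDiff_interp u z i)
  have hε : 0 ≤ lam⁻¹ / ((n : ℝ) * k) := by positivity
  have ht : ∀ p : Fin k × (Fin d ⊕ Fin b), 0 ≤ lam⁻¹ / ((n : ℝ) * k) * pointNorm p.1 w :=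
    fun p => mul_nonneg hε (pointNorm_nonneg _ _)
  have hΔ : ∀ p q : Fin k × (Fin d ⊕ Fin b),
      0 ≤ (if p.1 = q.1 then lam⁻¹ / ((n : ℝ) * k) else 0) := fun p q => by
    split_ifs <;> positivity
  have hm := meanSq_nonneg (interp u z i w)
  set m := meanSq (interp u z i w) with hm_def
  set κ := 48 * (1 + lam⁻¹ * m) with hκ
  have hL : 0 ≤ lam⁻¹ := by positivity
  have hκ1 : 1 ≤ κ := by nlinarith [mul_nonneg hL hm]
  obtain ⟨c, l, q, hc, hl, hq, hQe⟩ := id hQ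
  have hf : DerivShape (fun p => EuclideanSpace.single p (1 : ℝ))
      (fun p => lam⁻¹ / ((n : ℝ) * k) * pointNorm p.1 w)
      (fun p q => if p.1 = q.1 then lam⁻¹ / ((n : ℝ) * k) else 0)
      (fun w => Q (ridgeVec lam (interp u z i w))) w (‖c‖ + K * κ + 8 * K * (κ * κ)) := by
    simp only [hQe]
    refine DerivShape.add (contDiff_const.add (l.contDiff.comp hBC)) ?_ (DerivShape.add
      contDiff_const (l.contDiff.comp hBC) (DerivShape.const ht hΔ c w) (hB.clm l hl hBC))
      (DerivShape.bilinear ht hΔ q hq hBC hBC hB hB)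
    exact (q.contDiff.comp hBC).clm_apply hBC
  have hfC : ContDiff ℝ 3 (fun w => Q (ridgeVec lam (interp u z i w))) := hQ.contDiff.comp hBC
  have h1 := DerivShape.derivNorm_le_rate (x := fun j => pointNorm j w) i.pos hk hL hfC hf hr
  rw [sum_pointNorm_sq, Fintype.card_sum, Fintype.card_fin, Fintype.card_fin, Nat.cast_add] at h1
  -- Since κ ≥ 1 the left side is at most 10Kκ², and 10 · 48² = 23040. The factor 4(1 + λ⁻¹)³ of
  -- `DerivShape.derivNorm_le_rate` turns this into the 92160(1 + λ⁻¹)⁵ of `ridgeConst`.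
  have hκf : ‖c‖ + K * κ + 8 * K * (κ * κ) ≤ 23040 * (1 + lam⁻¹) ^ 2 * K * (1 + m) ^ 2 := by
    have h2 : ‖c‖ + K * κ + 8 * K * (κ * κ) ≤ 10 * K * κ ^ 2 := by
      nlinarith [mul_le_mul_of_nonneg_left hκ1 hK, mul_le_mul_of_nonneg_left hκ1
        (mul_nonneg hK (by linarith : 0 ≤ κ))]
    have h3 : κ ≤ 48 * ((1 + lam⁻¹) * (1 + m)) := by
      rw [hκ]; nlinarith
    calc _ ≤ 10 * K * κ ^ 2 := h2
      _ ≤ 10 * K * (48 * ((1 + lam⁻¹) * (1 + m))) ^ 2 := by gcongr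
      _ = _ := by ring
  have hrate := derivRate_nonneg (n := n) (k := k) (D := d + b) (by positivity) (by positivity)
    (by positivity) r
  have hx : interp u z i w i = w := by simp [interp]
  have henv := sq_mul_sq_le_envelope i (interp u z i w)
  rw [hx, ← hm_def] at henv
  refine h1.trans ?_
  calc _ ≤ 23040 * (1 + lam⁻¹) ^ 2 * K * (1 + m) ^ 2 * (4 * (1 + lam⁻¹) ^ 3) *
        derivRate n k (d + b) r * (1 + ‖w‖ ^ 2 / k) ^ 2 := by gcongr
    _ = ridgeConst lam K * derivRate n k (d + b) r *
        ((1 + m) ^ 2 * (1 + ‖w‖ ^ 2 / k) ^ 2) := by rw [ridgeConst]; ring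
    _ ≤ _ := by
      have : 0 ≤ ridgeConst lam K := by rw [ridgeConst]; positivity
      gcongr

/-- Monotonicity in the block norm replaces the supremum over the segment [0, e] by the value at its
end point e. -/
theorem envelope_interp_mono (u z : Fin n → Block k d b) (i : Fin n) {w e : Block k d b}
    (h : ‖w‖ ≤ ‖e‖) : envelope i (interp u z i w) ≤ envelope i (interp u z i e) := by
  have : ∀ j, ‖interp u z i w j‖ ≤ ‖interp u z i e j‖ := by
    intro j
    simp only [interp]
    split_ifs <;> first | exact le_rfl | exact h
  rw [envelope, envelope]
  gcongr with j
  · exact this i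
  · exact this j

theorem norm_le_of_mem_segment_zero {E : Type*} [NormedAddCommGroup E] [NormedSpace ℝ E] {w e : E}
    (h : w ∈ segment ℝ 0 e) : ‖w‖ ≤ ‖e‖ := by
  obtain ⟨a, c, ha, hc, hac, rfl⟩ := h
  rw [smul_zero, zero_add, norm_smul, Real.norm_of_nonneg hc]
  exact mul_le_of_le_one_left (norm_nonneg _) (by linarith)

theorem ridgeConst_nonneg (hlam : 0 < lam) (hK : 0 ≤ K) : 0 ≤ ridgeConst lam K := by
  rw [ridgeConst]; positivity

theorem supDeriv_quadratic_ridge_le (hQ : IsQuadraticBounded Q K) (hk : 0 < k) (hlam : 0 < lam)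
    (u z : Fin n → Block k d b) (i : Fin n) (e : Block k d b) {r : ℕ} (hr : r ≤ 3) :
    supDeriv (fun x => Q (ridgeVec lam x)) r u z i e ≤ ENNReal.ofReal
      (ridgeConst lam K * derivRate n k (d + b) r * envelope i (interp u z i e)) := by
  refine iSup₂_le fun w hw => ENNReal.ofReal_le_ofReal ?_
  refine (derivNorm_quadratic_ridge_le hQ hk hlam u z i w hr).trans ?_
  have h1 := ridgeConst_nonneg hlam hQ.nonneg
  have h2 := derivRate_nonneg (n := n) (k := k) (D := d + b) (by positivity) (by positivity)
    (by positivity) r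
  gcongr
  exact envelope_interp_mono u z i (norm_le_of_mem_segment_zero hw)

end QuadraticOfRidge

/-! ### From moments of the blocks to noise stability. -/

section Moments

variable {Ω : Type*} [MeasurableSpace Ω] {P : Measure Ω} {n k d b : ℕ}

/-- The random data `x` have blocks with uniformly bounded moments, at the scale `√k`. -/
def BlockMoments (P : Measure Ω) (M : ℝ) (x : Fin n → Ω → Block k d b) : Prop :=
  ∀ j, AEMeasurable (x j) P ∧
    eLpNorm (fun ω => (1 + ‖x j ω‖ ^ 2 / k) ^ 4) 6 P ≤ ENNReal.ofReal M

/-- The own block and the average over all blocks each contribute M by the triangle inequality; no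
independence is involved. -/
theorem BlockMoments.eLpNorm_envelope_le {M : ℝ} {x : Fin n → Ω → Block k d b}
    (hx : BlockMoments P M x) (i : Fin n) :
    eLpNorm (fun ω => envelope i (fun j => x j ω)) 6 P ≤ ENNReal.ofReal (2 * M) := by
  have hn : (0 : ℝ) < n := by exact_mod_cast i.pos
  have hmeas : ∀ j, AEStronglyMeasurable (fun ω => (1 + ‖x j ω‖ ^ 2 / k) ^ 4) P := by
    intro j
    have := (hx j).1
    fun_prop
  have h1 : eLpNorm (fun ω => (∑ j, (1 + ‖x j ω‖ ^ 2 / k) ^ 4) / (n : ℝ)) 6 P ≤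
      ENNReal.ofReal M := by
    have e1 : (fun ω => (∑ j, (1 + ‖x j ω‖ ^ 2 / k) ^ 4) / (n : ℝ)) =
        (n : ℝ)⁻¹ • ∑ j, fun ω => (1 + ‖x j ω‖ ^ 2 / k) ^ 4 := by
      funext ω; simp [div_eq_inv_mul]
    rw [e1, eLpNorm_const_smul]
    calc _ ≤ ‖(n : ℝ)⁻¹‖ₑ * ∑ j : Fin n, ENNReal.ofReal M := by
          gcongr
          exact (eLpNorm_sum_le (fun j _ => hmeas j) (by norm_num)).trans
            (Finset.sum_le_sum fun j _ => (hx j).2)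
      _ = ENNReal.ofReal M := by
          rw [Finset.sum_const, Finset.card_univ, Fintype.card_fin, nsmul_eq_mul, ← mul_assoc,
            Real.enorm_of_nonneg (by positivity), ← ENNReal.ofReal_natCast,
            ← ENNReal.ofReal_mul (by positivity), inv_mul_cancel₀ hn.ne']
          simp
  -- `ENNReal.ofReal` is additive on nonnegative numbers only; for M ≤ 0 both sides vanish.
  have hM : 0 ≤ M ∨ M ≤ 0 := le_total _ _
  have h2 := eLpNorm_add_le (p := 6) (μ := P) (hmeas i)
    (g := fun ω => (∑ j, (1 + ‖x j ω‖ ^ 2 / k) ^ 4) / (n : ℝ)) (by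
      have := fun j => (hx j).1
      fun_prop) (by norm_num)
  refine h2.trans ((add_le_add (hx i).2 h1).trans ?_)
  rcases hM with hM | hM
  · rw [← ENNReal.ofReal_add hM hM]
    exact ENNReal.ofReal_le_ofReal (by linarith)
  · simp [ENNReal.ofReal_of_nonpos hM]

theorem BlockMoments.interp {M : ℝ} {U Z : Fin n → Ω → Block k d b} (hU : BlockMoments P M U)
    (hZ : BlockMoments P M Z) (i : Fin n) {e : Ω → Block k d b} (he : e = U i ∨ e = Z i) :
    BlockMoments P M (fun j ω => interp (fun j => U j ω) (fun j => Z j ω) i (e ω) j) := by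
  intro j
  simp only [_root_.interp]
  split_ifs with h1 h2
  · exact hU j
  · subst h2
    rcases he with rfl | rfl
    · exact hU j
    · exact hZ j
  · exact hZ j

/-- Under a probability measure the L⁶ norm of the envelope dominates all lower ones, and the
interpolated data have blocks from U or Z only, so one moment bound covers every i, r and m. -/
theorem alpha_quadratic_ridge_le [IsProbabilityMeasure P] {lam K M : ℝ} {H : Type*}
    [NormedAddCommGroup H] [NormedSpace ℝ H] {Q : EuclideanSpace ℝ (Fin d × Fin b) → H}
    (hQ : IsQuadraticBounded Q K) (hk : 0 < k) (hlam : 0 < lam) {U Z : Fin n → Ω → Block k d b}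
    (hU : BlockMoments P M U) (hZ : BlockMoments P M Z) {r : ℕ} (hr : r ≤ 3) {m : ℝ≥0∞}
    (hm : m ≤ 6) :
    alpha P (fun x => Q (ridgeVec lam x)) U Z r m ≤
      ENNReal.ofReal (ridgeConst lam K * (2 * M) * derivRate n k (d + b) r) := by
  have h1 := ridgeConst_nonneg hlam hQ.nonneg
  have h2 := derivRate_nonneg (n := n) (k := k) (D := d + b) (by positivity) (by positivity)
    (by positivity) r
  have key : ∀ (i : Fin n) (e : Ω → Block k d b), (e = U i ∨ e = Z i) →
      eLpNorm (fun ω => supDeriv (fun x => Q (ridgeVec lam x)) r (fun j => U j ω)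
        (fun j => Z j ω) i (e ω)) m P ≤
      ENNReal.ofReal (ridgeConst lam K * (2 * M) * derivRate n k (d + b) r) := by
    intro i e he
    have hx := hU.interp hZ i he
    have hmeas : AEStronglyMeasurable (fun ω => envelope i (interp (fun j => U j ω)
        (fun j => Z j ω) i (e ω))) P := by
      have := fun j => (hx j).1
      unfold envelope
      fun_prop
    calc _ ≤ eLpNorm ((ridgeConst lam K * derivRate n k (d + b) r) • fun ω => envelope i
            (interp (fun j => U j ω) (fun j => Z j ω) i (e ω))) m P := by
          refine eLpNorm_mono_enorm fun ω => ?_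
          rw [enorm_eq_self, Pi.smul_apply, smul_eq_mul, Real.enorm_of_nonneg]
          · exact supDeriv_quadratic_ridge_le hQ hk hlam _ _ i (e ω) hr
          · exact mul_nonneg (mul_nonneg h1 h2) (zero_le_one.trans (one_le_envelope _ _))
      _ ≤ eLpNorm ((ridgeConst lam K * derivRate n k (d + b) r) • fun ω => envelope i
            (interp (fun j => U j ω) (fun j => Z j ω) i (e ω))) 6 P :=
          eLpNorm_le_eLpNorm_of_exponent_le hm (hmeas.const_smul _)
      _ ≤ ENNReal.ofReal (ridgeConst lam K * derivRate n k (d + b) r) *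
            ENNReal.ofReal (2 * M) := by
          rw [eLpNorm_const_smul, Real.enorm_of_nonneg (mul_nonneg h1 h2)]
          gcongr
          exact hx.eLpNorm_envelope_le i
      _ = _ := by
          rw [← ENNReal.ofReal_mul (mul_nonneg h1 h2)]
          congr 1; ring
  exact iSup_le fun i => max_le (key i (U i) (Or.inl rfl)) (key i (Z i) (Or.inr rfl))

end Moments

/-! ### The growth assumption implies the smoothness condition. -/

section Rates

theorem tendsto_growth {k d b : ℕ → ℕ}
    (hgrowth : (fun n : ℕ => ((b n : ℝ) + (d n : ℝ)) ^ (3 / 2 : ℝ) * (k n : ℝ) ^ (1 / 2 : ℝ))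
      =o[atTop] (fun n : ℕ => (n : ℝ))) :
    Tendsto (fun n : ℕ => ((d n : ℝ) + b n) * √((d n : ℝ) + b n) * √(k n : ℝ) / n) atTop (𝓝 0) := by
  have h := hgrowth.tendsto_div_nhds_zero
  refine h.congr fun n => ?_
  have h32 : ((b n : ℝ) + d n) ^ (3 / 2 : ℝ) = ((d n : ℝ) + b n) * √((d n : ℝ) + b n) := by
    rw [add_comm, Real.sqrt_eq_rpow, ← Real.rpow_one_add' (by positivity) (by norm_num)]
    norm_num
  rw [h32, Real.sqrt_eq_rpow (k n : ℝ)]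

/-- With s = nk^{3/2}, rates R_r and ψ = D^{3/2}k^{1/2}/n, direct computation gives sR₁R₂ = sR₃ = ψ
and sR₁³ = D^{3/2}/n² ≤ ψ. As R₀ = 1, each of the six products is O(ψ), and ψ → 0. -/
theorem smoothnessCondition_of_le {k d b : ℕ → ℕ} (hk : ∀ n, 0 < k n)
    (hgrowth : (fun n : ℕ => ((b n : ℝ) + (d n : ℝ)) ^ (3 / 2 : ℝ) * (k n : ℝ) ^ (1 / 2 : ℝ))
      =o[atTop] (fun n : ℕ => (n : ℝ)))
    {a : ℕ → ℕ → ℝ≥0∞ → ℝ≥0∞} {K : ℝ}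
    (ha : ∀ n, ∀ r ≤ 3, ∀ m ≤ 6, a n r m ≤ ENNReal.ofReal (K * derivRate n (k n) (d n + b n) r)) :
    SmoothnessCondition k a := by
  -- With K ≥ 1 all powers of K that occur are at most K³, so a single limit serves the six
  -- products.
  wlog hK : 1 ≤ K generalizing K
  · refine this (K := 1) (fun n r hr m hm => (ha n r hr m hm).trans (ENNReal.ofReal_le_ofReal ?_))
      le_rfl
    have := derivRate_nonneg (n := n) (k := k n) (D := d n + b n) (by positivity) (by positivity)
      (by positivity) r
    push Not at hK
    gcongr
  have hψ := tendsto_growth hgrowth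
  set ψ : ℕ → ℝ := fun n => ((d n : ℝ) + b n) * √((d n : ℝ) + b n) * √(k n : ℝ) / n with hψ_def
  have hlim : Tendsto (fun n => ENNReal.ofReal (K ^ 3 * ψ n)) atTop (𝓝 0) := by
    have := ENNReal.tendsto_ofReal (hψ.const_mul (K ^ 3))
    simpa using this
  set R : ℕ → ℕ → ℝ := fun n => derivRate n (k n) (d n + b n) with hR
  have hR0 : ∀ n r, 0 ≤ R n r := fun n r => derivRate_nonneg (by positivity) (by positivity)
    (by positivity) r
  set s : ℕ → ℝ := fun n => (n : ℝ) * (k n : ℝ) ^ (3 / 2 : ℝ) with hs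
  have hs0 : ∀ n, 0 ≤ s n := fun n => by rw [hs]; positivity
  have hsk : ∀ n, s n = n * (k n * √(k n : ℝ)) := by
    intro n
    rw [hs, Real.sqrt_eq_rpow, ← Real.rpow_one_add' (by positivity) (by norm_num)]
    norm_num
  have hfacts : ∀ n : ℕ, 1 ≤ n → s n * R n 1 ^ 3 ≤ ψ n ∧ s n * (R n 1 * R n 2) = ψ n ∧
      s n * R n 3 = ψ n := by
    intro n hn
    have hn' : (1 : ℝ) ≤ n := by exact_mod_cast hn
    have hk' : (1 : ℝ) ≤ k n := by exact_mod_cast hk n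
    have hD : (0 : ℝ) ≤ (d n : ℝ) + b n := by positivity
    have sk : √(k n : ℝ) * √(k n : ℝ) = k n := Real.mul_self_sqrt (by positivity)
    have sD : √((d n : ℝ) + b n) * √((d n : ℝ) + b n) = (d n : ℝ) + b n := Real.mul_self_sqrt hD
    have sk1 : 1 ≤ √(k n : ℝ) := by rw [Real.one_le_sqrt]; exact hk'
    simp only [hR, hψ_def, hsk, derivRate, Real.sqrt_mul hD]
    set κ := √(k n : ℝ) with hκ
    set δ := √((d n : ℝ) + b n) with hδ
    rw [← sk, ← sD]
    have hκ0 : 0 < κ := by linarith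
    have hδ0 : 0 ≤ δ := Real.sqrt_nonneg _
    refine ⟨?_, ?_, ?_⟩
    · have : (n : ℝ) * (κ * κ * κ) * (δ * κ / (n * (κ * κ))) ^ 3 = δ * δ * δ / (n * n) := by
        field_simp
      rw [this, div_le_div_iff₀ (by positivity) (by positivity)]
      have : δ * δ * δ * 1 ≤ δ * δ * δ * (κ * n) := by gcongr; nlinarith
      nlinarith [mul_nonneg (mul_nonneg hδ0 hδ0) hδ0]
    · field_simp
    · field_simp
  have hKpow : ∀ j ≤ 3, K ^ j ≤ K ^ 3 := fun j hj => pow_le_pow_right₀ hK hj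
  have hK0 : 0 ≤ K := by linarith
  have main : ∀ {g : ℕ → ℝ≥0∞}, (∀ n : ℕ, 1 ≤ n → g n ≤ ENNReal.ofReal (K ^ 3 * ψ n)) →
      Tendsto g atTop (𝓝 0) := by
    intro g hg
    refine tendsto_of_tendsto_of_tendsto_of_le_of_le' tendsto_const_nhds hlim
      (Eventually.of_forall fun _ => zero_le) ?_
    filter_upwards [eventually_ge_atTop 1] with n hn using hg n hn
  have ψ0 : ∀ n, 0 ≤ ψ n := fun n => by rw [hψ_def]; positivity
  have a0 : ∀ n, ∀ m ≤ 6, a n 0 m ≤ ENNReal.ofReal K := fun n m hm => by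
    simpa [derivRate] using ha n 0 (by norm_num) m hm
  have four6 : (4 : ℝ≥0∞) ≤ 6 := by norm_num
  have two6 : (2 : ℝ≥0∞) ≤ 6 := by norm_num
  have aR : ∀ n, ∀ r ≤ 3, ∀ m ≤ 6, a n r m ≤ ENNReal.ofReal (K * R n r) := ha
  refine ⟨?_, main fun n hn => ?_, main fun n hn => ?_, main fun n hn => ?_, main fun n hn => ?_,
    main fun n hn => ?_, main fun n hn => ?_⟩
  · exact Eventually.of_forall fun n r hr m hm =>
      ((ha n r hr m hm).trans_lt ENNReal.ofReal_lt_top).ne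
  all_goals obtain ⟨h1, h2, h3⟩ := hfacts n hn
  · calc _ ≤ ENNReal.ofReal (s n) * ENNReal.ofReal (K * R n 1) ^ 3 := by
          gcongr; exact aR n 1 (by norm_num) 6 le_rfl
      _ = ENNReal.ofReal (K ^ 3 * (s n * R n 1 ^ 3)) := by
          rw [← ENNReal.ofReal_pow (mul_nonneg hK0 (hR0 _ _)), ← ENNReal.ofReal_mul (hs0 n)]
          congr 1; ring
      _ ≤ _ := ENNReal.ofReal_le_ofReal (by gcongr)
  · calc _ ≤ ENNReal.ofReal (s n) * (ENNReal.ofReal K * ENNReal.ofReal (K * R n 1) *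
            ENNReal.ofReal (K * R n 2)) := by
          gcongr
          · exact a0 n 6 le_rfl
          · exact aR n 1 (by norm_num) 6 le_rfl
          · exact aR n 2 (by norm_num) 6 le_rfl
      _ = ENNReal.ofReal (K ^ 3 * (s n * (R n 1 * R n 2))) := by
          have := hR0 n 1
          rw [← ENNReal.ofReal_mul hK0, ← ENNReal.ofReal_mul (by positivity),
            ← ENNReal.ofReal_mul (hs0 n)]
          congr 1; ring
      _ ≤ _ := ENNReal.ofReal_le_ofReal (by rw [h2])
  · calc _ ≤ ENNReal.ofReal (s n) * (ENNReal.ofReal K ^ 2 * ENNReal.ofReal (K * R n 3)) := by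
          gcongr
          · exact a0 n 6 le_rfl
          · exact aR n 3 (by norm_num) 6 le_rfl
      _ = ENNReal.ofReal (K ^ 3 * (s n * R n 3)) := by
          rw [← ENNReal.ofReal_pow hK0, ← ENNReal.ofReal_mul (by positivity),
            ← ENNReal.ofReal_mul (hs0 n)]
          congr 1; ring
      _ ≤ _ := ENNReal.ofReal_le_ofReal (by rw [h3])
  · calc _ ≤ ENNReal.ofReal (s n) * (ENNReal.ofReal (K * R n 1) *
            ENNReal.ofReal (K * R n 2)) := by
          gcongr
          · exact aR n 1 (by norm_num) 4 four6
          · exact aR n 2 (by norm_num) 4 four6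
      _ = ENNReal.ofReal (K ^ 2 * (s n * (R n 1 * R n 2))) := by
          rw [← ENNReal.ofReal_mul (mul_nonneg hK0 (hR0 _ _)), ← ENNReal.ofReal_mul (hs0 n)]
          congr 1; ring
      _ ≤ _ := by
          rw [h2]
          exact ENNReal.ofReal_le_ofReal
            (mul_le_mul_of_nonneg_right (hKpow 2 (by norm_num)) (ψ0 n))
  · calc _ ≤ ENNReal.ofReal (s n) * (ENNReal.ofReal K * ENNReal.ofReal (K * R n 3)) := by
          gcongr
          · exact a0 n 4 four6
          · exact aR n 3 (by norm_num) 4 four6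
      _ = ENNReal.ofReal (K ^ 2 * (s n * R n 3)) := by
          rw [← ENNReal.ofReal_mul hK0, ← ENNReal.ofReal_mul (hs0 n)]
          congr 1; ring
      _ ≤ _ := by
          rw [h3]
          exact ENNReal.ofReal_le_ofReal
            (mul_le_mul_of_nonneg_right (hKpow 2 (by norm_num)) (ψ0 n))
  · calc _ ≤ ENNReal.ofReal (s n) * ENNReal.ofReal (K * R n 3) := by
          gcongr; exact aR n 3 (by norm_num) 2 two6
      _ = ENNReal.ofReal (K ^ 1 * (s n * R n 3)) := by
          rw [← ENNReal.ofReal_mul (hs0 n)]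
          congr 1; ring
      _ ≤ _ := by
          rw [h3]
          exact ENNReal.ofReal_le_ofReal
            (mul_le_mul_of_nonneg_right (hKpow 1 (by norm_num)) (ψ0 n))

end Rates

/-! ### Moments of real Gaussian variables. -/

section GaussianMoments

/-- With u = m + vt, differentiating p(u) times the Gaussian moment generating function acts on
polynomials as p ↦ v p' + u p. -/
theorem hasDerivAt_mul_exp_quadratic {m v t : ℝ} {p : ℝ → ℝ} {p' : ℝ}
    (hp : HasDerivAt p p' (m + v * t)) :
    HasDerivAt (fun t => p (m + v * t) * Real.exp (m * t + v * t ^ 2 / 2))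
      ((v * p' + (m + v * t) * p (m + v * t)) * Real.exp (m * t + v * t ^ 2 / 2)) t := by
  have h1 : HasDerivAt (fun t : ℝ => m + v * t) v t := by
    simpa using ((hasDerivAt_id t).const_mul v).const_add m
  have h2 : HasDerivAt (fun t : ℝ => m * t + v * t ^ 2 / 2) (m + v * t) t := by
    have := ((hasDerivAt_id t).const_mul m).add
      ((((hasDerivAt_id t).pow 2).const_mul v).div_const 2)
    refine this.congr_deriv ?_
    simp; ring
  have h3 := (hp.comp t h1).mul h2.exp
  refine h3.congr_deriv ?_
  simp only [Function.comp_apply]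
  ring

/-- The sixth derivative at 0 of the moment generating function: six iterations of p ↦ v p' + u p
from p = 1, evaluated at u = m. -/
theorem integral_pow_six_gaussianReal (m : ℝ) (v : NNReal) :
    ∫ x, x ^ 6 ∂(gaussianReal m v) =
      m ^ 6 + 15 * m ^ 4 * v + 45 * m ^ 2 * v ^ 2 + 15 * v ^ 3 := by
  have h0 : (0 : ℝ) ∈ interior (integrableExpSet id (gaussianReal m v)) := by
    rw [integrableExpSet_id_gaussianReal]; simp
  have h := iteratedDeriv_mgf_zero h0 6
  rw [mgf_id_gaussianReal] at h
  have hR : (∫ x, (id ^ 6 : ℝ → ℝ) x ∂(gaussianReal m v)) = ∫ x, x ^ 6 ∂(gaussianReal m v) := rfl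
  rw [← hR, ← h]
  have step : ∀ (p q r : ℝ → ℝ), (∀ u, HasDerivAt p (q u) u) → (∀ u, v * q u + u * p u = r u) →
      deriv (fun t : ℝ => p (m + v * t) * Real.exp (m * t + v * t ^ 2 / 2)) =
      fun t => r (m + v * t) * Real.exp (m * t + v * t ^ 2 / 2) :=
    fun p q r hpq hr => funext fun t => by
      rw [(hasDerivAt_mul_exp_quadratic (hpq (m + v * t))).deriv, hr]
  have e0 : (fun t : ℝ => Real.exp (m * t + v * t ^ 2 / 2)) =
      fun t => (fun _ => (1 : ℝ)) (m + v * t) * Real.exp (m * t + v * t ^ 2 / 2) := by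
    funext t; simp
  have mono : ∀ (c : ℝ) (j : ℕ) (u : ℝ),
      HasDerivAt (fun u : ℝ => c * u ^ j) (c * (j * u ^ (j - 1))) u :=
    fun c j u => (hasDerivAt_pow j u).const_mul c
  rw [iteratedDeriv_succ', iteratedDeriv_succ', iteratedDeriv_succ', iteratedDeriv_succ',
    iteratedDeriv_succ', iteratedDeriv_succ', iteratedDeriv_zero, e0,
    step (fun _ => 1) (fun _ => 0) (fun u => 1 * u ^ 1) (fun u => hasDerivAt_const u 1)
      (fun u => by ring),
    step _ _ (fun u => v + 1 * u ^ 2) (mono 1 1) (fun u => by simp; ring),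
    step _ _ (fun u => 3 * v * u ^ 1 + 1 * u ^ 3) (fun u => (mono 1 2 u).const_add _)
      (fun u => by push_cast; ring),
    step _ _ (fun u => 3 * v ^ 2 + (6 * v * u ^ 2 + 1 * u ^ 4))
      (fun u => (mono (3 * v) 1 u).fun_add (mono 1 3 u)) (fun u => by push_cast; ring),
    step _ _ (fun u => 15 * v ^ 2 * u ^ 1 + (10 * v * u ^ 3 + 1 * u ^ 5))
      (fun u => ((mono (6 * v) 2 u).fun_add (mono 1 4 u)).const_add _)
      (fun u => by push_cast; ring),
    step _ _ (fun u => 15 * v ^ 3 + (45 * v ^ 2 * u ^ 2 + (15 * v * u ^ 4 + 1 * u ^ 6)))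
      (fun u => (mono (15 * v ^ 2) 1 u).fun_add ((mono (10 * v) 3 u).fun_add (mono 1 5 u)))
      (fun u => by push_cast; ring)]
  simp
  ring

variable {Ω : Type*} [MeasurableSpace Ω] {P : Measure Ω}

/-- With s = m², compare coefficients of s³ + 15s²v + 45sv² + 15v³ and (5/2)³(s + v)³: one needs
(5/2)³ = 15.625 ≥ 15 and 3 · 15.625 ≥ 45. -/
theorem ProbabilityTheory.HasGaussianLaw.integral_pow_six_le {X : Ω → ℝ} (hX : HasGaussianLaw X P) :
    ∫ ω, X ω ^ 6 ∂P ≤ (5 / 2 * ∫ ω, X ω ^ 2 ∂P) ^ 3 := by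
  have := hX.isProbabilityMeasure
  have hv := variance_eq_sub hX.memLp_two
  have hlaw := hX.map_eq_gaussianReal
  have h6 : ∫ ω, X ω ^ 6 ∂P = ∫ x, x ^ 6 ∂(P.map X) :=
    (integral_map hX.aemeasurable (f := fun x : ℝ => x ^ 6) (by fun_prop)).symm
  rw [h6, hlaw, integral_pow_six_gaussianReal]
  have hv0 := variance_nonneg X P
  rw [Real.coe_toNNReal _ hv0]
  have h2 : ∫ ω, X ω ^ 2 ∂P = Var[X; P] + (∫ ω, X ω ∂P) ^ 2 := by
    rw [hv]; simp
  rw [h2]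
  generalize Var[X; P] = v at *
  generalize ∫ ω, X ω ∂P = m
  have h1 : 0 ≤ m ^ 2 := sq_nonneg m
  generalize hs : m ^ 2 = s at *
  have e4 : m ^ 4 = s ^ 2 := by rw [← hs]; ring
  have e6 : m ^ 6 = s ^ 3 := by rw [← hs]; ring
  rw [e4, e6]
  have a1 : 0 ≤ s ^ 3 := by positivity
  have a2 : 0 ≤ s ^ 2 * v := by positivity
  have a3 : 0 ≤ s * v ^ 2 := by positivity
  have a4 : 0 ≤ v ^ 3 := by positivity
  nlinarith

/-- The `L^48` norm of a standard Gaussian variable. -/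
noncomputable def gaussConst : ℝ := (eLpNorm id 48 (gaussianReal 0 1)).toReal

theorem gaussConst_nonneg : 0 ≤ gaussConst := ENNReal.toReal_nonneg

theorem eLpNorm_gaussianReal_le (m : ℝ) {s : ℝ} (hs : 0 ≤ s) {v : NNReal} (hv : (v : ℝ) = s ^ 2) :
    eLpNorm id 48 (gaussianReal m v) ≤ ENNReal.ofReal (|m| + s * gaussConst) := by
  have h1 : gaussianReal m v = (gaussianReal 0 1).map (fun x => m + s * x) := by
    have : (fun x : ℝ => m + s * x) = (fun x => m + x) ∘ (fun x => s * x) := rfl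
    rw [this, ← Measure.map_map (by fun_prop) (by fun_prop), gaussianReal_map_const_mul,
      gaussianReal_map_const_add]
    congr 1
    · ring
    · ext; simp [hv]
  have hfin : eLpNorm id 48 (gaussianReal 0 1) ≠ ∞ :=
    (memLp_id_gaussianReal' 48 (by norm_num)).2.ne
  rw [h1, eLpNorm_map_measure (by fun_prop) (by fun_prop)]
  have h2 : (id ∘ fun x : ℝ => m + s * x) = (fun _ => m) + s • id := rfl
  rw [h2]
  refine (eLpNorm_add_le (by fun_prop) (by fun_prop) (by norm_num)).trans ?_
  rw [eLpNorm_const_smul, eLpNorm_const _ (by norm_num) (NeZero.ne _), Real.enorm_eq_ofReal_abs,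
    Real.enorm_eq_ofReal_abs, abs_of_nonneg hs]
  simp only [measure_univ, ENNReal.one_rpow, mul_one]
  rw [ENNReal.ofReal_add (abs_nonneg _) (mul_nonneg hs gaussConst_nonneg), ENNReal.ofReal_mul hs,
    gaussConst, ENNReal.ofReal_toReal hfin]

/-- The exponent is 48 = 6 · 4 · 2: the envelope contains fourth powers of squared norms and is
measured in L⁶. -/
theorem ProbabilityTheory.HasGaussianLaw.eLpNorm_le {X : Ω → ℝ} (hX : HasGaussianLaw X P) {a : ℝ} (ha : 0 ≤ a)
    (hm : |∫ ω, X ω ∂P| ≤ a) (hv : Var[X; P] ≤ a ^ 2) :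
    eLpNorm X 48 P ≤ ENNReal.ofReal (a * (1 + gaussConst)) := by
  have hv0 := variance_nonneg X P
  have h1 : eLpNorm X 48 P = eLpNorm id 48 (P.map X) := by
    rw [eLpNorm_map_measure (by fun_prop) hX.aemeasurable]; rfl
  rw [h1, hX.map_eq_gaussianReal]
  refine (eLpNorm_gaussianReal_le _ (Real.sqrt_nonneg (Var[X; P])) ?_).trans
    (ENNReal.ofReal_le_ofReal ?_)
  · rw [Real.sq_sqrt hv0, Real.coe_toNNReal _ hv0]
  · have hs : √(Var[X; P]) ≤ a := Real.sqrt_le_iff.2 ⟨ha, hv⟩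
    have := gaussConst_nonneg
    nlinarith

end GaussianMoments

/-! ### Moments of data blocks and of their Gaussian surrogates. -/

section BlockMoments

variable {Ω : Type*} [MeasurableSpace Ω] {P : Measure Ω} {n k d b : ℕ}

/-- The order of magnitude of the coordinates: `d^{-1/2}` for covariates, `b^{-1/2}` for
responses. -/
noncomputable def coordScale {d b : ℕ} : Fin d ⊕ Fin b → ℝ :=
  Sum.elim (fun _ => (d : ℝ) ^ (-(1 / 2) : ℝ)) (fun _ => (b : ℝ) ^ (-(1 / 2) : ℝ))

theorem coordScale_nonneg (a : Fin d ⊕ Fin b) : 0 ≤ coordScale a := by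
  rcases a with a | a <;> simp only [coordScale, Sum.elim_inl, Sum.elim_inr] <;> positivity

theorem sum_coordScale_sq_le : ∑ a : Fin d ⊕ Fin b, coordScale a ^ 2 ≤ 2 := by
  have h : ∀ m : ℕ, ∑ _l : Fin m, ((m : ℝ) ^ (-(1 / 2) : ℝ)) ^ 2 ≤ 1 := by
    intro m
    rcases Nat.eq_zero_or_pos m with rfl | hm
    · simp
    have hm' : (0 : ℝ) < m := by exact_mod_cast hm
    rw [Finset.sum_const, Finset.card_univ, Fintype.card_fin, nsmul_eq_mul,
      ← Real.rpow_natCast, ← Real.rpow_mul hm'.le]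
    norm_num
    rw [Real.rpow_neg_one, mul_inv_cancel₀ hm'.ne']
  rw [Fintype.sum_sum_type]
  have h1 := h d
  have h2 := h b
  simp only [coordScale, Sum.elim_inl, Sum.elim_inr]
  linarith

theorem sum_block_coordScale_sq_le (hk : 0 < k) {C : ℝ} :
    (∑ p : Fin k × (Fin d ⊕ Fin b), (C * coordScale p.2) ^ 2) / k ≤ 2 * C ^ 2 := by
  have hk' : (0 : ℝ) < k := by exact_mod_cast hk
  rw [Fintype.sum_prod_type]
  simp only [Finset.sum_const, Finset.card_univ, Fintype.card_fin, nsmul_eq_mul, mul_pow,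
    ← Finset.mul_sum]
  rw [mul_div_cancel_left₀ _ hk'.ne']
  nlinarith [sum_coordScale_sq_le (d := d) (b := b), sq_nonneg C]

theorem eLpNorm_sq_coordinate {X : Ω → ℝ} {p : ℝ≥0∞} :
    eLpNorm (fun ω => X ω ^ 2) p P = eLpNorm X (p * 2) P ^ 2 := by
  have := eLpNorm_norm_rpow (p := p) (μ := P) (q := 2) X (by norm_num)
  simpa using this

/-- Minkowski's inequality in L²⁴ for ‖x‖² = ∑ x_p². The squared scales sum to at most 2 over the
coordinates of a point, hence to at most 2k over a block, and the factor k cancels. -/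
theorem blockMoments_of_coordinates [IsProbabilityMeasure P] (hk : 0 < k) {C : ℝ}
    (hC : 0 ≤ C) {x : Fin n → Ω → Block k d b} (hx : ∀ j, AEMeasurable (x j) P)
    (h : ∀ j p, eLpNorm (fun ω => x j ω p) 48 P ≤ ENNReal.ofReal (C * coordScale p.2)) :
    BlockMoments P ((1 + 2 * C ^ 2) ^ 4) x := by
  intro j
  refine ⟨hx j, ?_⟩
  have hk' : (0 : ℝ) < k := by exact_mod_cast hk
  have hxj := hx j
  have h1 : eLpNorm (fun ω => 1 + ‖x j ω‖ ^ 2 / k) 24 P ≤ ENNReal.ofReal (1 + 2 * C ^ 2) := by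
    have e1 : (fun ω => 1 + ‖x j ω‖ ^ 2 / k) =
        (fun _ => (1 : ℝ)) + (k : ℝ)⁻¹ • ∑ p, fun ω => x j ω p ^ 2 := by
      funext ω
      simp [EuclideanSpace.norm_sq_eq, div_eq_inv_mul]
    rw [e1]
    refine (eLpNorm_add_le (by fun_prop) (by fun_prop) (by norm_num)).trans ?_
    rw [eLpNorm_const_smul, eLpNorm_const _ (by norm_num) (NeZero.ne _),
      ENNReal.ofReal_add zero_le_one (by positivity)]
    refine add_le_add (by simp) ?_
    calc _ ≤ ‖(k : ℝ)⁻¹‖ₑ * ∑ p : Fin k × (Fin d ⊕ Fin b),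
          ENNReal.ofReal ((C * coordScale p.2) ^ 2) := by
          gcongr
          refine (eLpNorm_sum_le (fun p _ => by fun_prop) (by norm_num)).trans
            (Finset.sum_le_sum fun p _ => ?_)
          rw [eLpNorm_sq_coordinate, ENNReal.ofReal_pow (mul_nonneg hC (coordScale_nonneg _)),
            show (24 : ℝ≥0∞) * 2 = 48 by norm_num]
          gcongr
          exact h j p
      _ = ENNReal.ofReal ((∑ p : Fin k × (Fin d ⊕ Fin b), (C * coordScale p.2) ^ 2) / k) := by
          rw [Real.enorm_of_nonneg (by positivity), ← ENNReal.ofReal_sum_of_nonneg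
            (fun _ _ => sq_nonneg _), ← ENNReal.ofReal_mul (by positivity), div_eq_inv_mul]
      _ ≤ _ := ENNReal.ofReal_le_ofReal (sum_block_coordScale_sq_le hk)
  have h2 := eLpNorm_norm_rpow (p := 6) (μ := P) (q := 4) (fun ω => 1 + ‖x j ω‖ ^ 2 / k)
    (by norm_num)
  have e2 : (fun ω => (1 + ‖x j ω‖ ^ 2 / k) ^ 4) =
      fun ω => ‖1 + ‖x j ω‖ ^ 2 / k‖ ^ (4 : ℝ) := by
    funext ω
    rw [Real.norm_of_nonneg (by positivity)]
    norm_cast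
  rw [e2, h2, ENNReal.ofReal_pow (by positivity)]
  have : (6 : ℝ≥0∞) * ENNReal.ofReal 4 = 24 := by
    rw [show ENNReal.ofReal 4 = 4 by simp]; norm_num
  rw [this, show (4 : ℝ) = ((4 : ℕ) : ℝ) by norm_num, ENNReal.rpow_natCast]
  gcongr

/-- Data `U` with independent blocks, and an independent Gaussian surrogate `Z` whose independent
blocks have the same means and covariances; the coordinates of `U` decay with constant `C`. -/
structure GaussianMatch (P : Measure Ω) (U Z : Fin n → Ω → Block k d b) (C : ℝ) : Prop where
  aemeasurable : ∀ i, AEMeasurable (U i) P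
  indep : iIndepFun U P
  gaussian : ∀ i, HasGaussianLaw (Z i) P
  indep_gaussian : iIndepFun Z P
  indep_data : IndepFun (fun ω i => U i ω) (fun ω i => Z i ω) P
  mean : ∀ i p, ∫ ω, Z i ω p ∂P = ∫ ω, U i ω p ∂P
  covariance : ∀ i, covMat P (Z i) = covMat P (U i)
  nonneg : 0 ≤ C
  decay : CoordinateDecay P U C

namespace GaussianMatch

variable {U Z : Fin n → Ω → Block k d b} {C : ℝ}

theorem ae_abs_le (h : GaussianMatch P U Z C) (i : Fin n) (p : Fin k × (Fin d ⊕ Fin b)) :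
    ∀ᵐ ω ∂P, |U i ω p| ≤ C * coordScale p.2 := by
  obtain ⟨j, a⟩ := p
  filter_upwards [h.decay i j] with ω hω
  rcases a with l | l
  · exact hω.1 l
  · exact hω.2 l

variable [IsProbabilityMeasure P]

omit [IsProbabilityMeasure P] in
theorem aemeasurable_coord (h : GaussianMatch P U Z C) (i : Fin n)
    (p : Fin k × (Fin d ⊕ Fin b)) : AEMeasurable (fun ω => U i ω p) P := by
  have := h.aemeasurable i
  fun_prop

theorem memLp_coord (h : GaussianMatch P U Z C) (i : Fin n) (p : Fin k × (Fin d ⊕ Fin b))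
    (r : ℝ≥0∞) : MemLp (fun ω => U i ω p) r P :=
  MemLp.of_bound (h.aemeasurable_coord i p).aestronglyMeasurable _ (h.ae_abs_le i p)

omit [IsProbabilityMeasure P] in
theorem gaussian_coord (h : GaussianMatch P U Z C) (i : Fin n) (p : Fin k × (Fin d ⊕ Fin b)) :
    HasGaussianLaw (fun ω => Z i ω p) P :=
  (h.gaussian i).map_fun (EuclideanSpace.proj p)

omit [IsProbabilityMeasure P] in
theorem variance_eq (h : GaussianMatch P U Z C) (i : Fin n) (p : Fin k × (Fin d ⊕ Fin b)) :
    Var[fun ω => Z i ω p; P] = Var[fun ω => U i ω p; P] := by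
  have := congrFun (congrFun (h.covariance i) p) p
  rwa [covMat, covMat, covariance_self (h.gaussian_coord i p).aemeasurable,
    covariance_self (h.aemeasurable_coord i p)] at this

theorem integral_sq_eq (h : GaussianMatch P U Z C) (i : Fin n) (p : Fin k × (Fin d ⊕ Fin b)) :
    ∫ ω, Z i ω p ^ 2 ∂P = ∫ ω, U i ω p ^ 2 ∂P := by
  have h1 := variance_eq_sub (h.gaussian_coord i p).memLp_two
  have h2 := variance_eq_sub (h.memLp_coord i p 2)
  rw [h.variance_eq, h2, h.mean] at h1
  simp only [Pi.pow_apply] at h1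
  linarith

/-- Bounded data do not require the factor 1 + `gaussConst`; it lets data and surrogate share one
constant. -/
theorem blockMoments_data (h : GaussianMatch P U Z C) (hk : 0 < k) :
    BlockMoments P ((1 + 2 * (C * (1 + gaussConst)) ^ 2) ^ 4) U := by
  have hg := gaussConst_nonneg
  refine blockMoments_of_coordinates hk (mul_nonneg h.nonneg (by linarith)) h.aemeasurable
    fun j p => (eLpNorm_le_of_ae_bound (h.ae_abs_le j p)).trans ?_
  simp only [measure_univ, ENNReal.one_rpow, one_mul]
  refine ENNReal.ofReal_le_ofReal (mul_le_mul_of_nonneg_right ?_ (coordScale_nonneg _))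
  nlinarith [h.nonneg]

/-- Each Gaussian coordinate inherits mean and variance from a variable with values in [-σ, σ], so
they are at most σ and σ². -/
theorem blockMoments_gaussian (h : GaussianMatch P U Z C) (hk : 0 < k) :
    BlockMoments P ((1 + 2 * (C * (1 + gaussConst)) ^ 2) ^ 4) Z := by
  have hg := gaussConst_nonneg
  refine blockMoments_of_coordinates hk (mul_nonneg h.nonneg (by linarith))
    (fun i => (h.gaussian i).aemeasurable) fun j p => ?_
  have hσ : 0 ≤ C * coordScale p.2 := mul_nonneg h.nonneg (coordScale_nonneg _)
  refine ((h.gaussian_coord j p).eLpNorm_le hσ ?_ ?_).trans (le_of_eq (by congr 1; ring))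
  · rw [h.mean]
    have := norm_integral_le_of_norm_le_const (f := fun ω => U j ω p) (h.ae_abs_le j p)
    simpa using this
  · rw [h.variance_eq]
    have := variance_le_sq_of_bounded (a := -(C * coordScale p.2)) (b := C * coordScale p.2)
      (by filter_upwards [h.ae_abs_le j p] with ω hω using abs_le.1 hω) (h.aemeasurable_coord j p)
    refine this.trans (le_of_eq ?_)
    ring

/-- Gaussian hypercontractivity for the sixth moment of a block. -/
theorem lintegral_pow_six_le (h : GaussianMatch P U Z C) (i : Fin n) :
    ∫⁻ ω, ‖Z i ω‖ₑ ^ 6 ∂P ≤ 16 * ∫⁻ ω, ‖U i ω‖ₑ ^ 6 ∂P := by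
  have cube : ∀ {f : Ω → ℝ}, eLpNorm f 3 P ^ 3 = ∫⁻ ω, ‖f ω‖ₑ ^ 3 ∂P := by
    intro f
    have := eLpNorm_nnreal_pow_eq_lintegral (μ := P) (f := f) (p := 3) (by norm_num)
    simpa using this
  have six : ∀ (V : Ω → Block k d b), eLpNorm (fun ω => ‖V ω‖ ^ 2) 3 P ^ 3 =
      ∫⁻ ω, ‖V ω‖ₑ ^ 6 ∂P := by
    intro V
    rw [cube]
    refine lintegral_congr fun ω => ?_
    rw [enorm_pow, enorm_norm, ← pow_mul]
  have hUm := h.aemeasurable i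
  have hcoord : ∀ p, eLpNorm (fun ω => Z i ω p ^ 2) 3 P ≤
      ENNReal.ofReal (5 / 2 * ∫ ω, Z i ω p ^ 2 ∂P) := by
    intro p
    have hg := h.gaussian_coord i p
    have hint : Integrable (fun ω => Z i ω p ^ 6) P := by
      have := (hg.memLp (p := 6) (by norm_num)).integrable_norm_pow (by norm_num)
      refine this.congr (Eventually.of_forall fun ω => ?_)
      simp only [Real.norm_eq_abs]
      exact Even.pow_abs (by decide) _
    have h0 : 0 ≤ ∫ ω, Z i ω p ^ 2 ∂P := integral_nonneg fun _ => sq_nonneg _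
    rw [← ENNReal.pow_le_pow_left_iff (n := 3) (by norm_num), cube, ← ENNReal.ofReal_pow (by positivity)]
    refine le_trans (le_of_eq ?_) (ENNReal.ofReal_le_ofReal hg.integral_pow_six_le)
    rw [ofReal_integral_eq_lintegral_ofReal hint (Eventually.of_forall fun ω => by positivity)]
    refine lintegral_congr fun ω => ?_
    rw [← enorm_pow, Real.enorm_of_nonneg (by positivity)]
    congr 1; ring
  -- Minkowski's inequality in L³ over the coordinates reduces to one-dimensional Gaussians; what
  -- remains are second moments, which agree with those of the data.
  have hZ : eLpNorm (fun ω => ‖Z i ω‖ ^ 2) 3 P ≤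
      ENNReal.ofReal (5 / 2 * ∫ ω, ‖U i ω‖ ^ 2 ∂P) := by
    have e1 : (fun ω => ‖Z i ω‖ ^ 2) = ∑ p, fun ω => Z i ω p ^ 2 := by
      funext ω; simp [EuclideanSpace.norm_sq_eq]
    have hZm := fun p => (h.gaussian_coord i p).aemeasurable
    rw [e1]
    refine (eLpNorm_sum_le (fun p _ => (hZm p).aestronglyMeasurable.pow 2) (by norm_num)).trans
      ((Finset.sum_le_sum fun p _ => hcoord p).trans (le_of_eq ?_))
    rw [← ENNReal.ofReal_sum_of_nonneg
      (fun p _ => mul_nonneg (by norm_num) (integral_nonneg fun _ => sq_nonneg _)),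
      ← Finset.mul_sum]
    congr 2
    simp only [EuclideanSpace.norm_sq_eq, Real.norm_eq_abs, sq_abs]
    rw [integral_finsetSum _ fun p _ => (h.memLp_coord i p 2).integrable_sq]
    exact Finset.sum_congr rfl fun p _ => h.integral_sq_eq i p
  have hU : ENNReal.ofReal (5 / 2 * ∫ ω, ‖U i ω‖ ^ 2 ∂P) ≤
      ENNReal.ofReal (5 / 2) * eLpNorm (fun ω => ‖U i ω‖ ^ 2) 3 P := by
    rw [ENNReal.ofReal_mul (by norm_num)]
    gcongr
    have hint : Integrable (fun ω => ‖U i ω‖ ^ 2) P := by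
      simp only [EuclideanSpace.norm_sq_eq, Real.norm_eq_abs, sq_abs]
      exact integrable_finsetSum _ fun p _ => (h.memLp_coord i p 2).integrable_sq
    rw [ofReal_integral_eq_lintegral_ofReal hint (Eventually.of_forall fun ω => by positivity)]
    refine le_trans (le_of_eq ?_) (eLpNorm_le_eLpNorm_of_exponent_le
      (p := 1) (q := 3) (by norm_num) hint.aestronglyMeasurable)
    rw [eLpNorm_one_eq_lintegral_enorm]
    exact lintegral_congr fun ω => by rw [Real.enorm_of_nonneg (by positivity)]
  calc _ = eLpNorm (fun ω => ‖Z i ω‖ ^ 2) 3 P ^ 3 := (six _).symm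
    _ ≤ (ENNReal.ofReal (5 / 2) * eLpNorm (fun ω => ‖U i ω‖ ^ 2) 3 P) ^ 3 := by
        gcongr; exact hZ.trans hU
    -- (5/2)³ = 15.625 is rounded up to 16 so that the square root taken later is exactly 4.
    _ ≤ _ := by
        rw [mul_pow, six, ← ENNReal.ofReal_pow (by norm_num)]
        gcongr
        rw [show (16 : ℝ≥0∞) = ENNReal.ofReal 16 by simp]
        exact ENNReal.ofReal_le_ofReal (by norm_num)

end GaussianMatch

end BlockMoments

/-! ### Derivatives in one block as derivatives of the whole function. -/

section BlockDerivatives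

variable {n : ℕ} {E F : Type*} [NormedAddCommGroup E] [NormedSpace ℝ E]
  [NormedAddCommGroup F] [NormedSpace ℝ F]

theorem interp_eq_add_single (u z : Fin n → E) (i : Fin n) (w : E) :
    interp u z i w = interp u z i 0 + ContinuousLinearMap.single ℝ (fun _ : Fin n => E) i w := by
  funext j
  by_cases h : j = i
  · subst h; simp [interp]
  · simp [interp, h]

/-- The interpolation is affine in w, with linear part the inclusion of slot i. The right-hand side
makes the joint continuity in all the blocks visible. -/
theorem iteratedFDeriv_interp {f : (Fin n → E) → F} {r : ℕ} (hf : ContDiff ℝ r f)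
    (u z : Fin n → E) (i : Fin n) (w : E) (m : Fin r → E) :
    iteratedFDeriv ℝ r (fun w' => f (interp u z i w')) w m =
      iteratedFDeriv ℝ r f (interp u z i w)
        (fun s => ContinuousLinearMap.single ℝ (fun _ : Fin n => E) i (m s)) := by
  have h1 : (fun w' => f (interp u z i w')) = (fun y => f (interp u z i 0 + y)) ∘
      ContinuousLinearMap.single ℝ (fun _ : Fin n => E) i := by
    funext w'
    simp only [Function.comp_apply]
    rw [interp_eq_add_single]
  have hf' : ContDiff ℝ r (fun y => f (interp u z i 0 + y)) :=
    hf.comp (contDiff_const.add contDiff_id)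
  rw [h1, ContinuousLinearMap.iteratedFDeriv_comp_right _ hf' _ le_rfl,
    iteratedFDeriv_comp_add_left, ContinuousMultilinearMap.compContinuousLinearMap_apply,
    ← interp_eq_add_single]

omit [NormedSpace ℝ E] in
theorem continuous_interp (i : Fin n) :
    Continuous (fun p : (Fin n → E) × (Fin n → E) × E => interp p.1 p.2.1 i p.2.2) := by
  refine continuous_pi fun j => ?_
  simp only [interp]
  split_ifs <;> fun_prop

end BlockDerivatives

/-! ### Measurability of the suprema over segments. -/

section SupDeriv

variable {n k d b : ℕ} {F : Type*} [NormedAddCommGroup F] [NormedSpace ℝ F]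

theorem continuous_derivNorm_interp {f : (Fin n → Block k d b) → F} {r : ℕ} (hf : ContDiff ℝ r f)
    (i : Fin n) :
    Continuous (fun p : (Fin n → Block k d b) × (Fin n → Block k d b) × Block k d b =>
      derivNorm r (fun w' => f (interp p.1 p.2.1 i w')) p.2.2) := by
  refine Continuous.sqrt (continuous_finsetSum _ fun a _ => Continuous.pow (Continuous.norm ?_) 2)
  simp only [iteratedFDeriv_interp hf]
  have h1 : Continuous (iteratedFDeriv ℝ r f) := hf.continuous_iteratedFDeriv le_rfl
  have h2 := h1.comp (continuous_interp (E := Block k d b) i)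
  exact (ContinuousMultilinearMap.apply ℝ (fun _ : Fin r => Fin n → Block k d b) F _).continuous.comp
    h2

theorem supDeriv_eq_iSup (f : (Fin n → Block k d b) → F) (r : ℕ) (u z : Fin n → Block k d b)
    (i : Fin n) (e : Block k d b) :
    supDeriv f r u z i e = ⨆ t ∈ Set.Icc (0 : ℝ) 1,
      ENNReal.ofReal (derivNorm r (fun w' => f (interp u z i w')) (t • e)) := by
  rw [supDeriv, segment_eq_image, iSup_image]
  simp

/-- The supremum is uncountable, but once the segment is parametrised by t ∈ [0, 1] it is a supremum
of continuous functions, hence lower semicontinuous. -/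
theorem measurable_supDeriv {f : (Fin n → Block k d b) → F} {r : ℕ} (hf : ContDiff ℝ r f)
    (i : Fin n) :
    Measurable (fun p : (Fin n → Block k d b) × (Fin n → Block k d b) × Block k d b =>
      supDeriv f r p.1 p.2.1 i p.2.2) := by
  simp only [supDeriv_eq_iSup]
  refine LowerSemicontinuous.measurable (lowerSemicontinuous_biSup fun t _ => ?_)
  refine Continuous.lowerSemicontinuous (ENNReal.continuous_ofReal.comp ?_)
  exact (continuous_derivNorm_interp hf i).comp
    (f := fun p : (Fin n → Block k d b) × (Fin n → Block k d b) × Block k d b =>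
      (p.1, p.2.1, t • p.2.2)) (by fun_prop)

theorem ofReal_derivNorm_le_supDeriv (f : (Fin n → Block k d b) → F) (r : ℕ)
    (u z : Fin n → Block k d b) (i : Fin n) (e : Block k d b) {t : ℝ} (ht : t ∈ Set.Icc (0 : ℝ) 1) :
    ENNReal.ofReal (derivNorm r (fun w' => f (interp u z i w')) (t • e)) ≤
      supDeriv f r u z i e := by
  rw [supDeriv_eq_iSup]
  exact le_iSup₂ (f := fun t (_ : t ∈ Set.Icc (0 : ℝ) 1) =>
    ENNReal.ofReal (derivNorm r (fun w' => f (interp u z i w')) (t • e))) t ht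

end SupDeriv

/-! ### Taylor expansion of h ∘ f with a third order remainder. -/

section Taylor

/-- The third derivative need not be continuous, so the integral form of the remainder is avoided:
the mean value inequality is applied three times, with bounds Mt, Mt²/2 and Mt³/6. -/
theorem abs_sub_taylor_two_le {g g₁ g₂ g₃ : ℝ → ℝ} (h0 : ∀ t, HasDerivAt g (g₁ t) t)
    (h1 : ∀ t, HasDerivAt g₁ (g₂ t) t) (h2 : ∀ t, HasDerivAt g₂ (g₃ t) t) {M : ℝ}
    (hM : ∀ t ∈ Set.Icc (0 : ℝ) 1, |g₃ t| ≤ M) :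
    |g 1 - (g 0 + g₁ 0 + g₂ 0 / 2)| ≤ M / 6 := by
  have key : ∀ {f f' B B' : ℝ → ℝ}, (∀ t, HasDerivAt f (f' t) t) → f 0 = 0 →
      (∀ t, HasDerivAt B (B' t) t) → B 0 = 0 → (∀ t ∈ Set.Icc (0 : ℝ) 1, |f' t| ≤ B' t) →
      ∀ t ∈ Set.Icc (0 : ℝ) 1, |f t| ≤ B t := by
    intro f f' B B' hf hf0 hB hB0 hb t ht
    refine image_norm_le_of_norm_deriv_right_le_deriv_boundary (f := f) (f' := f')
      (fun x _ => (hf x).continuousAt.continuousWithinAt) (fun x _ => (hf x).hasDerivWithinAt)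
      (by simp [hf0, hB0]) hB (fun x hx => hb x ⟨hx.1, hx.2.le⟩) ht
  have id' : ∀ t : ℝ, HasDerivAt (fun t : ℝ => t) 1 t := fun t => hasDerivAt_id' t
  have s2 := key (f := fun t => g₂ t - g₂ 0) (B := fun t => M * t) (B' := fun _ => M)
    (fun t => (h2 t).sub_const _) (by simp)
    (fun t => by simpa using (id' t).const_mul M) (by simp) hM
  have s1 := key (f := fun t => g₁ t - g₁ 0 - g₂ 0 * t) (f' := fun t => g₂ t - g₂ 0)
    (B := fun t => M / 2 * t ^ 2) (B' := fun t => M * t)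
    (fun t => by simpa using ((h1 t).sub_const _).fun_sub ((id' t).const_mul (g₂ 0))) (by simp)
    (fun t => by
      refine ((hasDerivAt_pow 2 t).const_mul (M / 2)).congr_deriv ?_
      push_cast; ring) (by simp) s2
  have s0 := key (f := fun t => g t - g 0 - g₁ 0 * t - g₂ 0 / 2 * t ^ 2)
    (f' := fun t => g₁ t - g₁ 0 - g₂ 0 * t)
    (B := fun t => M / 6 * t ^ 3) (B' := fun t => M / 2 * t ^ 2)
    (fun t => by
      refine ((((h0 t).sub_const _).fun_sub ((id' t).const_mul (g₁ 0))).fun_sub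
        ((hasDerivAt_pow 2 t).const_mul (g₂ 0 / 2))).congr_deriv ?_
      push_cast; ring) (by simp)
    (fun t => by
      refine ((hasDerivAt_pow 3 t).const_mul (M / 6)).congr_deriv ?_
      push_cast; ring) (by simp) s1
  have := s0 1 ⟨by norm_num, le_rfl⟩
  calc _ = |g 1 - g 0 - g₁ 0 * 1 - g₂ 0 / 2 * 1 ^ 2| := by congr 1; ring
    _ ≤ _ := this.trans (le_of_eq (by ring))

theorem ThriceDifferentiable.hasDerivAt {h : ℝ → ℝ} (hh : ThriceDifferentiable h) {r : ℕ}
    (hr : r < 3) (y : ℝ) : HasDerivAt (iteratedDeriv r h) (iteratedDeriv (r + 1) h y) y := by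
  rw [iteratedDeriv_succ]
  exact (hh r hr y).hasDerivAt

theorem ThriceDifferentiable.continuous {h : ℝ → ℝ} (hh : ThriceDifferentiable h) {r : ℕ}
    (hr : r < 3) : Continuous (iteratedDeriv r h) := (hh r hr).continuous

theorem norm_iteratedDeriv_three_le {h : ℝ → ℝ} (hγ : gammaThree h ≠ ∞) (y : ℝ) :
    |iteratedDeriv 3 h y| ≤ (gammaThree h).toReal := by
  have h1 : ‖iteratedDeriv 3 h y‖ₑ ≤ gammaThree h := le_iSup (fun x => ‖iteratedDeriv 3 h x‖ₑ) y
  rw [← Real.norm_eq_abs, ← toReal_enorm]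
  exact ENNReal.toReal_mono hγ h1

theorem abs_sub_zero_le_of_deriv {g g' : ℝ → ℝ} (hg : ∀ y, HasDerivAt g (g' y) y) {y C : ℝ}
    (hC : ∀ s, |s| ≤ |y| → |g' s| ≤ C) : |g y| ≤ |g 0| + C * |y| := by
  have h1 := (convex_closedBall (0 : ℝ) |y|).norm_image_sub_le_of_norm_hasDerivWithin_le
    (f := g) (f' := g') (C := C) (x := 0) (y := y)
    (fun s _ => (hg s).hasDerivWithinAt) (fun s hs => by
      rw [mem_closedBall_zero_iff] at hs
      exact hC s hs) (by simp) (by simp)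
  simp only [sub_zero, Real.norm_eq_abs] at h1
  have := abs_sub_abs_le_abs_sub (g y) (g 0)
  linarith

theorem abs_iteratedDeriv_two_le {h : ℝ → ℝ} (hh : ThriceDifferentiable h)
    (hγ : gammaThree h ≠ ∞) (y : ℝ) :
    |iteratedDeriv 2 h y| ≤ |iteratedDeriv 2 h 0| + (gammaThree h).toReal * |y| :=
  abs_sub_zero_le_of_deriv (fun y => hh.hasDerivAt (by norm_num) y)
    fun s _ => norm_iteratedDeriv_three_le hγ s

/-- The mean value inequality on |s| ≤ |y| loses the factor 1/2 of the exact expansion, and the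
resulting coefficients are those of `lambdaTwo`. -/
theorem abs_iteratedDeriv_one_le {h : ℝ → ℝ} (hh : ThriceDifferentiable h)
    (hγ : gammaThree h ≠ ∞) (y : ℝ) :
    |iteratedDeriv 1 h y| ≤ |iteratedDeriv 1 h 0| + |iteratedDeriv 2 h 0| * |y| +
      (gammaThree h).toReal * |y| ^ 2 := by
  have := abs_sub_zero_le_of_deriv (fun y => hh.hasDerivAt (r := 1) (by norm_num) y) (y := y)
    fun s hs => (abs_iteratedDeriv_two_le hh hγ s).trans
      (add_le_add_right (mul_le_mul_of_nonneg_left hs ENNReal.toReal_nonneg) _)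
  refine this.trans (le_of_eq (by ring))

theorem abs_le_of_thriceDifferentiable {h : ℝ → ℝ} (hh : ThriceDifferentiable h)
    (hγ : gammaThree h ≠ ∞) (y : ℝ) :
    |h y| ≤ |h 0| + (|iteratedDeriv 1 h 0| + |iteratedDeriv 2 h 0| * |y| +
      (gammaThree h).toReal * |y| ^ 2) * |y| := by
  have hd : ∀ y, HasDerivAt h (iteratedDeriv 1 h y) y := fun y => by
    simpa using hh.hasDerivAt (r := 0) (by norm_num) y
  refine abs_sub_zero_le_of_deriv hd fun s hs => (abs_iteratedDeriv_one_le hh hγ s).trans ?_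
  have : 0 ≤ (gammaThree h).toReal := ENNReal.toReal_nonneg
  gcongr

variable {ι : Type*} [Fintype ι] [DecidableEq ι]

omit [DecidableEq ι] in
theorem hasDerivAt_iteratedFDeriv_line {φ : EuclideanSpace ℝ ι → ℝ} {r : ℕ}
    (hφ : ContDiff ℝ (r + 1 : ℕ) φ) (x : EuclideanSpace ℝ ι) (t : ℝ) :
    HasDerivAt (fun t : ℝ => iteratedFDeriv ℝ r φ (t • x) (fun _ => x))
      (iteratedFDeriv ℝ (r + 1) φ (t • x) (fun _ => x)) t := by
  have h1 : HasFDerivAt (iteratedFDeriv ℝ r φ) (fderiv ℝ (iteratedFDeriv ℝ r φ) (t • x)) (t • x) :=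
    ((hφ.differentiable_iteratedFDeriv (by norm_cast; omega)) _).hasFDerivAt
  have h2 : HasDerivAt (fun t : ℝ => t • x) x t := by
    simpa using (hasDerivAt_id t).smul_const x
  have h3 := h1.comp_hasDerivAt t h2
  have h4 := ((ContinuousMultilinearMap.apply ℝ (fun _ : Fin r => EuclideanSpace ℝ ι) ℝ
    (fun _ => x)).hasFDerivAt (x := iteratedFDeriv ℝ r φ (t • x))).comp_hasDerivAt t h3
  rw [iteratedFDeriv_succ_apply_left]
  exact h4

/-- Second order Taylor expansion at `0` of `h ∘ φ`. -/
theorem abs_comp_sub_taylor_le {h : ℝ → ℝ} (hh : ThriceDifferentiable h) (hγ : gammaThree h ≠ ∞)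
    {φ : EuclideanSpace ℝ ι → ℝ} (hφ : ContDiff ℝ 3 φ) (x : EuclideanSpace ℝ ι) {M : ℝ}
    (hM : ∀ t ∈ Set.Icc (0 : ℝ) 1,
      ((gammaThree h).toReal * (derivNorm 1 φ (t • x) ^ 3 +
        3 * (derivNorm 0 φ (t • x) * derivNorm 1 φ (t • x) * derivNorm 2 φ (t • x)) +
        derivNorm 0 φ (t • x) ^ 2 * derivNorm 3 φ (t • x)) +
      |iteratedDeriv 2 h 0| * (3 * (derivNorm 1 φ (t • x) * derivNorm 2 φ (t • x)) +
        derivNorm 0 φ (t • x) * derivNorm 3 φ (t • x)) +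
      |iteratedDeriv 1 h 0| * derivNorm 3 φ (t • x)) * ‖x‖ ^ 3 ≤ M) :
    |h (φ x) - (h (φ 0) + iteratedDeriv 1 h (φ 0) * iteratedFDeriv ℝ 1 φ 0 (fun _ => x) +
      (iteratedDeriv 2 h (φ 0) * iteratedFDeriv ℝ 1 φ 0 (fun _ => x) ^ 2 +
        iteratedDeriv 1 h (φ 0) * iteratedFDeriv ℝ 2 φ 0 (fun _ => x)) / 2)| ≤ M / 6 := by
  set F : ℕ → ℝ → ℝ := fun r t => iteratedFDeriv ℝ r φ (t • x) (fun _ => x) with hF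
  have hF0 : ∀ t, F 0 t = φ (t • x) := fun t => by simp [hF]
  have dF : ∀ r < 3, ∀ t, HasDerivAt (F r) (F (r + 1) t) t := fun r hr t =>
    hasDerivAt_iteratedFDeriv_line (hφ.of_le (by norm_cast)) x t
  have dh : ∀ r < 3, ∀ t, HasDerivAt (fun t => iteratedDeriv r h (F 0 t))
      (iteratedDeriv (r + 1) h (F 0 t) * F 1 t) t := fun r hr t =>
    (hh.hasDerivAt hr (F 0 t)).comp t (dF 0 (by norm_num) t)
  have main := abs_sub_taylor_two_le (g := fun t => iteratedDeriv 0 h (F 0 t))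
    (g₁ := fun t => iteratedDeriv 1 h (F 0 t) * F 1 t)
    (g₂ := fun t => iteratedDeriv 2 h (F 0 t) * F 1 t ^ 2 + iteratedDeriv 1 h (F 0 t) * F 2 t)
    (g₃ := fun t => iteratedDeriv 3 h (F 0 t) * F 1 t ^ 3 +
      3 * (iteratedDeriv 2 h (F 0 t) * F 1 t * F 2 t) + iteratedDeriv 1 h (F 0 t) * F 3 t)
    (M := M) (dh 0 (by norm_num))
    (fun t => by
      refine ((dh 1 (by norm_num) t).fun_mul (dF 1 (by norm_num) t)).congr_deriv ?_
      ring)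
    (fun t => by
      refine (((dh 2 (by norm_num) t).fun_mul ((dF 1 (by norm_num) t).fun_pow 2)).fun_add
        ((dh 1 (by norm_num) t).fun_mul (dF 2 (by norm_num) t))).congr_deriv ?_
      push_cast; ring)
    (fun t ht => by
      refine le_trans ?_ (hM t ht)
      have b : ∀ r, |F r t| ≤ derivNorm r φ (t • x) * ‖x‖ ^ r := fun r =>
        norm_iteratedFDeriv_diag_le r φ (t • x) x
      have b0 : |F 0 t| ≤ derivNorm 0 φ (t • x) := by simpa using b 0
      have b1 : |F 1 t| ≤ derivNorm 1 φ (t • x) * ‖x‖ := by simpa using b 1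
      have b2 := b 2
      have b3 := b 3
      have n0 := derivNorm_nonneg 0 φ (t • x)
      have n1 := derivNorm_nonneg 1 φ (t • x)
      have n2 := derivNorm_nonneg 2 φ (t • x)
      have n3 := derivNorm_nonneg 3 φ (t • x)
      generalize derivNorm 0 φ (t • x) = S₀ at *
      generalize derivNorm 1 φ (t • x) = S₁ at *
      generalize derivNorm 2 φ (t • x) = S₂ at *
      generalize derivNorm 3 φ (t • x) = S₃ at *
      have c3 := norm_iteratedDeriv_three_le hγ (F 0 t)
      have c2 := abs_iteratedDeriv_two_le hh hγ (F 0 t)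
      have c1 := abs_iteratedDeriv_one_le hh hγ (F 0 t)
      have γ0 : 0 ≤ (gammaThree h).toReal := ENNReal.toReal_nonneg
      have hx := norm_nonneg x
      -- Only the values at 0 of h' and h'' are controlled; moving to the point f costs powers of
      -- S₀. Inserted in h'''(f')³ + 3h''f'f'' + h'f''', this yields exactly the polynomial defining
      -- λ₂.
      have c2' : |iteratedDeriv 2 h (F 0 t)| ≤
          |iteratedDeriv 2 h 0| + (gammaThree h).toReal * S₀ := c2.trans (by gcongr)
      have c1' : |iteratedDeriv 1 h (F 0 t)| ≤ |iteratedDeriv 1 h 0| +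
          |iteratedDeriv 2 h 0| * S₀ + (gammaThree h).toReal * S₀ ^ 2 := c1.trans (by gcongr)
      calc _ ≤ |iteratedDeriv 3 h (F 0 t)| * |F 1 t| ^ 3 +
            3 * (|iteratedDeriv 2 h (F 0 t)| * |F 1 t| * |F 2 t|) +
            |iteratedDeriv 1 h (F 0 t)| * |F 3 t| := by
            refine (abs_add_le _ _).trans (add_le_add ((abs_add_le _ _).trans
              (add_le_add ?_ ?_)) ?_)
            · rw [abs_mul, abs_pow]
            · rw [abs_mul, abs_mul, abs_mul, abs_of_pos (by norm_num : (0 : ℝ) < 3)]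
            · rw [abs_mul]
        _ ≤ (gammaThree h).toReal * (S₁ * ‖x‖) ^ 3 +
            3 * ((|iteratedDeriv 2 h 0| + (gammaThree h).toReal * S₀) * (S₁ * ‖x‖) *
              (S₂ * ‖x‖ ^ 2)) +
            (|iteratedDeriv 1 h 0| + |iteratedDeriv 2 h 0| * S₀ +
              (gammaThree h).toReal * S₀ ^ 2) * (S₃ * ‖x‖ ^ 3) := by gcongr
        _ = _ := by ring)
  simpa [hF0, hF] using main

end Taylor

/-! ### Independence of a block from the interpolation with that block removed. -/

section Independence

variable {Ω : Type*} [MeasurableSpace Ω] {P : Measure Ω} [IsProbabilityMeasure P]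

/-- If `A` and `B` are independent and `(A, B)` is independent of `C`, then `(A, C)` is independent
of `B`. -/
theorem ProbabilityTheory.IndepFun.prodMk_right_comm {α β γ : Type*} [MeasurableSpace α]
    [MeasurableSpace β] [MeasurableSpace γ] {A : Ω → α} {B : Ω → β} {D : Ω → γ}
    (hA : AEMeasurable A P) (hB : AEMeasurable B P) (hD : AEMeasurable D P)
    (hAB : IndepFun A B P) (hABD : IndepFun (fun ω => (A ω, B ω)) D P) :
    IndepFun (fun ω => (A ω, D ω)) B P := by
  have := Measure.isProbabilityMeasure_map hA
  have := Measure.isProbabilityMeasure_map hB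
  have := Measure.isProbabilityMeasure_map hD
  have h1 := (indepFun_iff_map_prod_eq_prod_map_map hA hB).1 hAB
  have h2 := (indepFun_iff_map_prod_eq_prod_map_map (hA.prodMk hB) hD).1 hABD
  rw [h1] at h2
  have h3 : IndepFun A D P := hABD.comp measurable_fst measurable_id
  have h4 := (indepFun_iff_map_prod_eq_prod_map_map hA hD).1 h3
  refine (indepFun_iff_map_prod_eq_prod_map_map (hA.prodMk hD) hB).2 ?_
  rw [h4]
  -- The rearrangement (A, B), D → A, (B, D) → A, (D, B) → (A, D), B preserves product measures.
  have e1 := measurePreserving_prodAssoc (P.map A) (P.map B) (P.map D)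
  have e2 := (MeasurePreserving.id (P.map A)).prod
    (Measure.measurePreserving_swap (μ := P.map B) (ν := P.map D))
  have e3 := (measurePreserving_prodAssoc (P.map A) (P.map D) (P.map B)).symm
  have e := e3.comp (e2.comp e1)
  rw [← e.map_eq, ← h2, AEMeasurable.map_map_of_aemeasurable e.measurable.aemeasurable
    ((hA.prodMk hB).prodMk hD)]
  rfl

omit [IsProbabilityMeasure P] in
theorem ProbabilityTheory.iIndepFun.indepFun_erase {ι E : Type*} [Fintype ι] [DecidableEq ι]
    [MeasurableSpace E] {U : ι → Ω → E} (hU : iIndepFun U P) (hm : ∀ i, AEMeasurable (U i) P)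
    (i : ι) : IndepFun (fun ω (j : (Finset.univ.erase i : Finset ι)) => U j ω) (U i) P :=
  (hU.indepFun_finset₀ (Finset.univ.erase i) {i} (by simp) hm).comp measurable_id
    (measurable_pi_apply (⟨i, by simp⟩ : ({i} : Finset ι)))

variable {n : ℕ} {E : Type*} [MeasurableSpace E] [Zero E] {U Z : Fin n → Ω → E}

/-- With 0 in slot i, the interpolation is a function of the other data blocks and of Z. The block
U_i is independent of the former, and Z of all data jointly. -/
theorem indepFun_interp_left (hU : iIndepFun U P)
    (hm : ∀ i, AEMeasurable (U i) P) (hm' : ∀ i, AEMeasurable (Z i) P)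
    (hUZ : IndepFun (fun ω i => U i ω) (fun ω i => Z i ω) P) (i : Fin n) :
    IndepFun (fun ω => interp (fun j => U j ω) (fun j => Z j ω) i 0) (U i) P := by
  have h1 := hU.indepFun_erase hm i
  have h2 : IndepFun (fun ω => ((fun (j : (Finset.univ.erase i : Finset (Fin n))) => U j ω), U i ω))
      (fun ω j => Z j ω) P :=
    hUZ.comp (φ := fun u => ((fun (j : (Finset.univ.erase i : Finset (Fin n))) => u j), u i))
      (by fun_prop) measurable_id
  have h3 := h1.prodMk_right_comm (by fun_prop) (hm i) (by fun_prop) h2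
  refine (h3.comp (φ := fun p j => if h : j < i then p.1 ⟨j, by simp [h.ne]⟩ else
    if j = i then 0 else p.2 j) ?_ measurable_id).congr (ae_of_all _ fun ω => ?_)
    (ae_of_all _ fun _ => rfl)
  · refine measurable_pi_lambda _ fun j => ?_
    split_ifs <;> fun_prop
  · funext j
    simp only [Function.comp_apply, interp, dite_eq_ite]

theorem indepFun_interp_right (hZ : iIndepFun Z P)
    (hm : ∀ i, AEMeasurable (U i) P) (hm' : ∀ i, AEMeasurable (Z i) P)
    (hUZ : IndepFun (fun ω i => U i ω) (fun ω i => Z i ω) P) (i : Fin n) :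
    IndepFun (fun ω => interp (fun j => U j ω) (fun j => Z j ω) i 0) (Z i) P := by
  have h1 := hZ.indepFun_erase hm' i
  have h2 : IndepFun (fun ω => ((fun (j : (Finset.univ.erase i : Finset (Fin n))) => Z j ω), Z i ω))
      (fun ω j => U j ω) P :=
    hUZ.symm.comp (φ := fun u => ((fun (j : (Finset.univ.erase i : Finset (Fin n))) => u j), u i))
      (by fun_prop) measurable_id
  have h3 := h1.prodMk_right_comm (by fun_prop) (hm' i) (by fun_prop) h2
  refine (h3.comp (φ := fun p j => if j < i then p.2 j else
    if h : j = i then 0 else p.1 ⟨j, by simp [h]⟩) ?_ measurable_id).congr (ae_of_all _ fun ω => ?_)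
    (ae_of_all _ fun _ => rfl)
  · refine measurable_pi_lambda _ fun j => ?_
    split_ifs <;> fun_prop
  · funext j
    simp only [Function.comp_apply, interp, dite_eq_ite]

end Independence

/-! ### Hölder's inequality with a cubed factor. -/

section Holder

variable {Ω : Type*} [MeasurableSpace Ω] {P : Measure Ω}

theorem eLpNorm_ennreal_natCast (a : Ω → ℝ≥0∞) {m : ℕ} (hm : m ≠ 0) :
    eLpNorm a m P = (∫⁻ ω, a ω ^ m ∂P) ^ (1 / m : ℝ) := by
  rw [eLpNorm_eq_lintegral_rpow_enorm_toReal (by simpa using hm) (by simp)]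
  simp

/-- For c factors the exponents are 2c for each and 2 for x³, as c/(2c) + 1/2 = 1. The cases c = 1,
2, 3 explain the norms L₂, L₄, L₆ in λ₂. In the proof the index `none` carries x⁶. -/
theorem lintegral_mul_pow_three_le {ι : Type*} (s : Finset ι) {a : ι → Ω → ℝ≥0∞} {x : Ω → ℝ≥0∞}
    (ha : ∀ i ∈ s, AEMeasurable (a i) P) (hx : AEMeasurable x P) (hs : s.Nonempty) :
    ∫⁻ ω, (∏ i ∈ s, a i ω) * x ω ^ 3 ∂P ≤
      (∏ i ∈ s, eLpNorm (a i) ((2 * s.card : ℕ) : ℝ≥0∞) P) * (∫⁻ ω, x ω ^ 6 ∂P) ^ (1 / 2 : ℝ) := by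
  have hc : 0 < s.card := Finset.card_pos.2 hs
  have hc' : (0 : ℝ) < s.card := by exact_mod_cast hc
  have h := ENNReal.lintegral_prod_norm_pow_le (μ := P) (Finset.insertNone s)
    (f := fun o ω => o.elim (x ω ^ 6) (fun i => a i ω ^ (2 * s.card)))
    (fun o ho => by
      cases o with
      | none => exact hx.pow_const 6
      | some i => exact (ha i (by simpa using ho)).pow_const _)
    (p := fun o => o.elim (1 / 2 : ℝ) (fun _ => 1 / (2 * s.card : ℕ)))
    (by
      rw [Finset.sum_insertNone]
      simp only [Option.elim_none, Option.elim_some, Finset.sum_const, nsmul_eq_mul]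
      push_cast; field_simp; norm_num)
    (fun o _ => by cases o <;> simp)
  simp only [Finset.prod_insertNone, Option.elim_none, Option.elim_some] at h
  have e1 : ∀ y : ℝ≥0∞, (y ^ 6) ^ (1 / 2 : ℝ) = y ^ 3 := fun y => by
    rw [← ENNReal.rpow_natCast, ← ENNReal.rpow_mul, ← ENNReal.rpow_natCast]
    norm_num
  have e2 : ∀ y : ℝ≥0∞, (y ^ (2 * s.card)) ^ (1 / (2 * s.card : ℕ) : ℝ) = y := fun y => by
    rw [← ENNReal.rpow_natCast, ← ENNReal.rpow_mul, mul_one_div_cancel, ENNReal.rpow_one]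
    exact_mod_cast (by omega)
  simp only [e1, e2] at h
  refine (le_of_eq (lintegral_congr fun ω => mul_comm _ _)).trans (h.trans (le_of_eq ?_))
  rw [mul_comm]
  congr 1
  refine Finset.prod_congr rfl fun i _ => ?_
  rw [eLpNorm_ennreal_natCast _ (by omega)]

end Holder

/-! ### The expected remainder is at most λ₂ times the root of a sixth moment. -/

section Remainder

variable {n k d b : ℕ}

/-- A continuous function is bounded on the compact segment; this allows passing between extended
and real values pointwise. -/
theorem supDeriv_ne_top {F : Type*} [NormedAddCommGroup F] [NormedSpace ℝ F]
    {f : (Fin n → Block k d b) → F} {r : ℕ} (hf : ContDiff ℝ r f)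
    (u z : Fin n → Block k d b) (i : Fin n) (e : Block k d b) : supDeriv f r u z i e ≠ ∞ := by
  have hc : Continuous fun t : ℝ => derivNorm r (fun w' => f (interp u z i w')) (t • e) :=
    (continuous_derivNorm_interp hf i).comp
      (f := fun t : ℝ => (u, z, t • e)) (by fun_prop)
  obtain ⟨M, hM⟩ := (isCompact_Icc (a := (0 : ℝ)) (b := 1)).bddAbove_image hc.continuousOn
  rw [supDeriv_eq_iSup]
  refine ne_top_of_le_ne_top (ENNReal.ofReal_ne_top (r := M)) (iSup₂_le fun t ht => ?_)
  exact ENNReal.ofReal_le_ofReal (hM (Set.mem_image_of_mem _ ht))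

theorem derivNorm_le_toReal_supDeriv {F : Type*} [NormedAddCommGroup F] [NormedSpace ℝ F]
    {f : (Fin n → Block k d b) → F} {r : ℕ} (hf : ContDiff ℝ r f)
    (u z : Fin n → Block k d b) (i : Fin n) (e : Block k d b) {t : ℝ} (ht : t ∈ Set.Icc (0 : ℝ) 1) :
    derivNorm r (fun w' => f (interp u z i w')) (t • e) ≤ (supDeriv f r u z i e).toReal :=
  (ENNReal.ofReal_le_iff_le_toReal (supDeriv_ne_top hf u z i e)).1
    (ofReal_derivNorm_le_supDeriv f r u z i e ht)

/-- Third order bound for `h ∘ f` in terms of bounds `s r` for the `r`-th derivative of `f`. -/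
noncomputable def thirdOrder (h : ℝ → ℝ) (s : ℕ → ℝ≥0∞) : ℝ≥0∞ :=
  gammaThree h * (s 1 ^ 3 + 3 * (s 0 * s 1 * s 2) + s 0 ^ 2 * s 3) +
    eta 2 h * (3 * (s 1 * s 2) + s 0 * s 3) + eta 1 h * s 3

theorem toReal_thirdOrder {h : ℝ → ℝ} (hγ : gammaThree h ≠ ∞) {s : ℕ → ℝ≥0∞} (hs : ∀ r, s r ≠ ∞) :
    (thirdOrder h s).toReal =
      (gammaThree h).toReal * ((s 1).toReal ^ 3 + 3 * ((s 0).toReal * (s 1).toReal * (s 2).toReal) +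
        (s 0).toReal ^ 2 * (s 3).toReal) +
      |iteratedDeriv 2 h 0| * (3 * ((s 1).toReal * (s 2).toReal) + (s 0).toReal * (s 3).toReal) +
      |iteratedDeriv 1 h 0| * (s 3).toReal := by
  have e : ∀ r, eta r h = ((‖iteratedDeriv r h 0‖₊ : NNReal) : ℝ≥0∞) := fun r => rfl
  simp only [thirdOrder, e, ← Real.norm_eq_abs, ← coe_nnnorm]
  lift gammaThree h to NNReal using hγ with g
  obtain ⟨t, rfl⟩ : ∃ t : ℕ → NNReal, s = fun r => (t r : ℝ≥0∞) :=
    ⟨fun r => (s r).toNNReal, funext fun r => (ENNReal.coe_toNNReal (hs r)).symm⟩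
  generalize ‖iteratedDeriv 2 h 0‖₊ = q₂
  generalize ‖iteratedDeriv 1 h 0‖₊ = q₁
  have : ((g : ℝ≥0∞) * ((t 1 : ℝ≥0∞) ^ 3 + 3 * (t 0 * t 1 * t 2) + (t 0 : ℝ≥0∞) ^ 2 * t 3) +
      q₂ * (3 * (t 1 * t 2) + t 0 * t 3) + q₁ * t 3) =
      ((g * (t 1 ^ 3 + 3 * (t 0 * t 1 * t 2) + t 0 ^ 2 * t 3) +
      q₂ * (3 * (t 1 * t 2) + t 0 * t 3) + q₁ * t 3 : NNReal) : ℝ≥0∞) := by push_cast; rfl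
  rw [this, ENNReal.coe_toReal]
  push_cast
  simp only [ENNReal.coe_toReal]

theorem thirdOrder_ne_top {h : ℝ → ℝ} (hγ : gammaThree h ≠ ∞) {s : ℕ → ℝ≥0∞} (hs : ∀ r, s r ≠ ∞) :
    thirdOrder h s ≠ ∞ := by
  have h0 := hs 0
  have h1 := hs 1
  have h2 := hs 2
  have h3 := hs 3
  have e : ∀ r, eta r h ≠ ∞ := fun r => by simp [eta]
  unfold thirdOrder
  finiteness [e 1, e 2]

variable {Ω : Type*} [MeasurableSpace Ω] {P : Measure Ω}

theorem lintegral_thirdOrder_mul_le (h : ℝ → ℝ) {s : ℕ → Ω → ℝ≥0∞} {x : Ω → ℝ≥0∞}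
    {a : ℕ → ℝ≥0∞ → ℝ≥0∞} (hs : ∀ r ≤ 3, AEMeasurable (s r) P) (hx : AEMeasurable x P)
    (ha : ∀ r m, eLpNorm (s r) m P ≤ a r m) :
    ∫⁻ ω, thirdOrder h (fun r => s r ω) * x ω ^ 3 ∂P ≤
      lambdaTwo h a * (∫⁻ ω, x ω ^ 6 ∂P) ^ (1 / 2 : ℝ) := by
  have m0 := hs 0 (by norm_num)
  have m1 := hs 1 (by norm_num)
  have m2 := hs 2 (by norm_num)
  have m3 := hs 3 (by norm_num)
  set N := (∫⁻ ω, x ω ^ 6 ∂P) ^ (1 / 2 : ℝ)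
  have key1 : ∀ p : ℕ, p ≤ 3 → ∫⁻ ω, s p ω * x ω ^ 3 ∂P ≤ a p 2 * N := fun p hp => by
    have := lintegral_mul_pow_three_le (Finset.univ : Finset (Fin 1)) (a := fun _ => s p)
      (fun i _ => hs p hp) hx (by simp)
    simp only [Finset.prod_const, Finset.card_univ, Fintype.card_fin, pow_one] at this
    exact this.trans (mul_le_mul_left ((le_of_eq (by norm_num)).trans (ha p 2)) _)
  have key2 : ∀ p q : ℕ, p ≤ 3 → q ≤ 3 → ∫⁻ ω, (s p ω * s q ω) * x ω ^ 3 ∂P ≤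
      a p 4 * a q 4 * N := fun p q hp hq => by
    have := lintegral_mul_pow_three_le (Finset.univ : Finset (Fin 2)) (a := fun i => s (![p, q] i))
      (fun i _ => hs _ (by fin_cases i <;> simpa)) hx (by simp)
    simp only [Fin.prod_univ_two, Finset.card_univ, Fintype.card_fin] at this
    exact this.trans (mul_le_mul_left (mul_le_mul' ((le_of_eq (by norm_num)).trans (ha p 4))
      ((le_of_eq (by norm_num)).trans (ha q 4))) _)
  have key3 : ∀ p q r : ℕ, p ≤ 3 → q ≤ 3 → r ≤ 3 → ∫⁻ ω, (s p ω * s q ω * s r ω) * x ω ^ 3 ∂P ≤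
      a p 6 * a q 6 * a r 6 * N := fun p q r hp hq hr => by
    have := lintegral_mul_pow_three_le (Finset.univ : Finset (Fin 3))
      (a := fun i => s (![p, q, r] i))
      (fun i _ => hs _ (by fin_cases i <;> simpa)) hx (by simp)
    simp only [Fin.prod_univ_three, Finset.card_univ, Fintype.card_fin] at this
    exact this.trans (mul_le_mul_left (mul_le_mul' (mul_le_mul'
      ((le_of_eq (by norm_num)).trans (ha p 6)) ((le_of_eq (by norm_num)).trans (ha q 6)))
      ((le_of_eq (by norm_num; rfl)).trans (ha r 6))) _)
  have meas3 : ∀ p q r : ℕ, p ≤ 3 → q ≤ 3 → r ≤ 3 →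
      AEMeasurable (fun ω => (s p ω * s q ω * s r ω) * x ω ^ 3) P := fun p q r hp hq hr =>
    (((hs p hp).mul (hs q hq)).mul (hs r hr)).mul (hx.pow_const 3)
  have meas2 : ∀ p q : ℕ, p ≤ 3 → q ≤ 3 →
      AEMeasurable (fun ω => (s p ω * s q ω) * x ω ^ 3) P := fun p q hp hq =>
    ((hs p hp).mul (hs q hq)).mul (hx.pow_const 3)
  have meas1 : ∀ p : ℕ, p ≤ 3 → AEMeasurable (fun ω => s p ω * x ω ^ 3) P := fun p hp =>
    (hs p hp).mul (hx.pow_const 3)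
  have e : ∀ ω, thirdOrder h (fun r => s r ω) * x ω ^ 3 =
      gammaThree h * ((s 1 ω * s 1 ω * s 1 ω) * x ω ^ 3) +
      (gammaThree h * 3) * ((s 0 ω * s 1 ω * s 2 ω) * x ω ^ 3) +
      gammaThree h * ((s 0 ω * s 0 ω * s 3 ω) * x ω ^ 3) +
      (eta 2 h * 3) * ((s 1 ω * s 2 ω) * x ω ^ 3) +
      eta 2 h * ((s 0 ω * s 3 ω) * x ω ^ 3) +
      eta 1 h * (s 3 ω * x ω ^ 3) := fun ω => by
    unfold thirdOrder; ring
  simp only [e]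
  rw [lintegral_add_right' _ ((meas1 3 (by norm_num)).const_mul _),
    lintegral_add_right' _ ((meas2 0 3 (by norm_num) (by norm_num)).const_mul _),
    lintegral_add_right' _ ((meas2 1 2 (by norm_num) (by norm_num)).const_mul _),
    lintegral_add_right' _ ((meas3 0 0 3 (by norm_num) (by norm_num) (by norm_num)).const_mul _),
    lintegral_add_right' _ ((meas3 0 1 2 (by norm_num) (by norm_num) (by norm_num)).const_mul _),
    lintegral_const_mul'' _ (meas1 3 (by norm_num)),
    lintegral_const_mul'' _ (meas2 0 3 (by norm_num) (by norm_num)),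
    lintegral_const_mul'' _ (meas2 1 2 (by norm_num) (by norm_num)),
    lintegral_const_mul'' _ (meas3 0 0 3 (by norm_num) (by norm_num) (by norm_num)),
    lintegral_const_mul'' _ (meas3 0 1 2 (by norm_num) (by norm_num) (by norm_num)),
    lintegral_const_mul'' _ (meas3 1 1 1 (by norm_num) (by norm_num) (by norm_num))]
  calc _ ≤ gammaThree h * (a 1 6 * a 1 6 * a 1 6 * N) +
        (gammaThree h * 3) * (a 0 6 * a 1 6 * a 2 6 * N) +
        gammaThree h * (a 0 6 * a 0 6 * a 3 6 * N) +
        (eta 2 h * 3) * (a 1 4 * a 2 4 * N) + eta 2 h * (a 0 4 * a 3 4 * N) +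
        eta 1 h * (a 3 2 * N) := by
        refine add_le_add (add_le_add (add_le_add (add_le_add (add_le_add ?_ ?_) ?_) ?_) ?_) ?_ <;>
          refine mul_le_mul_right ?_ _
        · exact key3 1 1 1 (by norm_num) (by norm_num) (by norm_num)
        · exact key3 0 1 2 (by norm_num) (by norm_num) (by norm_num)
        · exact key3 0 0 3 (by norm_num) (by norm_num) (by norm_num)
        · exact key2 1 2 (by norm_num) (by norm_num)
        · exact key2 0 3 (by norm_num) (by norm_num)
        · exact key1 3 (by norm_num)
    _ = _ := by unfold lambdaTwo; ring

end Remainder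

/-! ### Expectation of a polynomial with independent random coefficients. -/

section TaylorMean

variable {Ω S : Type*} [MeasurableSpace Ω] [MeasurableSpace S] {P : Measure Ω} {ι : Type*}
  [Fintype ι]

/-- Expectation of a quadratic polynomial in `x` whose coefficients are functions of a random
element independent of `x`. -/
theorem integral_quadratic_of_indepFun {W : Ω → S} {x : Ω → EuclideanSpace ℝ ι}
    (hind : IndepFun W x P) {c : S → ℝ} {A : ι → S → ℝ} {B : ι → ι → S → ℝ}
    (hA : ∀ p, Measurable (A p)) (hB : ∀ p q, Measurable (B p q))
    (ic : Integrable (fun ω => c (W ω)) P) (iA : ∀ p, Integrable (fun ω => A p (W ω)) P)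
    (iB : ∀ p q, Integrable (fun ω => B p q (W ω)) P)
    (ix : ∀ p, Integrable (fun ω => x ω p) P)
    (ixx : ∀ p q, Integrable (fun ω => x ω p * x ω q) P) :
    Integrable (fun ω => c (W ω) + ∑ p, A p (W ω) * x ω p +
      ∑ p, ∑ q, B p q (W ω) * (x ω p * x ω q)) P ∧
    ∫ ω, (c (W ω) + ∑ p, A p (W ω) * x ω p + ∑ p, ∑ q, B p q (W ω) * (x ω p * x ω q)) ∂P =
      ∫ ω, c (W ω) ∂P + ∑ p, (∫ ω, A p (W ω) ∂P) * ∫ ω, x ω p ∂P +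
      ∑ p, ∑ q, (∫ ω, B p q (W ω) ∂P) * ∫ ω, x ω p * x ω q ∂P := by
  have hi : ∀ p, IndepFun (fun ω => A p (W ω)) (fun ω => x ω p) P := fun p =>
    hind.comp (φ := A p) (ψ := fun y : EuclideanSpace ℝ ι => y p) (hA p) (by fun_prop)
  have hij : ∀ p q, IndepFun (fun ω => B p q (W ω)) (fun ω => x ω p * x ω q) P := fun p q =>
    hind.comp (φ := B p q) (ψ := fun y : EuclideanSpace ℝ ι => y p * y q) (hB p q) (by fun_prop)
  have jA : ∀ p, Integrable (fun ω => A p (W ω) * x ω p) P := fun p =>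
    (hi p).integrable_mul (iA p) (ix p)
  have jB : ∀ p q, Integrable (fun ω => B p q (W ω) * (x ω p * x ω q)) P := fun p q =>
    (hij p q).integrable_mul (iB p q) (ixx p q)
  have sA : Integrable (fun ω => ∑ p, A p (W ω) * x ω p) P := integrable_finsetSum _ fun p _ => jA p
  have sB' : ∀ p, Integrable (fun ω => ∑ q, B p q (W ω) * (x ω p * x ω q)) P :=
    fun p => integrable_finsetSum _ fun q _ => jB p q
  have sB : Integrable (fun ω => ∑ p, ∑ q, B p q (W ω) * (x ω p * x ω q)) P :=
    integrable_finsetSum _ fun p _ => sB' p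
  refine ⟨(ic.add sA).add sB, ?_⟩
  rw [integral_add (f := fun ω => c (W ω) + ∑ p, A p (W ω) * x ω p) (ic.add sA) sB,
    integral_add ic sA, integral_finsetSum _ fun p _ => jA p,
    integral_finsetSum _ fun p _ => sB' p]
  congr 1
  · congr 1
    refine Finset.sum_congr rfl fun p _ => ?_
    exact (hi p).integral_fun_mul_eq_mul_integral (iA p).1 (ix p).1
  · refine Finset.sum_congr rfl fun p _ => ?_
    rw [integral_finsetSum _ fun q _ => jB p q]
    refine Finset.sum_congr rfl fun q _ => ?_
    exact (hij p q).integral_fun_mul_eq_mul_integral (iB p q).1 (ixx p q).1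

end TaylorMean

/-! ### Coefficients of the Taylor polynomial and their growth. -/

section TaylorCoefficients

variable {n k d b : ℕ}

/-- Partial derivative of order `r` in block `i`, in the coordinate directions `a`. -/
noncomputable def blockPartial (f : (Fin n → Block k d b) → ℝ) (i : Fin n) {r : ℕ}
    (a : Fin r → Fin k × (Fin d ⊕ Fin b)) (w : Fin n → Block k d b) : ℝ :=
  iteratedFDeriv ℝ r f w (fun s => ContinuousLinearMap.single ℝ (fun _ : Fin n => Block k d b) i
    (EuclideanSpace.single (a s) (1 : ℝ)))

/-- First order Taylor coefficient of `h ∘ f` in block `i`. -/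
noncomputable def taylorLinear (h : ℝ → ℝ) (f : (Fin n → Block k d b) → ℝ) (i : Fin n)
    (p : Fin k × (Fin d ⊕ Fin b)) (w : Fin n → Block k d b) : ℝ :=
  iteratedDeriv 1 h (f w) * blockPartial f i ![p] w

/-- Second order Taylor coefficient of `h ∘ f` in block `i`. -/
noncomputable def taylorQuadratic (h : ℝ → ℝ) (f : (Fin n → Block k d b) → ℝ) (i : Fin n)
    (p q : Fin k × (Fin d ⊕ Fin b)) (w : Fin n → Block k d b) : ℝ :=
  (iteratedDeriv 2 h (f w) * (blockPartial f i ![p] w * blockPartial f i ![q] w) +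
    iteratedDeriv 1 h (f w) * blockPartial f i ![p, q] w) / 2

variable {f : (Fin n → Block k d b) → ℝ} {h : ℝ → ℝ}

theorem continuous_blockPartial {r : ℕ} (hf : ContDiff ℝ r f) (i : Fin n)
    (a : Fin r → Fin k × (Fin d ⊕ Fin b)) : Continuous (blockPartial f i a) :=
  (ContinuousMultilinearMap.apply ℝ (fun _ : Fin r => Fin n → Block k d b) ℝ _).continuous.comp
    (hf.continuous_iteratedFDeriv le_rfl)

theorem abs_blockPartial_interp_le {r : ℕ} (hf : ContDiff ℝ r f) (u z : Fin n → Block k d b)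
    (i : Fin n) (a : Fin r → Fin k × (Fin d ⊕ Fin b)) :
    |blockPartial f i a (interp u z i 0)| ≤ derivNorm r (fun w' => f (interp u z i w')) 0 := by
  have := norm_iteratedFDeriv_single_le_derivNorm r (fun w' => f (interp u z i w')) 0 a
  rwa [iteratedFDeriv_interp hf, Real.norm_eq_abs] at this

/-- In coordinates the coefficients depend on the interpolation at 0 only, the form in which
independence from the block x can be used. -/
theorem taylor_interp_eq (hf : ContDiff ℝ 3 f) (u z : Fin n → Block k d b) (i : Fin n)
    (x : Block k d b) :
    (h (f (interp u z i 0)) + iteratedDeriv 1 h (f (interp u z i 0)) *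
      iteratedFDeriv ℝ 1 (fun w' => f (interp u z i w')) 0 (fun _ => x) +
      (iteratedDeriv 2 h (f (interp u z i 0)) *
        iteratedFDeriv ℝ 1 (fun w' => f (interp u z i w')) 0 (fun _ => x) ^ 2 +
        iteratedDeriv 1 h (f (interp u z i 0)) *
        iteratedFDeriv ℝ 2 (fun w' => f (interp u z i w')) 0 (fun _ => x)) / 2) =
    h (f (interp u z i 0)) + ∑ p, taylorLinear h f i p (interp u z i 0) * x p +
      ∑ p, ∑ q, taylorQuadratic h f i p q (interp u z i 0) * (x p * x q) := by
  have f1 : ContDiff ℝ (1 : ℕ) f := hf.of_le (by norm_num)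
  have f2 : ContDiff ℝ (2 : ℕ) f := hf.of_le (by norm_cast)
  have d1 : iteratedFDeriv ℝ 1 (fun w' => f (interp u z i w')) 0 (fun _ => x) =
      ∑ p, x p * blockPartial f i ![p] (interp u z i 0) := by
    rw [iteratedFDeriv_diag_eq_sum, sum_fin_succ_arrow]
    refine Finset.sum_congr rfl fun p _ => ?_
    rw [sum_fin_zero_arrow, iteratedFDeriv_interp f1, smul_eq_mul]
    simp only [Finset.univ_unique, Finset.prod_singleton]
    rfl
  have d2 : iteratedFDeriv ℝ 2 (fun w' => f (interp u z i w')) 0 (fun _ => x) =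
      ∑ p, ∑ q, x p * x q * blockPartial f i ![p, q] (interp u z i 0) := by
    rw [iteratedFDeriv_diag_eq_sum, sum_fin_succ_arrow]
    refine Finset.sum_congr rfl fun p _ => ?_
    rw [sum_fin_succ_arrow]
    refine Finset.sum_congr rfl fun q _ => ?_
    rw [sum_fin_zero_arrow, iteratedFDeriv_interp f2, smul_eq_mul, Fin.prod_univ_two]
    rfl
  rw [d1, d2, sq, Finset.sum_mul_sum, Finset.mul_sum, Finset.mul_sum, Finset.mul_sum,
    ← Finset.sum_add_distrib, Finset.sum_div, add_assoc, add_assoc]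
  congr 2
  · refine Finset.sum_congr rfl fun p _ => ?_
    unfold taylorLinear; ring
  · refine Finset.sum_congr rfl fun p _ => ?_
    rw [Finset.mul_sum, Finset.mul_sum, ← Finset.sum_add_distrib, Finset.sum_div]
    refine Finset.sum_congr rfl fun q _ => ?_
    unfold taylorQuadratic; ring

/-- A bounded third derivative forces at most linear growth of h'', quadratic of h' and cubic of h.
-/
theorem ThriceDifferentiable.exists_bound (hh : ThriceDifferentiable h) (hγ : gammaThree h ≠ ∞) :
    ∃ K : ℝ, 0 ≤ K ∧ ∀ y D : ℝ, 1 ≤ D → |y| ≤ D → |h y| ≤ K * D ^ 3 ∧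
      |iteratedDeriv 1 h y| ≤ K * D ^ 2 ∧ |iteratedDeriv 2 h y| ≤ K * D := by
  set g := (gammaThree h).toReal
  have g0 : 0 ≤ g := ENNReal.toReal_nonneg
  set c0 := |h 0|
  set c1 := |iteratedDeriv 1 h 0|
  set c2 := |iteratedDeriv 2 h 0|
  have n0 : 0 ≤ c0 := abs_nonneg _
  have n1 : 0 ≤ c1 := abs_nonneg _
  have n2 : 0 ≤ c2 := abs_nonneg _
  refine ⟨c0 + c1 + c2 + g, by positivity, fun y D hD hy => ?_⟩
  have hD0 : 0 ≤ D := by linarith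
  have p2 : D ≤ D ^ 2 := by nlinarith
  have p3 : D ^ 2 ≤ D ^ 3 := by nlinarith [sq_nonneg D]
  have b2 := abs_iteratedDeriv_two_le hh hγ y
  have b1 := abs_iteratedDeriv_one_le hh hγ y
  have b0 := abs_le_of_thriceDifferentiable hh hγ y
  refine ⟨?_, ?_, ?_⟩
  · calc |h y| ≤ c0 + (c1 + c2 * D + g * D ^ 2) * D := b0.trans (by gcongr)
      _ = c0 * 1 + c1 * D + c2 * D ^ 2 + g * D ^ 3 := by ring
      _ ≤ c0 * D ^ 3 + c1 * D ^ 3 + c2 * D ^ 3 + g * D ^ 3 := by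
        gcongr <;> linarith
      _ = _ := by ring
  · calc _ ≤ c1 + c2 * D + g * D ^ 2 := b1.trans (by gcongr)
      _ ≤ c0 * D ^ 2 + c1 * D ^ 2 + c2 * D ^ 2 + g * D ^ 2 := by
        have : c1 * 1 ≤ c1 * D ^ 2 := by gcongr; linarith
        have : c2 * D ≤ c2 * D ^ 2 := by gcongr
        have : 0 ≤ c0 * D ^ 2 := by positivity
        linarith
      _ = _ := by ring
  · calc _ ≤ c2 + g * D := b2.trans (by gcongr)
      _ ≤ c0 * D + c1 * D + c2 * D + g * D := by
        have : c2 * 1 ≤ c2 * D := by gcongr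
        have : 0 ≤ c0 * D := by positivity
        have : 0 ≤ c1 * D := by positivity
        linarith
      _ = _ := by ring

end TaylorCoefficients

/-! ### Integrability and error of the Taylor approximation in one block. -/

section LindebergStep

variable {n k d b : ℕ} {Ω : Type*} [MeasurableSpace Ω] {P : Measure Ω} [IsProbabilityMeasure P]
  {U Z : Fin n → Ω → Block k d b} {f : (Fin n → Block k d b) → ℝ} {h : ℝ → ℝ}
  {x : Ω → Block k d b} {i : Fin n}

/-- The Taylor polynomial of second order in block `i` of `h ∘ f`, at the increment `x`. -/
noncomputable def taylorPoly (h : ℝ → ℝ) (f : (Fin n → Block k d b) → ℝ)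
    (u z : Fin n → Block k d b) (i : Fin n) (x : Block k d b) : ℝ :=
  h (f (interp u z i 0)) + ∑ p, taylorLinear h f i p (interp u z i 0) * x p +
    ∑ p, ∑ q, taylorQuadratic h f i p q (interp u z i 0) * (x p * x q)

omit [IsProbabilityMeasure P] in
theorem aemeasurable_supDeriv (hU : ∀ j, AEMeasurable (U j) P) (hZ : ∀ j, AEMeasurable (Z j) P)
    (hx : AEMeasurable x P) {r : ℕ} (hf : ContDiff ℝ r f) :
    AEMeasurable (fun ω => supDeriv f r (fun j => U j ω) (fun j => Z j ω) i (x ω)) P :=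
  (measurable_supDeriv hf i).comp_aemeasurable
    (f := fun ω => ((fun j => U j ω), (fun j => Z j ω), x ω)) (by fun_prop)

omit [IsProbabilityMeasure P] in
theorem aemeasurable_interp (hU : ∀ j, AEMeasurable (U j) P) (hZ : ∀ j, AEMeasurable (Z j) P)
    (hx : AEMeasurable x P) :
    AEMeasurable (fun ω => interp (fun j => U j ω) (fun j => Z j ω) i (x ω)) P :=
  (continuous_interp (E := Block k d b) i).measurable.comp_aemeasurable
    (f := fun ω => ((fun j => U j ω), (fun j => Z j ω), x ω)) (by fun_prop)

omit [IsProbabilityMeasure P] in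
theorem memLp_toReal_supDeriv (hU : ∀ j, AEMeasurable (U j) P) (hZ : ∀ j, AEMeasurable (Z j) P)
    (hx : AEMeasurable x P) {r : ℕ} (hf : ContDiff ℝ r f) {m : ℝ≥0∞}
    (hs : eLpNorm (fun ω => supDeriv f r (fun j => U j ω) (fun j => Z j ω) i (x ω)) m P ≠ ∞) :
    MemLp (fun ω => (supDeriv f r (fun j => U j ω) (fun j => Z j ω) i (x ω)).toReal) m P := by
  refine ⟨(aemeasurable_supDeriv hU hZ hx hf).ennreal_toReal.aestronglyMeasurable, ?_⟩
  refine lt_of_le_of_lt (le_of_eq (eLpNorm_congr_enorm_ae (ae_of_all _ fun ω => ?_))) hs.lt_top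
  rw [enorm_eq_self, Real.enorm_of_nonneg ENNReal.toReal_nonneg,
    ENNReal.ofReal_toReal (supDeriv_ne_top hf _ _ _ _)]

/-- One plus the suprema of the derivatives of orders 0, 1, 2 lies in L⁶, hence in L³, and dominates
all three along the segment. -/
theorem exists_integrable_pow_three_bound (hU : ∀ j, AEMeasurable (U j) P)
    (hZ : ∀ j, AEMeasurable (Z j) P) (hx : AEMeasurable x P) (hf : ContDiff ℝ 3 f)
    (hs : ∀ r ≤ 2,
      eLpNorm (fun ω => supDeriv f r (fun j => U j ω) (fun j => Z j ω) i (x ω)) 6 P ≠ ∞) :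
    ∃ D : Ω → ℝ, (∀ ω, 1 ≤ D ω) ∧ Integrable (fun ω => D ω ^ 3) P ∧
      ∀ r ≤ 2, ∀ t ∈ Set.Icc (0 : ℝ) 1, ∀ ω,
        derivNorm r (fun w' => f (interp (fun j => U j ω) (fun j => Z j ω) i w')) (t • x ω) ≤
          D ω := by
  obtain ⟨s, hs'⟩ : ∃ s : ℕ → Ω → ℝ, s = fun r ω =>
    (supDeriv f r (fun j => U j ω) (fun j => Z j ω) i (x ω)).toReal := ⟨_, rfl⟩
  have fr : ∀ r ≤ 2, ContDiff ℝ (r : ℕ) f := fun r hr => hf.of_le (by norm_cast; omega)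
  have ms : ∀ r ≤ 2, MemLp (s r) 6 P := fun r hr => by
    rw [hs']
    exact memLp_toReal_supDeriv hU hZ hx (fr r hr) (hs r hr)
  have s0 : ∀ r ω, 0 ≤ s r ω := fun r ω => by
    rw [hs']
    exact ENNReal.toReal_nonneg
  have mc : MemLp (fun _ : Ω => (1 : ℝ)) 6 P := memLp_const 1
  have mD : MemLp (fun ω => 1 + s 0 ω + s 1 ω + s 2 ω) 6 P :=
    ((mc.add (ms 0 (by omega))).add (ms 1 (by omega))).add (ms 2 le_rfl)
  have D1 : ∀ ω, 1 ≤ 1 + s 0 ω + s 1 ω + s 2 ω := fun ω => by linarith [s0 0 ω, s0 1 ω, s0 2 ω]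
  refine ⟨fun ω => 1 + s 0 ω + s 1 ω + s 2 ω, D1, ?_, fun r hr t ht ω => ?_⟩
  · refine ((mD.mono_exponent (p := (3 : ℕ)) (by norm_num)).integrable_norm_pow' ).congr
      (ae_of_all _ fun ω => ?_)
    simp only
    rw [Real.norm_of_nonneg (by linarith [D1 ω])]
  · have h1 := derivNorm_le_toReal_supDeriv (fr r hr) (fun j => U j ω) (fun j => Z j ω) i (x ω) ht
    have h2 : s r ω = (supDeriv f r (fun j => U j ω) (fun j => Z j ω) i (x ω)).toReal := by
      rw [hs']
    rw [← h2] at h1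
    interval_cases r <;> linarith [s0 0 ω, s0 1 ω, s0 2 ω]

/-- All integrands in the expansion of `h ∘ f` around `x = 0` in block `i` are integrable. -/
theorem integrable_taylor (hU : ∀ j, AEMeasurable (U j) P) (hZ : ∀ j, AEMeasurable (Z j) P)
    (hx : AEMeasurable x P) (hf : ContDiff ℝ 3 f) (hh : ThriceDifferentiable h)
    (hγ : gammaThree h ≠ ∞)
    (hs : ∀ r ≤ 2,
      eLpNorm (fun ω => supDeriv f r (fun j => U j ω) (fun j => Z j ω) i (x ω)) 6 P ≠ ∞) :
    Integrable (fun ω => h (f (interp (fun j => U j ω) (fun j => Z j ω) i (x ω)))) P ∧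
    Integrable (fun ω => h (f (interp (fun j => U j ω) (fun j => Z j ω) i 0))) P ∧
    (∀ p, Integrable
      (fun ω => taylorLinear h f i p (interp (fun j => U j ω) (fun j => Z j ω) i 0)) P) ∧
    ∀ p q, Integrable
      (fun ω => taylorQuadratic h f i p q (interp (fun j => U j ω) (fun j => Z j ω) i 0)) P := by
  have f1 : ContDiff ℝ (1 : ℕ) f := hf.of_le (by norm_num)
  have f2 : ContDiff ℝ (2 : ℕ) f := hf.of_le (by norm_cast)
  obtain ⟨K, hK, hb⟩ := hh.exists_bound hγ
  obtain ⟨D, D1, iD, bD⟩ := exists_integrable_pow_three_bound hU hZ hx hf hs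
  -- Every integrand is O(D³): h is O(D³), h' times a derivative of f is O(D² · D), and h'' times
  -- two first derivatives is O(D · D²).
  have bd : ∀ {g : Ω → ℝ}, AEStronglyMeasurable g P → (∀ ω, |g ω| ≤ K * D ω ^ 3) →
      Integrable g P := fun {g} hg hgD => (iD.const_mul K).mono' hg (ae_of_all _ hgD)
  have hW1 : AEMeasurable (fun ω => interp (fun j => U j ω) (fun j => Z j ω) i (x ω)) P :=
    aemeasurable_interp hU hZ hx
  have hW0 : AEMeasurable (fun ω => interp (fun j => U j ω) (fun j => Z j ω) i 0) P :=
    aemeasurable_interp hU hZ aemeasurable_const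
  have z0 : ∀ r ≤ 2, ∀ ω,
      derivNorm r (fun w' => f (interp (fun j => U j ω) (fun j => Z j ω) i w')) 0 ≤ D ω :=
    fun r hr ω => by simpa using bD r hr 0 (by simp) ω
  have a0 : ∀ ω, |f (interp (fun j => U j ω) (fun j => Z j ω) i 0)| ≤ D ω := fun ω => by
    have := z0 0 (by norm_num) ω
    rwa [derivNorm_zero, Real.norm_eq_abs] at this
  have a0' : ∀ ω, |f (interp (fun j => U j ω) (fun j => Z j ω) i (x ω))| ≤ D ω := fun ω => by
    have := bD 0 (by norm_num) 1 (by simp) ω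
    rwa [derivNorm_zero, Real.norm_eq_abs, one_smul] at this
  have a1 : ∀ p ω, |blockPartial f i ![p] (interp (fun j => U j ω) (fun j => Z j ω) i 0)| ≤ D ω :=
    fun p ω => (abs_blockPartial_interp_le f1 _ _ i ![p]).trans (z0 1 (by norm_num) ω)
  have a2 : ∀ p q ω,
      |blockPartial f i ![p, q] (interp (fun j => U j ω) (fun j => Z j ω) i 0)| ≤ D ω :=
    fun p q ω => (abs_blockPartial_interp_le f2 _ _ i ![p, q]).trans (z0 2 (by norm_num) ω)
  have ch : ∀ r < 3, Continuous (fun w => iteratedDeriv r h (f w)) := fun r hr =>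
    (hh.continuous hr).comp hf.continuous
  have ch0 : Continuous (fun w => h (f w)) := by simpa using ch 0 (by norm_num)
  have sm : ∀ {g : (Fin n → Block k d b) → ℝ} {W : Ω → Fin n → Block k d b}, Continuous g →
      AEMeasurable W P → AEStronglyMeasurable (fun ω => g (W ω)) P := fun hg hW =>
    (hg.measurable.comp_aemeasurable hW).aestronglyMeasurable
  refine ⟨bd (sm ch0 hW1) fun ω => (hb _ _ (D1 ω) (a0' ω)).1,
    bd (sm ch0 hW0) fun ω => (hb _ _ (D1 ω) (a0 ω)).1, fun p => bd (sm ?_ hW0) fun ω => ?_,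
    fun p q => bd (sm ?_ hW0) fun ω => ?_⟩
  · exact (ch 1 (by norm_num)).mul (continuous_blockPartial f1 i _)
  · have b1 := (hb _ _ (D1 ω) (a0 ω)).2.1
    have b2 := a1 p ω
    have hD1 := D1 ω
    rw [taylorLinear, abs_mul]
    calc _ ≤ K * D ω ^ 2 * D ω := mul_le_mul b1 b2 (abs_nonneg _) (by positivity)
      _ = _ := by ring
  · exact (((ch 2 (by norm_num)).mul ((continuous_blockPartial f1 i _).mul
      (continuous_blockPartial f1 i _))).add ((ch 1 (by norm_num)).mul
      (continuous_blockPartial f2 i _))).div_const 2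
  · obtain ⟨_, b1, b2⟩ := hb _ _ (D1 ω) (a0 ω)
    have c1 := a1 p ω
    have c2 := a1 q ω
    have c3 := a2 p q ω
    have hD1 := D1 ω
    have hD0 : 0 ≤ D ω := by linarith
    rw [taylorQuadratic, abs_div, abs_two, div_le_iff₀ (by norm_num)]
    refine (abs_add_le _ _).trans ?_
    rw [abs_mul, abs_mul, abs_mul]
    have t1 := mul_le_mul b2 (mul_le_mul c1 c2 (abs_nonneg _) hD0)
      (mul_nonneg (abs_nonneg _) (abs_nonneg _)) (mul_nonneg hK hD0)
    have t2 := mul_le_mul b1 c3 (abs_nonneg _) (mul_nonneg hK (sq_nonneg _))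
    refine (add_le_add t1 t2).trans (le_of_eq (by ring))

omit [IsProbabilityMeasure P] in
/-- Distance between the expectation of `h ∘ f` and of its Taylor polynomial in block `i`. -/
theorem ofReal_abs_integral_sub_taylorPoly_le (hU : ∀ j, AEMeasurable (U j) P)
    (hZ : ∀ j, AEMeasurable (Z j) P) (hx : AEMeasurable x P) (hf : ContDiff ℝ 3 f)
    (hh : ThriceDifferentiable h) (hγ : gammaThree h ≠ ∞) {a : ℕ → ℝ≥0∞ → ℝ≥0∞}
    (ha : ∀ r m,
      eLpNorm (fun ω => supDeriv f r (fun j => U j ω) (fun j => Z j ω) i (x ω)) m P ≤ a r m)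
    (iH : Integrable (fun ω => h (f (interp (fun j => U j ω) (fun j => Z j ω) i (x ω)))) P)
    (iT : Integrable (fun ω => taylorPoly h f (fun j => U j ω) (fun j => Z j ω) i (x ω)) P) :
    ENNReal.ofReal |(∫ ω, h (f (interp (fun j => U j ω) (fun j => Z j ω) i (x ω))) ∂P) -
      ∫ ω, taylorPoly h f (fun j => U j ω) (fun j => Z j ω) i (x ω) ∂P| ≤
    lambdaTwo h a * (∫⁻ ω, ‖x ω‖ₑ ^ 6 ∂P) ^ (1 / 2 : ℝ) / 6 := by
  rw [← integral_sub iH iT, ← Real.norm_eq_abs, ofReal_norm]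
  refine (enorm_integral_le_lintegral_enorm _).trans ?_
  -- The order is capped at 3 because f is only C³, while finiteness in `toReal_thirdOrder` is
  -- required for all indices of the sequence.
  have key : ∀ ω, ‖h (f (interp (fun j => U j ω) (fun j => Z j ω) i (x ω))) -
      taylorPoly h f (fun j => U j ω) (fun j => Z j ω) i (x ω)‖ₑ ≤
      thirdOrder h (fun r => supDeriv f (min r 3) (fun j => U j ω) (fun j => Z j ω) i (x ω)) *
        ‖x ω‖ₑ ^ 3 / 6 := by
    intro ω
    set s : ℕ → ℝ≥0∞ := fun r =>
      supDeriv f (min r 3) (fun j => U j ω) (fun j => Z j ω) i (x ω) with hs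
    have fr : ∀ r, ContDiff ℝ (min r 3 : ℕ) f := fun r => hf.of_le (by norm_cast; omega)
    have hs' : ∀ r, s r ≠ ∞ := fun r => supDeriv_ne_top (fr r) _ _ _ _
    have hφ : ContDiff ℝ 3 (fun w' => f (interp (fun j => U j ω) (fun j => Z j ω) i w')) :=
      hf.comp (contDiff_interp _ _ i)
    have main := abs_comp_sub_taylor_le hh hγ hφ (x ω)
      (M := (thirdOrder h s * ‖x ω‖ₑ ^ 3).toReal) (fun t ht => by
        have c : ∀ r ≤ 3, derivNorm r
            (fun w' => f (interp (fun j => U j ω) (fun j => Z j ω) i w')) (t • x ω) ≤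
            (s r).toReal := fun r hr => by
          have := derivNorm_le_toReal_supDeriv (fr r) (fun j => U j ω) (fun j => Z j ω) i (x ω) ht
          simpa only [hs, min_eq_left hr] using this
        rw [ENNReal.toReal_mul, toReal_thirdOrder hγ hs', ENNReal.toReal_pow, toReal_enorm]
        have c0 := c 0 (by norm_num)
        have c1 := c 1 (by norm_num)
        have c2 := c 2 (by norm_num)
        have c3 := c 3 (by norm_num)
        have n : ∀ r, 0 ≤ derivNorm r
            (fun w' => f (interp (fun j => U j ω) (fun j => Z j ω) i w')) (t • x ω) :=
          fun r => derivNorm_nonneg _ _ _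
        have n0 := n 0
        have n1 := n 1
        have n2 := n 2
        have n3 := n 3
        have g0 : 0 ≤ (gammaThree h).toReal := ENNReal.toReal_nonneg
        gcongr)
    rw [taylor_interp_eq hf] at main
    have fin : thirdOrder h s * ‖x ω‖ₑ ^ 3 ≠ ∞ :=
      ENNReal.mul_ne_top (thirdOrder_ne_top hγ hs') (by simp)
    rw [← ofReal_norm, Real.norm_eq_abs]
    refine (ENNReal.ofReal_le_ofReal main).trans (le_of_eq ?_)
    rw [ENNReal.ofReal_div_of_pos (by norm_num), ENNReal.ofReal_toReal fin]
    norm_num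
  refine (lintegral_mono key).trans ?_
  simp only [div_eq_mul_inv]
  rw [lintegral_mul_const' _ _ (by simp)]
  refine mul_le_mul_left ?_ _
  have := lintegral_thirdOrder_mul_le (P := P) h
    (s := fun r ω => supDeriv f (min r 3) (fun j => U j ω) (fun j => Z j ω) i (x ω))
    (x := fun ω => ‖x ω‖ₑ) (a := fun r m => a (min r 3) m)
    (fun r hr => aemeasurable_supDeriv hU hZ hx (hf.of_le (by norm_cast; omega))) hx.enorm
    (fun r m => ha _ m)
  exact this

end LindebergStep

/-! ### Exchange of one block, and the telescoping sum. -/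

section Lindeberg

variable {n k d b : ℕ} {Ω : Type*} [MeasurableSpace Ω] {P : Measure Ω} [IsProbabilityMeasure P]
  {U Z : Fin n → Ω → Block k d b} {C : ℝ} {f : (Fin n → Block k d b) → ℝ} {h : ℝ → ℝ}

theorem ofReal_abs_sub_le_add {x y t : ℝ} :
    ENNReal.ofReal |x - y| ≤ ENNReal.ofReal |x - t| + ENNReal.ofReal |y - t| := by
  rw [← ENNReal.ofReal_add (abs_nonneg _) (abs_nonneg _)]
  refine ENNReal.ofReal_le_ofReal ?_
  rw [abs_sub_comm y t]
  exact abs_sub_le x t y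

namespace GaussianMatch

theorem integrable_mul_data (hm : GaussianMatch P U Z C) (i : Fin n)
    (p q : Fin k × (Fin d ⊕ Fin b)) : Integrable (fun ω => U i ω p * U i ω q) P :=
  (hm.memLp_coord i p 2).integrable_mul (hm.memLp_coord i q 2)

omit [IsProbabilityMeasure P] in
theorem integrable_mul_gaussian (hm : GaussianMatch P U Z C) (i : Fin n)
    (p q : Fin k × (Fin d ⊕ Fin b)) : Integrable (fun ω => Z i ω p * Z i ω q) P :=
  (hm.gaussian_coord i p).memLp_two.integrable_mul (hm.gaussian_coord i q).memLp_two

theorem integral_mul_eq (hm : GaussianMatch P U Z C) (i : Fin n)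
    (p q : Fin k × (Fin d ⊕ Fin b)) :
    ∫ ω, Z i ω p * Z i ω q ∂P = ∫ ω, U i ω p * U i ω q ∂P := by
  have h1 := congrFun (congrFun (hm.covariance i) p) q
  rw [covMat, covMat, covariance_eq_sub (hm.gaussian_coord i p).memLp_two
    (hm.gaussian_coord i q).memLp_two, covariance_eq_sub (hm.memLp_coord i p 2)
    (hm.memLp_coord i q 2), hm.mean, hm.mean] at h1
  simpa using h1

theorem lintegral_pow_six_rpow_le (hm : GaussianMatch P U Z C) (i : Fin n) :
    (∫⁻ ω, ‖Z i ω‖ₑ ^ 6 ∂P) ^ (1 / 2 : ℝ) ≤ 4 * (∫⁻ ω, ‖U i ω‖ₑ ^ 6 ∂P) ^ (1 / 2 : ℝ) := by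
  refine (ENNReal.rpow_le_rpow (hm.lintegral_pow_six_le i) (by norm_num)).trans (le_of_eq ?_)
  rw [ENNReal.mul_rpow_of_nonneg _ _ (by norm_num)]
  congr 1
  rw [show (16 : ℝ≥0∞) = 4 ^ (2 : ℝ) by norm_num, ← ENNReal.rpow_mul]
  norm_num

/-- The random Taylor polynomials at the data block and at the Gaussian block are integrable, with
equal expectations. -/
theorem integral_taylorPoly_eq (hm : GaussianMatch P U Z C) (hf : ContDiff ℝ 3 f)
    (hh : ThriceDifferentiable h) (hγ : gammaThree h ≠ ∞) (i : Fin n)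
    (hs : ∀ r ≤ 2,
      eLpNorm (fun ω => supDeriv f r (fun j => U j ω) (fun j => Z j ω) i (U i ω)) 6 P ≠ ∞) :
    Integrable (fun ω => taylorPoly h f (fun j => U j ω) (fun j => Z j ω) i (U i ω)) P ∧
    Integrable (fun ω => taylorPoly h f (fun j => U j ω) (fun j => Z j ω) i (Z i ω)) P ∧
    ∫ ω, taylorPoly h f (fun j => U j ω) (fun j => Z j ω) i (U i ω) ∂P =
      ∫ ω, taylorPoly h f (fun j => U j ω) (fun j => Z j ω) i (Z i ω) ∂P := by
  have hU := hm.aemeasurable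
  have hZ : ∀ j, AEMeasurable (Z j) P := fun j => (hm.gaussian j).aemeasurable
  obtain ⟨-, ic, iA, iB⟩ := integrable_taylor hU hZ (hU i) hf hh hγ hs
  have f1 : ContDiff ℝ (1 : ℕ) f := hf.of_le (by norm_num)
  have f2 : ContDiff ℝ (2 : ℕ) f := hf.of_le (by norm_cast)
  have c1 : Continuous (fun w => iteratedDeriv 1 h (f w)) :=
    (hh.continuous (by norm_num)).comp hf.continuous
  have c2 : Continuous (fun w => iteratedDeriv 2 h (f w)) :=
    (hh.continuous (by norm_num)).comp hf.continuous
  have mA : ∀ p, Measurable (taylorLinear h f i p) := fun p =>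
    (c1.mul (continuous_blockPartial f1 i _)).measurable
  have mB : ∀ p q, Measurable (taylorQuadratic h f i p q) := fun p q =>
    (((c2.mul ((continuous_blockPartial f1 i _).mul (continuous_blockPartial f1 i _))).add
      (c1.mul (continuous_blockPartial f2 i _))).div_const 2).measurable
  obtain ⟨jU, eU⟩ := integral_quadratic_of_indepFun (c := fun w => h (f w))
    (indepFun_interp_left hm.indep hU hZ hm.indep_data i) mA mB ic iA iB
    (fun p => (hm.memLp_coord i p 1).integrable le_rfl) (hm.integrable_mul_data i)
  obtain ⟨jZ, eZ⟩ := integral_quadratic_of_indepFun (c := fun w => h (f w))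
    (indepFun_interp_right hm.indep_gaussian hU hZ hm.indep_data i) mA mB ic iA iB
    (fun p => (hm.gaussian_coord i p).integrable) (hm.integrable_mul_gaussian i)
  refine ⟨jU, jZ, eU.trans (Eq.trans ?_ eZ.symm)⟩
  simp only [hm.mean, hm.integral_mul_eq]

/-- Let N be the root of the sixth moment of the data block. The remainders are at most λ₂N/6 and,
for the Gaussian block, λ₂ · 4N/6. Their sum 5λ₂N/6 is below λ₂N, so no Gaussian moment and no
constant is left. -/
theorem lindeberg_step (hm : GaussianMatch P U Z C) (hf : ContDiff ℝ 3 f)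
    (hα : ∀ r ≤ 2, alpha P f U Z r 6 ≠ ∞) (hh : ThriceDifferentiable h) (hγ : gammaThree h ≠ ∞)
    (i : Fin n) :
    Integrable (fun ω => h (f (interp (fun j => U j ω) (fun j => Z j ω) i (U i ω)))) P ∧
    Integrable (fun ω => h (f (interp (fun j => U j ω) (fun j => Z j ω) i (Z i ω)))) P ∧
    ENNReal.ofReal |(∫ ω, h (f (interp (fun j => U j ω) (fun j => Z j ω) i (U i ω))) ∂P) -
      ∫ ω, h (f (interp (fun j => U j ω) (fun j => Z j ω) i (Z i ω))) ∂P| ≤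
    lambdaTwo h (alpha P f U Z) * (∫⁻ ω, ‖U i ω‖ₑ ^ 6 ∂P) ^ (1 / 2 : ℝ) := by
  have hU := hm.aemeasurable
  have hZ : ∀ j, AEMeasurable (Z j) P := fun j => (hm.gaussian j).aemeasurable
  have aU : ∀ r m, eLpNorm (fun ω => supDeriv f r (fun j => U j ω) (fun j => Z j ω) i (U i ω)) m P ≤
      alpha P f U Z r m := fun r m => (le_max_left _ _).trans (le_iSup (fun i => max
      (eLpNorm (fun ω => supDeriv f r (fun j => U j ω) (fun j => Z j ω) i (U i ω)) m P)
      (eLpNorm (fun ω => supDeriv f r (fun j => U j ω) (fun j => Z j ω) i (Z i ω)) m P)) i)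
  have aZ : ∀ r m, eLpNorm (fun ω => supDeriv f r (fun j => U j ω) (fun j => Z j ω) i (Z i ω)) m P ≤
      alpha P f U Z r m := fun r m => (le_max_right _ _).trans (le_iSup (fun i => max
      (eLpNorm (fun ω => supDeriv f r (fun j => U j ω) (fun j => Z j ω) i (U i ω)) m P)
      (eLpNorm (fun ω => supDeriv f r (fun j => U j ω) (fun j => Z j ω) i (Z i ω)) m P)) i)
  have sU := fun r hr => ne_top_of_le_ne_top (hα r hr) (aU r 6)
  have sZ := fun r hr => ne_top_of_le_ne_top (hα r hr) (aZ r 6)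
  have iU := (integrable_taylor hU hZ (hU i) hf hh hγ sU).1
  have iZ := (integrable_taylor hU hZ (hZ i) hf hh hγ sZ).1
  obtain ⟨tU, tZ, te⟩ := hm.integral_taylorPoly_eq hf hh hγ i sU
  refine ⟨iU, iZ, ?_⟩
  have bU := ofReal_abs_integral_sub_taylorPoly_le hU hZ (hU i) hf hh hγ aU iU tU
  have bZ := ofReal_abs_integral_sub_taylorPoly_le hU hZ (hZ i) hf hh hγ aZ iZ tZ
  rw [← te] at bZ
  refine ofReal_abs_sub_le_add.trans ((add_le_add bU bZ).trans ?_)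
  have six := hm.lintegral_pow_six_rpow_le i
  generalize lambdaTwo h (alpha P f U Z) = l
  generalize (∫⁻ ω, ‖U i ω‖ₑ ^ 6 ∂P) ^ (1 / 2 : ℝ) = N at *
  calc _ ≤ l * N / 6 + l * (4 * N) / 6 := by gcongr
    _ = (l * N) * (5 / 6) := by
      simp only [div_eq_mul_inv]; ring
    _ ≤ (l * N) * 1 := by
      gcongr
      rw [ENNReal.div_le_iff (by norm_num) (by norm_num)]
      norm_num
    _ = _ := mul_one _

/-- The Lindeberg principle: replacing the data blocks one at a time by matching Gaussian blocks. -/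
theorem lindeberg (hm : GaussianMatch P U Z C) (hf : ContDiff ℝ 3 f)
    (hα : ∀ r ≤ 2, alpha P f U Z r 6 ≠ ∞) (hh : ThriceDifferentiable h) (hγ : gammaThree h ≠ ∞) :
    Integrable (fun ω => h (f (fun i => U i ω))) P ∧
    Integrable (fun ω => h (f (fun i => Z i ω))) P ∧
    ENNReal.ofReal |(∫ ω, h (f (fun i => U i ω)) ∂P) - ∫ ω, h (f (fun i => Z i ω)) ∂P| ≤
      ∑ i, lambdaTwo h (alpha P f U Z) * (∫⁻ ω, ‖U i ω‖ₑ ^ 6 ∂P) ^ (1 / 2 : ℝ) := by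
  -- V m has data in its first m slots: V 0 = Z, V n = U, and V (i + 1), V i are the two
  -- interpolations of slot i.
  set V : ℕ → Ω → Fin n → Block k d b := fun m ω j => if j.val < m then U j ω else Z j ω with hV
  have V0 : ∀ ω, V 0 ω = fun i => Z i ω := fun ω => by simp [hV]
  have Vn : ∀ ω, V n ω = fun i => U i ω := fun ω => by simp [hV]
  have VU : ∀ (i : Fin n) ω, interp (fun j => U j ω) (fun j => Z j ω) i (U i ω) = V (i + 1) ω := by
    intro i ω
    funext j
    simp only [interp, hV]
    rcases lt_trichotomy j i with hj | rfl | hj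
    · have : j.val < i.val := hj
      rw [if_pos hj, if_pos (by omega)]
    · simp
    · have : i.val < j.val := hj
      rw [if_neg hj.not_gt, if_neg hj.ne', if_neg (by omega)]
  have VZ : ∀ (i : Fin n) ω, interp (fun j => U j ω) (fun j => Z j ω) i (Z i ω) = V i ω := by
    intro i ω
    funext j
    simp only [interp, hV]
    rcases lt_trichotomy j i with hj | rfl | hj
    · have : j.val < i.val := hj
      rw [if_pos hj, if_pos this]
    · simp
    · have : i.val < j.val := hj
      rw [if_neg hj.not_gt, if_neg hj.ne', if_neg (by omega)]
  have step := fun i => hm.lindeberg_step hf hα hh hγ i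
  simp only [VU, VZ] at step
  have end_points : Integrable (fun ω => h (f (V n ω))) P ∧ Integrable (fun ω => h (f (V 0 ω))) P := by
    -- Integrability at the end points comes from the last and the first exchange; for n = 0 there
    -- is none, and the functions are constant.
    rcases Nat.eq_zero_or_pos n with rfl | hn
    · have : ∀ v : Fin 0 → Block k d b, v = 0 := fun v => Subsingleton.elim _ _
      simp only [this (V 0 _)]
      exact ⟨integrable_const _, integrable_const _⟩
    · refine ⟨?_, (step ⟨0, hn⟩).2.1⟩
      have := (step ⟨n - 1, by omega⟩).1
      simpa only [Nat.sub_add_cancel hn] using this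
  simp only [V0, Vn] at end_points
  refine ⟨end_points.1, end_points.2, ?_⟩
  have tele := Finset.sum_range_sub (fun m => ∫ ω, h (f (V m ω)) ∂P) n
  simp only [V0, Vn] at tele
  rw [← tele, ← Real.norm_eq_abs, ofReal_norm,
    Finset.sum_range (fun m => (∫ ω, h (f (V (m + 1) ω)) ∂P) - ∫ ω, h (f (V m ω)) ∂P)]
  refine (enorm_sum_le _ _).trans (Finset.sum_le_sum fun i _ => ?_)
  rw [← ofReal_norm, Real.norm_eq_abs]
  exact (step i).2.2

end GaussianMatch

end Lindeberg

/-! ### Sixth moments of bounded blocks. -/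

section SixthMoment

variable {n k d b : ℕ} {Ω : Type*} [MeasurableSpace Ω] {P : Measure Ω} [IsProbabilityMeasure P]
  {U Z : Fin n → Ω → Block k d b} {C : ℝ}

/-- Almost surely ‖U_i‖² ≤ 2C²k. The root of this bound is the factor k^{3/2} of the smoothness
condition. -/
theorem GaussianMatch.lintegral_enorm_pow_six_le (hm : GaussianMatch P U Z C) (hk : 0 < k)
    (i : Fin n) : ∫⁻ ω, ‖U i ω‖ₑ ^ 6 ∂P ≤ ENNReal.ofReal ((2 * C ^ 2 * k) ^ 3) := by
  have hk' : (0 : ℝ) < k := by exact_mod_cast hk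
  have h1 : ∀ᵐ ω ∂P, ‖U i ω‖ₑ ^ 6 ≤ ENNReal.ofReal ((2 * C ^ 2 * k) ^ 3) := by
    filter_upwards [ae_all_iff.2 (hm.ae_abs_le i)] with ω hω
    have h2 : ‖U i ω‖ ^ 2 ≤ 2 * C ^ 2 * k := by
      rw [EuclideanSpace.real_norm_sq_eq]
      refine le_trans (Finset.sum_le_sum fun p _ => ?_)
        ((div_le_iff₀ hk').1 (sum_block_coordScale_sq_le (d := d) (b := b) hk))
      rw [← sq_abs]
      exact pow_le_pow_left₀ (abs_nonneg _) (hω p) 2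
    rw [← ofReal_norm, ← ENNReal.ofReal_pow (norm_nonneg _)]
    refine ENNReal.ofReal_le_ofReal ?_
    calc ‖U i ω‖ ^ 6 = (‖U i ω‖ ^ 2) ^ 3 := by ring
      _ ≤ _ := pow_le_pow_left₀ (by positivity) h2 3
  refine (lintegral_mono_ae h1).trans ?_
  simp

theorem ENNReal.ofReal_mul_nat_pow_three_rpow {c : ℝ} (hc : 0 ≤ c) :
    ENNReal.ofReal ((c * (k : ℝ)) ^ 3) ^ (1 / 2 : ℝ) =
      ENNReal.ofReal (c ^ (3 / 2 : ℝ)) * ENNReal.ofReal ((k : ℝ) ^ (3 / 2 : ℝ)) := by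
  rw [ENNReal.ofReal_rpow_of_nonneg (by positivity) (by norm_num),
    ← ENNReal.ofReal_mul (by positivity), ← Real.mul_rpow hc (by positivity),
    ← Real.rpow_natCast, ← Real.rpow_mul (by positivity)]
  norm_num

end SixthMoment

/-! ### The zeroth stability number bounds the function itself. -/

section AlphaZero

variable {n k d b : ℕ} {Ω : Type*} [MeasurableSpace Ω] {P : Measure Ω} {F : Type*}
  [NormedAddCommGroup F] [NormedSpace ℝ F]

/-- The interpolation at the last slot, filled with its data block, is all of U; at slot 0, filled
with its Gaussian block, it is all of Z. Both are the end point t = 1 of a segment. -/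
theorem eLpNorm_comp_le_alpha (hn : 0 < n) (f : (Fin n → Block k d b) → F)
    (U Z : Fin n → Ω → Block k d b) (m : ℝ≥0∞) :
    eLpNorm (fun ω => f (fun i => U i ω)) m P ≤ alpha P f U Z 0 m ∧
      eLpNorm (fun ω => f (fun i => Z i ω)) m P ≤ alpha P f U Z 0 m := by
  have key : ∀ (u z : Fin n → Block k d b) (i : Fin n) (e : Block k d b),
      ‖f (interp u z i e)‖ₑ ≤ supDeriv f 0 u z i e := by
    intro u z i e
    have := ofReal_derivNorm_le_supDeriv f 0 u z i e (t := 1) (by simp)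
    rwa [derivNorm_zero, ofReal_norm, one_smul] at this
  have sup := fun i => le_iSup (fun i : Fin n => max
    (eLpNorm (fun ω => supDeriv f 0 (fun j => U j ω) (fun j => Z j ω) i (U i ω)) m P)
    (eLpNorm (fun ω => supDeriv f 0 (fun j => U j ω) (fun j => Z j ω) i (Z i ω)) m P)) i
  constructor
  · refine le_trans (eLpNorm_mono_enorm fun ω => ?_)
      ((le_max_left _ _).trans (sup ⟨n - 1, by omega⟩))
    have := key (fun j => U j ω) (fun j => Z j ω) ⟨n - 1, by omega⟩ (U ⟨n - 1, by omega⟩ ω)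
    rw [enorm_eq_self]
    convert this using 3
    funext j
    simp only [interp]
    split_ifs with h1 h2
    · rfl
    · rw [h2]
    · exact absurd (lt_of_le_of_ne (Fin.mk_le_mk.2 (Nat.le_sub_one_of_lt j.2)) h2) h1
  · refine le_trans (eLpNorm_mono_enorm fun ω => ?_)
      ((le_max_right _ _).trans (sup ⟨0, hn⟩))
    have := key (fun j => U j ω) (fun j => Z j ω) ⟨0, hn⟩ (Z ⟨0, hn⟩ ω)
    rw [enorm_eq_self]
    convert this using 3
    funext j
    simp only [interp]
    split_ifs with h1 h2
    · exact absurd h1 (Nat.not_lt_zero j.val)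
    · rw [h2]
    · rfl

end AlphaZero

/-! ### Convergence of d_ℋ for quadratic functions of the estimator. -/

section Convergence

variable {k d b : ℕ → ℕ} {Ω : ℕ → Type*} [∀ n, MeasurableSpace (Ω n)] {P : ∀ n, Measure (Ω n)}
  [∀ n, IsProbabilityMeasure (P n)] {U Z : ∀ n, Fin n → Ω n → Block (k n) (d n) (b n)} {C : ℝ}

theorem lambdaTwo_le_of_mem_testClass {h : ℝ → ℝ} (hh : h ∈ testClass) (a : ℕ → ℝ≥0∞ → ℝ≥0∞) :
    lambdaTwo h a ≤ ((a 1 6) ^ 3 + 3 * (a 0 6 * a 1 6 * a 2 6) + (a 0 6) ^ 2 * a 3 6) +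
      (3 * (a 1 4 * a 2 4) + a 0 4 * a 3 4) + a 3 2 := by
  obtain ⟨-, h1, h2, h3⟩ := hh
  unfold lambdaTwo
  calc _ ≤ 1 * ((a 1 6) ^ 3 + 3 * (a 0 6 * a 1 6 * a 2 6) + (a 0 6) ^ 2 * a 3 6) +
      1 * (3 * (a 1 4 * a 2 4) + a 0 4 * a 3 4) + 1 * a 3 2 := by gcongr
    _ = _ := by simp only [one_mul]

/-- The n exchanges cost n · λ₂ · O(k^{3/2}). On ℋ the factors of h in λ₂ are at most 1, so the
bound is uniform in h and is a combination of the six products of the smoothness condition. -/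
theorem distH_tendsto_zero (hk : ∀ n, 0 < k n) (hm : ∀ n, GaussianMatch (P n) (U n) (Z n) C)
    {f : ∀ n, (Fin n → Block (k n) (d n) (b n)) → ℝ} (hf : ∀ n, ContDiff ℝ 3 (f n))
    (hα : ∀ n, ∀ r ≤ 2, alpha (P n) (f n) (U n) (Z n) r 6 ≠ ∞)
    (hs : SmoothnessCondition k (fun n => alpha (P n) (f n) (U n) (Z n))) :
    DistHTendstoZero P (fun n ω => f n (fun i => U n i ω)) (fun n ω => f n (fun i => Z n i ω)) := by
  have fin : ∀ h ∈ testClass, gammaThree h ≠ ∞ := fun h hh =>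
    ne_top_of_le_ne_top ENNReal.one_ne_top hh.2.2.2
  have lind := fun n (h : ℝ → ℝ) (hh : h ∈ testClass) =>
    (hm n).lindeberg (hf n) (hα n) hh.1 (fin h hh)
  refine ⟨fun n h hh => ⟨(lind n h hh).1, (lind n h hh).2.1⟩, ?_⟩
  obtain ⟨-, t1, t2, t3, t4, t5, t6⟩ := hs
  have three : (3 : ℝ≥0∞) ≠ ∞ := by norm_num
  have lim := ENNReal.Tendsto.const_mul (a := ENNReal.ofReal ((2 * C ^ 2) ^ (3 / 2 : ℝ)))
    (((t1.add (ENNReal.Tendsto.const_mul t2 (Or.inr three))).add t3).add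
    ((ENNReal.Tendsto.const_mul t4 (Or.inr three)).add t5) |>.add t6) (Or.inr (by simp))
  simp only [mul_zero, add_zero] at lim
  refine tendsto_of_tendsto_of_tendsto_of_le_of_le tendsto_const_nhds lim (fun n => zero_le)
    (fun n => ?_)
  refine iSup₂_le fun h hh => (lind n h hh).2.2.trans ?_
  have six : ∀ i : Fin n, (∫⁻ ω, ‖U n i ω‖ₑ ^ 6 ∂(P n)) ^ (1 / 2 : ℝ) ≤
      ENNReal.ofReal ((2 * C ^ 2) ^ (3 / 2 : ℝ)) *
        ENNReal.ofReal ((k n : ℝ) ^ (3 / 2 : ℝ)) := fun i => by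
    rw [← ENNReal.ofReal_mul_nat_pow_three_rpow (by positivity)]
    exact ENNReal.rpow_le_rpow ((hm n).lintegral_enorm_pow_six_le (hk n) i) (by norm_num)
  refine (Finset.sum_le_sum fun i _ => mul_le_mul' (lambdaTwo_le_of_mem_testClass hh _)
    (six i)).trans (le_of_eq ?_)
  simp only [Finset.sum_const, Finset.card_univ, Fintype.card_fin, nsmul_eq_mul]
  rw [ENNReal.ofReal_mul (by positivity), ENNReal.ofReal_natCast]
  ring

variable (hk : ∀ n, 0 < k n) (hm : ∀ n, GaussianMatch (P n) (U n) (Z n) C)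
  {lam : ℝ} (hlam : 0 < lam)
  (hgrowth : (fun n : ℕ => ((b n : ℝ) + (d n : ℝ)) ^ (3 / 2 : ℝ) * (k n : ℝ) ^ (1 / 2 : ℝ))
    =o[atTop] (fun n : ℕ => (n : ℝ)))
  {H : ℕ → Type*} [∀ n, NormedAddCommGroup (H n)] [∀ n, NormedSpace ℝ (H n)]
  {K : ℝ} {Q : ∀ n, EuclideanSpace ℝ (Fin (d n) × Fin (b n)) → H n}
  (hQ : ∀ n, IsQuadraticBounded (Q n) K)

include hk hm hlam hQ in
-- The constant depends on λ, K and C only, so the quadratic functions may vary freely with n within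
-- the bound K.
theorem alpha_ridge_le (n : ℕ) {r : ℕ} (hr : r ≤ 3) {m : ℝ≥0∞} (hm' : m ≤ 6) :
    alpha (P n) (fun x => Q n (ridgeVec lam x)) (U n) (Z n) r m ≤
      ENNReal.ofReal (ridgeConst lam K * (2 * (1 + 2 * (C * (1 + gaussConst)) ^ 2) ^ 4) *
        derivRate n (k n) (d n + b n) r) := by
  have := alpha_quadratic_ridge_le (hQ n) (hk n) hlam ((hm n).blockMoments_data (hk n))
    ((hm n).blockMoments_gaussian (hk n)) hr hm'
  exact_mod_cast this

include hk hm hlam hQ hgrowth in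
theorem smoothnessCondition_ridge : SmoothnessCondition k
    (fun n => alpha (P n) (fun x => Q n (ridgeVec lam x)) (U n) (Z n)) :=
  smoothnessCondition_of_le (d := d) (b := b) hk hgrowth
    fun n _ hr _ hm' => alpha_ridge_le hk hm hlam hQ n hr hm'

include hk hm hlam hgrowth in
theorem distH_ridge_tendsto_zero {Q : ∀ n, EuclideanSpace ℝ (Fin (d n) × Fin (b n)) → ℝ}
    (hQ : ∀ n, IsQuadraticBounded (Q n) K) :
    DistHTendstoZero P (fun n ω => Q n (ridgeVec lam (fun i => U n i ω)))
      (fun n ω => Q n (ridgeVec lam (fun i => Z n i ω))) :=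
  distH_tendsto_zero hk hm (f := fun n x => Q n (ridgeVec lam x))
    (fun n => (hQ n).contDiff_ridge (hk n) hlam)
    (fun n r hr => ne_top_of_le_ne_top ENNReal.ofReal_ne_top
      (alpha_ridge_le hk hm hlam hQ n (by omega) le_rfl))
    (smoothnessCondition_ridge hk hm hlam hgrowth hQ)

end Convergence

/-! ### Duality for the Frobenius norm. -/

section Frobenius

variable {ι : Type*} [Fintype ι]

/-- The entries of a matrix as a Euclidean vector. -/
def flattenMatrix (A : Matrix ι ι ℝ) : EuclideanSpace ℝ (ι × ι) :=
  WithLp.toLp 2 (fun p => A p.1 p.2)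

theorem frob_eq_norm (A : Matrix ι ι ℝ) : frob A = ‖flattenMatrix A‖ := by
  rw [EuclideanSpace.norm_eq, frob, Fintype.sum_prod_type]
  simp [flattenMatrix]

theorem frob_nonneg (A : Matrix ι ι ℝ) : 0 ≤ frob A := Real.sqrt_nonneg _

theorem frob_add_le (A B : Matrix ι ι ℝ) : frob (A + B) ≤ frob A + frob B := by
  simp only [frob_eq_norm]
  exact norm_add_le (flattenMatrix A) (flattenMatrix B)

theorem frob_vecMulVec (x y : EuclideanSpace ℝ ι) :
    frob (Matrix.vecMulVec x y) = ‖x‖ * ‖y‖ := by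
  rw [frob, EuclideanSpace.norm_eq, EuclideanSpace.norm_eq,
    ← Real.sqrt_mul (Finset.sum_nonneg fun _ _ => sq_nonneg _), Finset.sum_mul_sum]
  simp [Matrix.vecMulVec_apply, mul_pow]

/-- The bilinear form with matrix `T`. -/
noncomputable def matrixForm (T : Matrix ι ι ℝ) :
    EuclideanSpace ℝ ι →L[ℝ] EuclideanSpace ℝ ι →L[ℝ] ℝ :=
  LinearMap.mkContinuous₂ (LinearMap.mk₂ ℝ (fun x y => ∑ a, ∑ a', T a a' * (x a * y a'))
    (fun x x' y => by
      simp only [← Finset.sum_add_distrib]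
      refine Finset.sum_congr rfl fun a _ => Finset.sum_congr rfl fun a' _ => ?_
      simp only [PiLp.add_apply]; ring)
    (fun c x y => by
      simp only [smul_eq_mul, Finset.mul_sum]
      refine Finset.sum_congr rfl fun a _ => Finset.sum_congr rfl fun a' _ => ?_
      simp only [PiLp.smul_apply, smul_eq_mul]; ring)
    (fun x y y' => by
      simp only [← Finset.sum_add_distrib]
      refine Finset.sum_congr rfl fun a _ => Finset.sum_congr rfl fun a' _ => ?_
      simp only [PiLp.add_apply]; ring)
    (fun c x y => by
      simp only [smul_eq_mul, Finset.mul_sum]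
      refine Finset.sum_congr rfl fun a _ => Finset.sum_congr rfl fun a' _ => ?_
      simp only [PiLp.smul_apply, smul_eq_mul]; ring)) (frob T) (fun x y => by
    rw [LinearMap.mk₂_apply, mul_assoc, ← frob_vecMulVec, frob, frob, Real.norm_eq_abs]
    have h1 := Real.sum_mul_le_sqrt_mul_sqrt Finset.univ (fun p : ι × ι => T p.1 p.2)
      (fun p => Matrix.vecMulVec x y p.1 p.2)
    have h2 := Real.sum_mul_le_sqrt_mul_sqrt Finset.univ (fun p : ι × ι => T p.1 p.2)
      (fun p => -Matrix.vecMulVec x y p.1 p.2)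
    simp only [neg_sq, mul_neg, Finset.sum_neg_distrib, Fintype.sum_prod_type] at h1 h2
    simp only [Matrix.vecMulVec_apply] at h1 h2 ⊢
    exact abs_le.2 ⟨by linarith, h1⟩)

theorem matrixForm_apply (T : Matrix ι ι ℝ) (x y : EuclideanSpace ℝ ι) :
    matrixForm T x y = ∑ a, ∑ a', T a a' * (x a * y a') := rfl

theorem norm_matrixForm_le (T : Matrix ι ι ℝ) : ‖matrixForm T‖ ≤ frob T :=
  LinearMap.mkContinuous₂_norm_le _ (frob_nonneg T) _

/-- The witness is A divided by its norm; for A = 0 the convention 0⁻¹ = 0 gives T = 0. -/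
theorem exists_unit_matrix (A : Matrix ι ι ℝ) :
    ∃ T : Matrix ι ι ℝ, frob T ≤ 1 ∧ frob A = ∑ a, ∑ a', T a a' * A a a' := by
  refine ⟨(frob A)⁻¹ • A, ?_, ?_⟩
  · rw [frob_eq_norm, frob_eq_norm]
    have : flattenMatrix (‖flattenMatrix A‖⁻¹ • A) = ‖flattenMatrix A‖⁻¹ • flattenMatrix A := rfl
    rw [this, norm_smul, norm_inv, norm_norm]
    exact inv_mul_le_one
  · have h : frob A ^ 2 = ∑ a, ∑ a', A a a' ^ 2 := Real.sq_sqrt (by positivity)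
    have : ∑ a, ∑ a', ((frob A)⁻¹ • A) a a' * A a a' = (frob A)⁻¹ * frob A ^ 2 := by
      rw [h, Finset.mul_sum]
      refine Finset.sum_congr rfl fun a _ => ?_
      rw [Finset.mul_sum]
      refine Finset.sum_congr rfl fun a' _ => ?_
      simp only [Matrix.smul_apply, smul_eq_mul]; ring
    rw [this, sq, ← mul_assoc]
    rcases eq_or_ne (frob A) 0 with h0 | h0
    · simp [h0]
    · rw [inv_mul_cancel₀ h0, one_mul]

end Frobenius

/-! ### Differences of covariance matrices through scalar test functionals. -/

section CovarianceDifference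

variable {ι Ω : Type*} [Fintype ι] [MeasurableSpace Ω] {P : Measure Ω} [IsProbabilityMeasure P]

omit [IsProbabilityMeasure P] in
theorem memLp_euclidean_coord {B : Ω → EuclideanSpace ℝ ι} (hB : MemLp B 2 P) (a : ι) :
    MemLp (fun ω => B ω a) 2 P :=
  ((EuclideanSpace.proj a : EuclideanSpace ℝ ι →L[ℝ] ℝ).comp_memLp' hB)

theorem covMat_eq {B : Ω → EuclideanSpace ℝ ι} (hB : MemLp B 2 P) :
    covMat P B = Matrix.of (fun a a' => ∫ ω, B ω a * B ω a' ∂P) -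
      Matrix.vecMulVec (WithLp.ofLp (∫ ω, B ω ∂P)) (WithLp.ofLp (∫ ω, B ω ∂P)) := by
  have hi := hB.integrable (by norm_num)
  have hm : ∀ a, (∫ ω, B ω ∂P) a = ∫ ω, B ω a ∂P := fun a =>
    ((EuclideanSpace.proj a : EuclideanSpace ℝ ι →L[ℝ] ℝ).integral_comp_comm hi).symm
  ext a a'
  rw [covMat, covariance_eq_sub (memLp_euclidean_coord hB a) (memLp_euclidean_coord hB a')]
  rw [Matrix.sub_apply, Matrix.vecMulVec_apply, hm, hm]
  rfl

/-- The difference of two covariance matrices, in terms of expectations of linear and quadratic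
functions of the random vectors. -/
theorem exists_frob_covMat_sub_le {B B' : Ω → EuclideanSpace ℝ ι} (hB : MemLp B 2 P)
    (hB' : MemLp B' 2 P) :
    ∃ (T : Matrix ι ι ℝ) (u : EuclideanSpace ℝ ι), frob T ≤ 1 ∧ ‖u‖ ≤ 1 ∧
      frob (covMat P B - covMat P B') ≤
        (∫ ω, matrixForm T (B ω) (B ω) ∂P - ∫ ω, matrixForm T (B' ω) (B' ω) ∂P) +
        (∫ ω, innerSL ℝ u (B ω) ∂P - ∫ ω, innerSL ℝ u (B' ω) ∂P) *
          (‖∫ ω, B ω ∂P‖ + ‖∫ ω, B' ω ∂P‖) := by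
  set M : Matrix ι ι ℝ := fun a a' => ∫ ω, B ω a * B ω a' ∂P with hM
  set M' : Matrix ι ι ℝ := fun a a' => ∫ ω, B' ω a * B' ω a' ∂P with hM'
  set m := ∫ ω, B ω ∂P
  set m' := ∫ ω, B' ω ∂P
  obtain ⟨T, hT1, hT⟩ := exists_unit_matrix (M - M')
  have form : ∀ {B : Ω → EuclideanSpace ℝ ι}, MemLp B 2 P → ∫ ω, matrixForm T (B ω) (B ω) ∂P =
      ∑ a, ∑ a', T a a' * ∫ ω, B ω a * B ω a' ∂P := by
    intro B hB
    simp only [matrixForm_apply]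
    have hij : ∀ a a', Integrable (fun ω => T a a' * (B ω a * B ω a')) P := fun a a' =>
      ((memLp_euclidean_coord hB a).integrable_mul (memLp_euclidean_coord hB a')).const_mul _
    rw [integral_finsetSum _ fun a _ => integrable_finsetSum _ fun a' _ => hij a a']
    refine Finset.sum_congr rfl fun a _ => ?_
    rw [integral_finsetSum _ fun a' _ => hij a a']
    exact Finset.sum_congr rfl fun a' _ => integral_const_mul _ _
  -- u is the direction of the difference of means, so that its pairing with m - m' is the norm; it
  -- is 0 if the means agree.
  refine ⟨T, ‖m - m'‖⁻¹ • (m - m'), hT1, ?_, ?_⟩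
  · rw [norm_smul, norm_inv, norm_norm]
    exact inv_mul_le_one
  have lin : ∀ (u : EuclideanSpace ℝ ι) {B : Ω → EuclideanSpace ℝ ι}, MemLp B 2 P →
      ∫ ω, innerSL ℝ u (B ω) ∂P = innerSL ℝ u (∫ ω, B ω ∂P) := fun u B hB =>
    (innerSL ℝ u).integral_comp_comm (hB.integrable (by norm_num))
  rw [lin _ hB, lin _ hB', ← map_sub, form hB, form hB']
  have e1 : innerSL ℝ (‖m - m'‖⁻¹ • (m - m')) (m - m') = ‖m - m'‖ := by
    rw [innerSL_apply_apply, real_inner_smul_left, real_inner_self_eq_norm_sq]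
    rcases eq_or_ne ‖m - m'‖ 0 with h0 | h0
    · simp [h0]
    · field_simp
  have e2 : frob (M - M') = ∑ a, ∑ a', T a a' * M a a' - ∑ a, ∑ a', T a a' * M' a a' := by
    rw [hT, ← Finset.sum_sub_distrib]
    refine Finset.sum_congr rfl fun a _ => ?_
    rw [← Finset.sum_sub_distrib]
    refine Finset.sum_congr rfl fun a' _ => ?_
    rw [Matrix.sub_apply]; ring
  rw [e1]
  change _ ≤ (∑ a, ∑ a', T a a' * M a a' - ∑ a, ∑ a', T a a' * M' a a') +
    ‖m - m'‖ * (‖m‖ + ‖m'‖)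
  rw [← e2, covMat_eq hB, covMat_eq hB']
  -- m'm'ᵀ - mmᵀ = (m' - m)mᵀ + m'(m' - m)ᵀ, which isolates the difference of the means.
  have split : (M - Matrix.vecMulVec m m) - (M' - Matrix.vecMulVec m' m') =
      (M - M') + (Matrix.vecMulVec (m' - m : EuclideanSpace ℝ ι) m +
        Matrix.vecMulVec m' (m' - m : EuclideanSpace ℝ ι)) := by
    ext a a'
    simp only [Matrix.sub_apply, Matrix.add_apply, Matrix.vecMulVec_apply, PiLp.sub_apply]
    ring
  change frob ((M - Matrix.vecMulVec m m) - (M' - Matrix.vecMulVec m' m')) ≤ _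
  rw [split]
  refine (frob_add_le _ _).trans (add_le_add_right ((frob_add_le _ _).trans (le_of_eq ?_)) _)
  rw [frob_vecMulVec, frob_vecMulVec, norm_sub_rev m' m]
  ring

end CovarianceDifference

/-! ### Convergence of the variance of the ridge estimator. -/

section RidgeVariance

variable {k d b : ℕ → ℕ} {Ω : ℕ → Type*} [∀ n, MeasurableSpace (Ω n)] {P : ∀ n, Measure (Ω n)}
  [∀ n, IsProbabilityMeasure (P n)] {U Z : ∀ n, Fin n → Ω n → Block (k n) (d n) (b n)} {C : ℝ}

theorem isQuadraticBounded_clm {V H : Type*} [NormedAddCommGroup V] [NormedSpace ℝ V]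
    [NormedAddCommGroup H] [NormedSpace ℝ H] (l : V →L[ℝ] H) (hl : ‖l‖ ≤ 1) :
    IsQuadraticBounded (fun B => l B) 1 :=
  ⟨0, l, 0, by simp, hl, (le_of_eq ContinuousLinearMap.opNorm_zero).trans zero_le_one, by simp⟩

theorem isQuadraticBounded_matrixForm {ι : Type*} [Fintype ι] (T : Matrix ι ι ℝ)
    (hT : frob T ≤ 1) : IsQuadraticBounded (fun B => matrixForm T B B) 1 :=
  ⟨0, 0, matrixForm T, by simp, by simp, (norm_matrixForm_le T).trans hT, by simp⟩

theorem id_mem_testClass : (fun y : ℝ => y) ∈ testClass := by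
  have d1 : iteratedDeriv 1 (fun y : ℝ => y) = fun _ => 1 := by
    rw [iteratedDeriv_one]; exact deriv_id'
  have d2 : iteratedDeriv 2 (fun y : ℝ => y) = fun _ => 0 := by
    rw [iteratedDeriv_succ, d1]; exact deriv_const' _
  have d3 : iteratedDeriv 3 (fun y : ℝ => y) = fun _ => 0 := by
    rw [iteratedDeriv_succ, d2]; exact deriv_const' _
  refine ⟨fun r hr => ?_, ?_, ?_, ?_⟩
  · interval_cases r
    · rw [iteratedDeriv_zero]; exact differentiable_id
    · rw [d1]; exact differentiable_const _
    · rw [d2]; exact differentiable_const _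
  · simp [eta, d1]
  · simp [eta, d2]
  · simp [gammaThree, d3]

variable (hk : ∀ n, 0 < k n) (hm : ∀ n, GaussianMatch (P n) (U n) (Z n) C)
  {lam : ℝ} (hlam : 0 < lam)
  (hgrowth : (fun n : ℕ => ((b n : ℝ) + (d n : ℝ)) ^ (3 / 2 : ℝ) * (k n : ℝ) ^ (1 / 2 : ℝ))
    =o[atTop] (fun n : ℕ => (n : ℝ)))

include hk hm hlam hgrowth in
-- The identity belongs to ℋ, so closeness in d_ℋ includes closeness of expectations.
theorem tendsto_integral_ridge_sub {K : ℝ}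
    {Q : ∀ n, EuclideanSpace ℝ (Fin (d n) × Fin (b n)) → ℝ}
    (hQ : ∀ n, IsQuadraticBounded (Q n) K) :
    Tendsto (fun n => (∫ ω, Q n (ridgeVec lam (fun i => U n i ω)) ∂(P n)) -
      ∫ ω, Q n (ridgeVec lam (fun i => Z n i ω)) ∂(P n)) atTop (𝓝 0) := by
  have h := (distH_ridge_tendsto_zero hk hm hlam hgrowth hQ).2
  rw [tendsto_zero_iff_abs_tendsto_zero]
  have h2 : Tendsto (fun n => ENNReal.ofReal |(∫ ω, Q n (ridgeVec lam (fun i => U n i ω)) ∂(P n)) -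
      ∫ ω, Q n (ridgeVec lam (fun i => Z n i ω)) ∂(P n)|) atTop (𝓝 0) :=
    tendsto_of_tendsto_of_tendsto_of_le_of_le tendsto_const_nhds h (fun _ => zero_le)
      (fun n => le_iSup₂_of_le (fun y : ℝ => y) id_mem_testClass le_rfl)
  have h3 := (ENNReal.tendsto_toReal ENNReal.zero_ne_top).comp h2
  simpa [Function.comp_def] using h3

theorem isQuadraticBounded_id {V : Type*} [NormedAddCommGroup V] [NormedSpace ℝ V] :
    IsQuadraticBounded (fun B : V => B) 1 :=
  isQuadraticBounded_clm (ContinuousLinearMap.id ℝ V) ContinuousLinearMap.norm_id_le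

include hk hm hlam in
theorem memLp_ridgeVec (n : ℕ) :
    MemLp (fun ω => ridgeVec lam (fun i => U n i ω)) 2 (P n) ∧
      MemLp (fun ω => ridgeVec lam (fun i => Z n i ω)) 2 (P n) := by
  rcases Nat.eq_zero_or_pos n with rfl | hn
  · have : ∀ v : Fin 0 → Block (k 0) (d 0) (b 0), v = 0 := fun v => Subsingleton.elim _ _
    simp only [this (fun i => _)]
    exact ⟨memLp_const _, memLp_const _⟩
  have hc : Continuous (ridgeVec lam : (Fin n → Block (k n) (d n) (b n)) → _) :=
    (contDiff_ridgeVec (m := 0) (hk n) hlam).continuous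
  have hU := (hm n).aemeasurable
  have hZ : ∀ i, AEMeasurable (Z n i) (P n) := fun i => ((hm n).gaussian i).aemeasurable
  have ha : alpha (P n) (ridgeVec lam) (U n) (Z n) 0 2 ≠ ∞ :=
    ne_top_of_le_ne_top ENNReal.ofReal_ne_top
      (alpha_ridge_le hk hm hlam (fun n => isQuadraticBounded_id) n (by norm_num)
        (by norm_num))
  obtain ⟨h1, h2⟩ := eLpNorm_comp_le_alpha (P := P n) hn (ridgeVec lam) (U n) (Z n) 2
  exact ⟨⟨(hc.measurable.comp_aemeasurable (f := fun ω i => U n i ω)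
      (by fun_prop)).aestronglyMeasurable, h1.trans_lt ha.lt_top⟩,
    ⟨(hc.measurable.comp_aemeasurable (f := fun ω i => Z n i ω)
      (by fun_prop)).aestronglyMeasurable, h2.trans_lt ha.lt_top⟩⟩

include hk hm hlam in
-- The means multiply a difference tending to zero, so they must stay bounded. Their norms are at
-- most the L₁ norm of B̂, controlled by α⁰₁.
theorem exists_norm_integral_ridgeVec_le : ∃ K : ℝ, ∀ n, 0 < n →
    ‖∫ ω, ridgeVec lam (fun i => U n i ω) ∂(P n)‖ ≤ K ∧
      ‖∫ ω, ridgeVec lam (fun i => Z n i ω) ∂(P n)‖ ≤ K := by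
  refine ⟨ridgeConst lam 1 * (2 * (1 + 2 * (C * (1 + gaussConst)) ^ 2) ^ 4), fun n hn => ?_⟩
  have h0 : 0 ≤ ridgeConst lam 1 * (2 * (1 + 2 * (C * (1 + gaussConst)) ^ 2) ^ 4) :=
    mul_nonneg (ridgeConst_nonneg hlam zero_le_one) (by positivity)
  have ha := alpha_ridge_le hk hm hlam (Q := fun n B => B) (fun n => isQuadraticBounded_id) n
    (r := 0) (by norm_num) (m := 1) (by norm_num)
  rw [derivRate, mul_one] at ha
  obtain ⟨h1, h2⟩ := eLpNorm_comp_le_alpha (P := P n) hn (ridgeVec lam) (U n) (Z n) 1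
  have key : ∀ {B : Ω n → EuclideanSpace ℝ (Fin (d n) × Fin (b n))},
      eLpNorm B 1 (P n) ≤ alpha (P n) (ridgeVec lam) (U n) (Z n) 0 1 →
      ‖∫ ω, B ω ∂(P n)‖ ≤ ridgeConst lam 1 * (2 * (1 + 2 * (C * (1 + gaussConst)) ^ 2) ^ 4) := by
    intro B hB
    rw [← ENNReal.ofReal_le_ofReal_iff h0, ofReal_norm]
    refine (enorm_integral_le_lintegral_enorm _).trans ?_
    rw [← eLpNorm_one_eq_lintegral_enorm]
    exact hB.trans ha
  exact ⟨key h1, key h2⟩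

include hk hm hlam hgrowth in
-- The dual matrix and vector depend on n through the laws, but have norm at most 1, so
-- `tendsto_integral_ridge_sub` applies to the forms they define.
theorem tendsto_frob_covMat_ridgeVec_sub :
    Tendsto (fun n => frob (covMat (P n) (fun ω => ridgeVec lam (fun i => U n i ω)) -
      covMat (P n) (fun ω => ridgeVec lam (fun i => Z n i ω)))) atTop (𝓝 0) := by
  obtain ⟨K, hK⟩ := exists_norm_integral_ridgeVec_le hk hm hlam
  choose T u hT hu hle using fun n => exists_frob_covMat_sub_le
    (memLp_ridgeVec hk hm hlam n).1 (memLp_ridgeVec hk hm hlam n).2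
  have l1 := tendsto_integral_ridge_sub hk hm hlam hgrowth
    (Q := fun n B => matrixForm (T n) B B) (fun n => isQuadraticBounded_matrixForm _ (hT n))
  have l2 := tendsto_integral_ridge_sub hk hm hlam hgrowth
    (Q := fun n B => innerSL ℝ (u n) B) (fun n => isQuadraticBounded_clm _
      (by rw [innerSL_apply_norm]; exact hu n))
  have l3 := l1.add ((l2.abs).mul_const (K + K))
  rw [abs_zero, zero_mul, add_zero] at l3
  refine tendsto_of_tendsto_of_tendsto_of_le_of_le' tendsto_const_nhds l3
    (Eventually.of_forall fun n => frob_nonneg _) ?_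
  filter_upwards [eventually_gt_atTop 0] with n hn
  refine (hle n).trans (add_le_add_right ?_ _)
  exact mul_le_mul (le_abs_self _) (add_le_add (hK n hn).1 (hK n hn).2) (by positivity)
    (abs_nonneg _)

end RidgeVariance

/-! ### The risk is a quadratic function of the estimator. -/

section RiskQuadratic

variable {d b : ℕ}

/-- The bilinear form `(x, y) ↦ ⟨M x, y⟩`. -/
noncomputable def operatorForm {V : Type*} [NormedAddCommGroup V] [InnerProductSpace ℝ V]
    (M : V →L[ℝ] V) : V →L[ℝ] V →L[ℝ] ℝ :=
  LinearMap.mkContinuous₂ (LinearMap.mk₂ ℝ (fun x y => inner ℝ (M x) y)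
    (fun x x' y => by rw [map_add, inner_add_left])
    (fun c x y => by rw [map_smul, real_inner_smul_left, smul_eq_mul])
    (fun x y y' => inner_add_right _ _ _)
    (fun c x y => real_inner_smul_right _ _ _)) ‖M‖ (fun x y => by
      refine (norm_inner_le_norm (M x) y).trans ?_
      exact mul_le_mul_of_nonneg_right (M.le_opNorm x) (norm_nonneg y))

theorem norm_operatorForm_le {V : Type*} [NormedAddCommGroup V] [InnerProductSpace ℝ V]
    (M : V →L[ℝ] V) : ‖operatorForm M‖ ≤ ‖M‖ :=
  LinearMap.mkContinuous₂_norm_le _ (norm_nonneg M) _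

/-- The risk of the flattened `d × b` matrix `B`. -/
noncomputable def flatRisk (ν : Measure (Vec d × Vec b)) (B : EuclideanSpace ℝ (Fin d × Fin b)) :
    ℝ :=
  risk ν (Matrix.of fun l s => B (l, s))

theorem sum_sq_residual_eq (v : Vec d) (y : Vec b) (B : EuclideanSpace ℝ (Fin d × Fin b)) :
    ∑ s, (y s - ((Matrix.of fun l s => B (l, s)).transpose.mulVec (fun l => v l)) s) ^ 2 =
      ‖y‖ ^ 2 - 2 * inner ℝ (outerVecL v y) B + inner ℝ (rankOneOp v v B) B := by
  rw [EuclideanSpace.real_norm_sq_eq, outerVecL_apply, rankOneOp_apply, PiLp.inner_apply,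
    PiLp.inner_apply, Fintype.sum_prod_type_right, Fintype.sum_prod_type_right, Finset.mul_sum,
    ← Finset.sum_sub_distrib, ← Finset.sum_add_distrib]
  refine Finset.sum_congr rfl fun s _ => ?_
  simp only [outerVec, rankOneApply, RCLike.inner_apply, conj_trivial, Matrix.mulVec, dotProduct,
    Matrix.transpose_apply, Matrix.of_apply]
  set t := ∑ l, B (l, s) * v l with ht
  have h1 : ∑ l, v l * B (l, s) = t := Finset.sum_congr rfl fun l _ => mul_comm _ _
  have h2 : ∑ l, B (l, s) * (v l * y s) = t * y s := by
    rw [ht, Finset.sum_mul]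
    exact Finset.sum_congr rfl fun l _ => by ring
  have h3 : ∑ l, B (l, s) * (v l * t) = t * t := by
    conv_rhs => rw [ht, Finset.sum_mul]
    exact Finset.sum_congr rfl fun l _ => by ring
  rw [h1, h2, h3]
  ring

/-- The coefficients are 𝔼‖Y‖², -2 𝔼[VYᵀ] and 𝔼[VVᵀ], all controlled by second moments. The largest
bound is that of the linear term: 2‖𝔼[VYᵀ]‖ ≤ 𝔼‖V‖² + 𝔼‖Y‖² ≤ 2C². -/
theorem isQuadraticBounded_flatRisk {ν : Measure (Vec d × Vec b)} [IsProbabilityMeasure ν] {C : ℝ}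
    (hV : eLpNorm (fun p : Vec d × Vec b => p.1) 2 ν ≤ ENNReal.ofReal C)
    (hY : eLpNorm (fun p : Vec d × Vec b => p.2) 2 ν ≤ ENNReal.ofReal C) :
    IsQuadraticBounded (flatRisk ν) (2 * C ^ 2) := by
  have mV : MemLp (fun p : Vec d × Vec b => p.1) 2 ν :=
    ⟨continuous_fst.aestronglyMeasurable, hV.trans_lt ENNReal.ofReal_lt_top⟩
  have mY : MemLp (fun p : Vec d × Vec b => p.2) 2 ν :=
    ⟨continuous_snd.aestronglyMeasurable, hY.trans_lt ENNReal.ofReal_lt_top⟩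
  have sq : ∀ {m : ℕ} {g : Vec d × Vec b → Vec m}, MemLp g 2 ν →
      eLpNorm g 2 ν ≤ ENNReal.ofReal C →
      Integrable (fun p => ‖g p‖ ^ 2) ν ∧ ∫ p, ‖g p‖ ^ 2 ∂ν ≤ C ^ 2 := by
    intro m g hg hgC
    have hi : Integrable (fun p => ‖g p‖ ^ 2) ν := (memLp_two_iff_integrable_sq_norm hg.1).1 hg
    refine ⟨hi, ?_⟩
    have h1 : ENNReal.ofReal (∫ p, ‖g p‖ ^ 2 ∂ν) = eLpNorm g 2 ν ^ 2 := by
      have := eLpNorm_nnreal_pow_eq_lintegral (μ := ν) (f := g) (p := 2) (by norm_num)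
      rw [ofReal_integral_eq_lintegral_ofReal hi (ae_of_all _ fun p => sq_nonneg _)]
      simp only [ENNReal.coe_ofNat, NNReal.coe_ofNat, ENNReal.rpow_ofNat] at this
      rw [this]
      refine lintegral_congr fun p => ?_
      rw [ENNReal.ofReal_pow (norm_nonneg _), ofReal_norm]
    have h2 : ENNReal.ofReal (∫ p, ‖g p‖ ^ 2 ∂ν) ≤ ENNReal.ofReal (C ^ 2) := by
      rw [h1, ← sq_abs, ENNReal.ofReal_pow (abs_nonneg C)]
      exact pow_le_pow_left₀ zero_le (hgC.trans (ENNReal.ofReal_le_ofReal (le_abs_self C))) 2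
    exact (ENNReal.ofReal_le_ofReal_iff (sq_nonneg C)).1 h2
  obtain ⟨iV, bV⟩ := sq mV hV
  obtain ⟨iY, bY⟩ := sq mY hY
  have bo : ∀ p : Vec d × Vec b, ‖outerVecL p.1 p.2‖ ≤ (‖p.1‖ ^ 2 + ‖p.2‖ ^ 2) / 2 := fun p => by
    have := norm_outerVec_le p.1 p.2
    rw [outerVecL_apply]
    nlinarith [sq_nonneg (‖p.1‖ - ‖p.2‖)]
  have br : ∀ p : Vec d × Vec b, ‖(rankOneOp p.1 p.1 :
      EuclideanSpace ℝ (Fin d × Fin b) →L[ℝ] _)‖ ≤ ‖p.1‖ ^ 2 := fun p => by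
    rw [pow_two]; exact norm_rankOneOp_le p.1 p.1
  have io : Integrable (fun p : Vec d × Vec b => outerVecL p.1 p.2) ν :=
    ((iV.add iY).div_const 2).mono' (by fun_prop) (ae_of_all _ bo)
  have ir : Integrable (fun p : Vec d × Vec b => (rankOneOp p.1 p.1 :
      EuclideanSpace ℝ (Fin d × Fin b) →L[ℝ] EuclideanSpace ℝ (Fin d × Fin b))) ν :=
    iV.mono' (Continuous.aestronglyMeasurable (by fun_prop)) (ae_of_all _ br)
  set w := ∫ p : Vec d × Vec b, outerVecL p.1 p.2 ∂ν with hw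
  set M := ∫ p : Vec d × Vec b, (rankOneOp p.1 p.1 :
      EuclideanSpace ℝ (Fin d × Fin b) →L[ℝ] EuclideanSpace ℝ (Fin d × Fin b)) ∂ν with hM
  refine ⟨∫ p, ‖p.2‖ ^ 2 ∂ν, (-2 : ℝ) • innerSL ℝ w, operatorForm M, ?_, ?_, ?_, fun B => ?_⟩
  · rw [Real.norm_of_nonneg (integral_nonneg fun _ => sq_nonneg _)]
    linarith [sq_nonneg C]
  · rw [norm_smul, innerSL_apply_norm]
    have h1 : ‖w‖ ≤ ∫ p : Vec d × Vec b, (‖p.1‖ ^ 2 + ‖p.2‖ ^ 2) / 2 ∂ν :=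
      norm_integral_le_of_norm_le ((iV.add iY).div_const 2) (ae_of_all _ bo)
    rw [integral_div, integral_add iV iY] at h1
    norm_num
    linarith
  · refine (norm_operatorForm_le M).trans ?_
    have h1 : ‖M‖ ≤ ∫ p : Vec d × Vec b, ‖p.1‖ ^ 2 ∂ν :=
      norm_integral_le_of_norm_le iV (ae_of_all _ br)
    linarith [sq_nonneg C]
  · have e1 : innerSL ℝ w B = ∫ p : Vec d × Vec b, inner ℝ (outerVecL p.1 p.2) B ∂ν := by
      rw [innerSL_apply_apply, hw, real_inner_comm, ← integral_inner io]
      exact integral_congr_ae (ae_of_all _ fun p => real_inner_comm _ _)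
    have ioB : Integrable (fun p : Vec d × Vec b => inner ℝ (outerVecL p.1 p.2) B) ν :=
      io.inner_const B
    have irB' : Integrable (fun p : Vec d × Vec b => rankOneOp p.1 p.1 B) ν :=
      ir.apply_continuousLinearMap B
    have irB : Integrable (fun p : Vec d × Vec b => inner ℝ (rankOneOp p.1 p.1 B) B) ν :=
      irB'.inner_const B
    have e2 : operatorForm M B B = ∫ p : Vec d × Vec b, inner ℝ (rankOneOp p.1 p.1 B) B ∂ν := by
      have h0 : M B = ∫ p : Vec d × Vec b, rankOneOp p.1 p.1 B ∂ν :=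
        ContinuousLinearMap.integral_apply ir B
      change inner ℝ (M B) B = _
      rw [h0, real_inner_comm, ← integral_inner irB']
      exact integral_congr_ae (ae_of_all _ fun p => real_inner_comm _ _)
    rw [flatRisk, risk]
    simp only [sum_sq_residual_eq]
    have i2 : Integrable (fun p : Vec d × Vec b => 2 * inner ℝ (outerVecL p.1 p.2) B) ν :=
      ioB.const_mul 2
    rw [integral_add (f := fun p : Vec d × Vec b => ‖p.2‖ ^ 2 - 2 * inner ℝ (outerVecL p.1 p.2) B)
      (iY.sub i2) irB, integral_sub iY i2, integral_const_mul, ← e1, ← e2,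
      _root_.smul_apply, smul_eq_mul]
    ring

theorem ridgeRisk_eq_flatRisk {n k : ℕ} (lam : ℝ) (ν : Measure (Vec d × Vec b)) :
    (ridgeRisk lam ν : (Fin n → Block k d b) → ℝ) = fun x => flatRisk ν (ridgeVec lam x) := rfl

end RiskQuadratic

/-! ### Data blocks and surrogates share their means and covariances. -/

section SampleLaw

variable {Ω Θ : Type*} [MeasurableSpace Ω] [MeasurableSpace Θ] {n k d b : ℕ} {P : Measure Ω}
  [IsProbabilityMeasure P] {μ : Measure (Vec d × Vec b)} [IsProbabilityMeasure μ] {ρ : Measure Θ}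
  [IsProbabilityMeasure ρ] {X : Fin n → Ω → Vec d × Vec b} {φ : Fin n → Fin k → Ω → Θ}

/-- Groups the transformations φ_ij, independent over pairs (i, j), into independent vectors
attached to the i-th data point. -/
theorem measurePreserving_curry {ι κ : Type*} [Fintype ι] [Fintype κ] :
    MeasurePreserving (MeasurableEquiv.curry ι κ Θ) (Measure.pi fun _ => ρ)
      (Measure.pi fun _ => Measure.pi fun _ => ρ) := by
  refine ⟨(MeasurableEquiv.curry ι κ Θ).measurable, ?_⟩
  have := Measure.infinitePi_map_curry (X := Θ) (fun (_ : ι) (_ : κ) => ρ)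
  simpa only [Measure.infinitePi_eq_pi] using this

namespace IsAugmentedSample

/-- The pairs `(X_i, (φ_{i1}, …, φ_{ik}))` are i.i.d. -/
theorem hasLaw_pairs (h : IsAugmentedSample P μ ρ X φ) :
    HasLaw (fun ω i => (X i ω, fun j => φ i j ω))
      (Measure.pi fun _ : Fin n => μ.prod (Measure.pi fun _ : Fin k => ρ)) P := by
  have h1 : HasLaw (fun ω i => X i ω) (Measure.pi fun _ => μ) P := h.indep_X.hasLaw_pi h.law_X
  have h2 : HasLaw (fun ω (p : Fin n × Fin k) => φ p.1 p.2 ω) (Measure.pi fun _ => ρ) P :=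
    h.indep_φ.hasLaw_pi fun p => h.law_φ p.1 p.2
  have h3 := measurePreserving_curry.comp_hasLaw h2
  have h4 := (indepFun_iff_hasLaw_prodMk_prod h1 h3).1 h.indep_X_φ
  exact (measurePreserving_arrowProdEquivProdArrow (Vec d × Vec b) (Fin k → Θ) (Fin n)
    (fun _ => μ) (fun _ => Measure.pi fun _ => ρ)).symm.comp_hasLaw h4

theorem hasLaw_pair (h : IsAugmentedSample P μ ρ X φ) (i : Fin n) :
    HasLaw (fun ω => (X i ω, fun j => φ i j ω)) (μ.prod (Measure.pi fun _ : Fin k => ρ)) P :=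
  (measurePreserving_eval (fun _ : Fin n => μ.prod (Measure.pi fun _ : Fin k => ρ)) i).comp_hasLaw
    h.hasLaw_pairs

theorem iIndepFun_pairs (h : IsAugmentedSample P μ ρ X φ) :
    iIndepFun (fun i ω => (X i ω, fun j => φ i j ω)) P :=
  (iIndepFun_iff_hasLaw_pi_pi fun i => h.hasLaw_pair i).2 h.hasLaw_pairs

theorem hasLaw_single (h : IsAugmentedSample P μ ρ X φ) (i : Fin n) (j : Fin k) :
    HasLaw (fun ω => (φ i j ω, X i ω)) (ρ.prod μ) P :=
  Measure.measurePreserving_swap.comp_hasLaw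
    (((MeasurePreserving.id μ).prod (measurePreserving_eval (fun _ : Fin k => ρ) j)).comp_hasLaw
      (h.hasLaw_pair i))

/-- Two different augmentations of one point have exactly the joint law defining `sigma12`; this
gives the off-diagonal blocks of the covariance. -/
theorem hasLaw_double (h : IsAugmentedSample P μ ρ X φ) (i : Fin n) {j j' : Fin k} (hj : j ≠ j') :
    HasLaw (fun ω => ((φ i j ω, φ i j' ω), X i ω)) ((ρ.prod ρ).prod μ) P := by
  have h1 : MeasurePreserving (fun t : Fin k → Θ => (t j, t j')) (Measure.pi fun _ => ρ)
      (ρ.prod ρ) := by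
    refine ⟨by fun_prop, ?_⟩
    have := Measure.infinitePi_map_eval_prod (P := fun _ : Fin k => ρ) hj
    simpa only [Measure.infinitePi_eq_pi] using this
  exact Measure.measurePreserving_swap.comp_hasLaw
    (((MeasurePreserving.id μ).prod h1).comp_hasLaw (h.hasLaw_pair i))

end IsAugmentedSample

theorem measurable_toPoint : Measurable (toPoint : Vec d × Vec b → Point d b) := by
  refine (WithLp.measurable_toLp 2 _).comp (measurable_pi_lambda _ fun a => ?_)
  rcases a with a | a <;> simp only [Sum.elim_inl, Sum.elim_inr] <;> fun_prop

variable {π : Θ → Vec d → Vec d} {τ : Θ → Vec b → Vec b}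

theorem measurable_augPoint (hπ : Measurable (Function.uncurry π))
    (hτ : Measurable (Function.uncurry τ)) :
    Measurable (fun p : Θ × (Vec d × Vec b) => augPoint π τ p.1 p.2) :=
  measurable_toPoint.comp ((hπ.comp (by fun_prop : Measurable
    (fun p : Θ × (Vec d × Vec b) => (p.1, p.2.1)))).prodMk (hτ.comp (by fun_prop : Measurable
    (fun p : Θ × (Vec d × Vec b) => (p.1, p.2.2)))))

theorem kronecker_covariance_apply {S₁₁ S₁₂ : Matrix (Fin d ⊕ Fin b) (Fin d ⊕ Fin b) ℝ}
    (j j' : Fin k) (a a' : Fin d ⊕ Fin b) :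
    ((1 : Matrix (Fin k) (Fin k) ℝ) ⊗ₖ S₁₁ + (Matrix.of (fun _ _ => (1 : ℝ)) - 1) ⊗ₖ S₁₂ :
      Matrix (Fin k × (Fin d ⊕ Fin b)) (Fin k × (Fin d ⊕ Fin b)) ℝ) (j, a) (j', a') =
    if j = j' then S₁₁ a a' else S₁₂ a a' := by
  simp only [Matrix.add_apply, Matrix.kroneckerMap_apply, Matrix.sub_apply, Matrix.of_apply,
    Matrix.one_apply]
  split_ifs <;> simp

omit [IsProbabilityMeasure P] in
-- The decay constant carries no sign, hence the absolute value.
theorem GaussianMatch.of_surrogate {U Z : Fin n → Ω → Block k d b} {m : Fin d ⊕ Fin b → ℝ}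
    {S₁₁ S₁₂ : Matrix (Fin d ⊕ Fin b) (Fin d ⊕ Fin b) ℝ} {C : ℝ}
    (hU : ∀ i, AEMeasurable (U i) P) (hind : iIndepFun U P) (hZ : IsGaussianSurrogate P U Z m S₁₁ S₁₂)
    (hm : ∀ i j a, ∫ ω, U i ω (j, a) ∂P = m a)
    (hcov : ∀ i j a j' a', cov[fun ω => U i ω (j, a), fun ω => U i ω (j', a'); P] =
      if j = j' then S₁₁ a a' else S₁₂ a a') (hC : CoordinateDecay P U C) :
    GaussianMatch P U Z |C| where
  aemeasurable := hU
  indep := hind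
  gaussian := hZ.gaussian
  indep_gaussian := hZ.indep
  indep_data := hZ.indep_data
  mean i p := by rw [← Prod.mk.eta (p := p), hZ.mean, hm]
  covariance i := by
    rw [hZ.covariance]
    ext ⟨j, a⟩ ⟨j', a'⟩
    rw [kronecker_covariance_apply, covMat, hcov]
  nonneg := abs_nonneg C
  decay i j := by
    filter_upwards [hC i j] with ω hω
    exact ⟨fun l => (hω.1 l).trans (mul_le_mul_of_nonneg_right (le_abs_self C) (by positivity)),
      fun l => (hω.2 l).trans (mul_le_mul_of_nonneg_right (le_abs_self C) (by positivity))⟩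

theorem gaussianMatch_augData (hπ : Measurable (Function.uncurry π))
    (hτ : Measurable (Function.uncurry τ)) (h : IsAugmentedSample P μ ρ X φ)
    {Z : Fin n → Ω → Block k d b} {C : ℝ}
    (hZ : IsGaussianSurrogate P (augData π τ X φ) Z (augMean μ ρ π τ) (sigma11 μ ρ π τ)
      (sigma12 μ ρ π τ)) (hC : CoordinateDecay P (augData π τ X φ) C) :
    GaussianMatch P (augData π τ X φ) Z |C| := by
  have ma := measurable_augPoint hπ hτ
  have mc : ∀ a, Measurable (fun p : Θ × (Vec d × Vec b) => augPoint π τ p.1 p.2 a) := fun a =>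
    (by fun_prop : Measurable (fun y : Point d b => y a)).comp ma
  have mG : Measurable (fun w : (Vec d × Vec b) × (Fin k → Θ) =>
      (WithLp.toLp 2 (fun p => augPoint π τ (w.2 p.1) w.1 p.2) : Block k d b)) := by
    refine (WithLp.measurable_toLp 2 _).comp (measurable_pi_lambda _ fun p => ?_)
    exact (mc p.2).comp (by fun_prop : Measurable
      (fun w : (Vec d × Vec b) × (Fin k → Θ) => (w.2 p.1, w.1)))
  refine GaussianMatch.of_surrogate (fun i => mG.comp_aemeasurable (h.hasLaw_pair i).aemeasurable)
    (h.iIndepFun_pairs.comp (fun _ => _) fun _ => mG) hZ (fun i j a => ?_)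
    (fun i j a j' a' => ?_) hC
  · exact (h.hasLaw_single i j).integral_comp (mc a).aestronglyMeasurable
  · split_ifs with hj
    · subst hj
      exact (h.hasLaw_single i j).covariance_fun_comp (mc a).aemeasurable (mc a').aemeasurable
    · exact (h.hasLaw_double i hj).covariance_fun_comp
        (f := fun p : (Θ × Θ) × (Vec d × Vec b) => augPoint π τ p.1.1 p.2 a)
        (g := fun p : (Θ × Θ) × (Vec d × Vec b) => augPoint π τ p.1.2 p.2 a')
        ((mc a).comp (by fun_prop : Measurable
          (fun p : (Θ × Θ) × (Vec d × Vec b) => (p.1.1, p.2)))).aemeasurable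
        ((mc a').comp (by fun_prop : Measurable
          (fun p : (Θ × Θ) × (Vec d × Vec b) => (p.1.2, p.2)))).aemeasurable

omit [IsProbabilityMeasure P] [IsProbabilityMeasure μ] [IsProbabilityMeasure ρ] in
-- Taking S₁₁ = S₁₂ = Var X₁ collapses the Kronecker expression to the all-ones matrix ⊗ Var X₁, the
-- covariance of identical copies.
theorem gaussianMatch_repData (h : IsAugmentedSample P μ ρ X φ) {Z : Fin n → Ω → Block k d b}
    {C : ℝ} (hZ : IsGaussianSurrogate P (repData k X) Z (fun a => ∫ x, toPoint x a ∂μ)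
      (covMat μ toPoint) (covMat μ toPoint)) (hC : CoordinateDecay P (repData k X) C) :
    GaussianMatch P (repData k X) Z |C| := by
  have mc : ∀ a, Measurable (fun x : Vec d × Vec b => toPoint x a) := fun a =>
    (by fun_prop : Measurable (fun y : Point d b => y a)).comp measurable_toPoint
  have mG : Measurable (fun x : Vec d × Vec b =>
      (WithLp.toLp 2 (fun p => toPoint x p.2) : Block k d b)) :=
    (WithLp.measurable_toLp 2 _).comp (measurable_pi_lambda _ fun p => mc p.2)
  refine GaussianMatch.of_surrogate (fun i => mG.comp_aemeasurable (h.law_X i).aemeasurable)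
    (h.indep_X.comp (fun _ => _) fun _ => mG) hZ (fun i j a => ?_)
    (fun i j a j' a' => ?_) hC
  · exact (h.law_X i).integral_comp (mc a).aestronglyMeasurable
  · rw [ite_self]
    exact (h.law_X i).covariance_fun_comp (mc a).aemeasurable (mc a').aemeasurable

omit [IsProbabilityMeasure P] [IsProbabilityMeasure μ] in
theorem lintegral_enorm_repData_pow_six (hX : ∀ i, HasLaw (X i) μ P) (i : Fin n) :
    ∫⁻ ω, ‖repData k X i ω‖ₑ ^ 6 ∂P = (k : ℝ≥0∞) ^ 3 * ∫⁻ x, ‖toPoint x‖ₑ ^ 6 ∂μ := by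
  have h1 : ∀ ω, ‖repData k X i ω‖ₑ ^ 6 = (k : ℝ≥0∞) ^ 3 * ‖toPoint (X i ω)‖ₑ ^ 6 := by
    intro ω
    have h2 : ‖repData k X i ω‖ ^ 2 = k * ‖toPoint (X i ω)‖ ^ 2 := by
      rw [EuclideanSpace.real_norm_sq_eq, EuclideanSpace.real_norm_sq_eq, Fintype.sum_prod_type]
      simp [repData, mul_add]
    rw [← ofReal_norm, ← ofReal_norm, ← ENNReal.ofReal_pow (norm_nonneg _),
      ← ENNReal.ofReal_pow (norm_nonneg _), ← ENNReal.ofReal_natCast,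
      ← ENNReal.ofReal_pow (by positivity), ← ENNReal.ofReal_mul (by positivity)]
    congr 1
    calc ‖repData k X i ω‖ ^ 6 = (‖repData k X i ω‖ ^ 2) ^ 3 := by ring
      _ = _ := by rw [h2]; ring
  have m6 : Measurable (fun x : Vec d × Vec b => ‖toPoint x‖ₑ ^ 6) :=
    (measurable_toPoint.enorm).pow_const 6
  simp only [h1]
  rw [lintegral_const_mul' _ _ (by simp), (hX i).lintegral_comp (f := fun x => ‖toPoint x‖ₑ ^ 6)
    m6.aemeasurable]

end SampleLaw

/-! ### The explicit bound without augmentation. -/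

section Unaugmented

variable {Ω Θ : Type*} [MeasurableSpace Ω] [MeasurableSpace Θ] {n k d b : ℕ} {P : Measure Ω}
  [IsProbabilityMeasure P] {μ : Measure (Vec d × Vec b)} {X : Fin n → Ω → Vec d × Vec b}
  {Z : Fin n → Ω → Block k d b} {C : ℝ}

omit [IsProbabilityMeasure P] in
theorem lintegral_repData_pow_six_rpow (hX : ∀ i, HasLaw (X i) μ P) (i : Fin n) :
    (∫⁻ ω, ‖repData k X i ω‖ₑ ^ 6 ∂P) ^ (1 / 2 : ℝ) =
      ENNReal.ofReal ((k : ℝ) ^ (3 / 2 : ℝ)) * (∫⁻ x, ‖toPoint x‖ₑ ^ 6 ∂μ) ^ (1 / 2 : ℝ) := by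
  rw [lintegral_enorm_repData_pow_six hX, ENNReal.mul_rpow_of_nonneg _ _ (by norm_num)]
  congr 1
  have h := ENNReal.ofReal_mul_nat_pow_three_rpow (k := k) (c := 1) zero_le_one
  rw [one_mul, Real.one_rpow, ENNReal.ofReal_one, one_mul] at h
  rw [← h, ENNReal.ofReal_pow (by positivity), ENNReal.ofReal_natCast]

omit [IsProbabilityMeasure P] in
-- ‖X̃_i‖² = k‖X_i‖² produces k^{3/2}. The summand r is free: the Gaussian remainder has already
-- been absorbed into the data moment. A direct estimate would have left k^{-3/2} before the
-- Gaussian root, more than the k^{-3} available.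
theorem sum_lindeberg_le (hX : ∀ i, HasLaw (X i) μ P) (l r : ℝ≥0∞) :
    ∑ i, l * (∫⁻ ω, ‖repData k X i ω‖ₑ ^ 6 ∂P) ^ (1 / 2 : ℝ) ≤
      ENNReal.ofReal ((n : ℝ) * (k : ℝ) ^ (3 / 2 : ℝ)) * l *
        ((∫⁻ x, ‖toPoint x‖ₑ ^ 6 ∂μ) ^ (1 / 2 : ℝ) + r) := by
  simp only [lintegral_repData_pow_six_rpow hX, Finset.sum_const, Finset.card_univ,
    Fintype.card_fin, nsmul_eq_mul]
  rw [ENNReal.ofReal_mul (by positivity), ENNReal.ofReal_natCast]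
  calc _ = (n : ℝ≥0∞) * ENNReal.ofReal ((k : ℝ) ^ (3 / 2 : ℝ)) * l *
        (∫⁻ x, ‖toPoint x‖ₑ ^ 6 ∂μ) ^ (1 / 2 : ℝ) := by ring
    _ ≤ _ := by
      gcongr
      exact le_self_add

/-- The root of the Gaussian sixth moment is O(k^{3/2}), and k^{3/2} ≤ k³. -/
theorem GaussianMatch.gaussian_moment_le {U : Fin n → Ω → Block k d b}
    (hm : GaussianMatch P U Z C) (hk : 0 < k) (i : Fin n) :
    ENNReal.ofReal (1 / (k : ℝ) ^ 3) * (∫⁻ ω, ‖Z i ω‖ₑ ^ 6 ∂P) ^ (1 / 2 : ℝ) ≤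
      ENNReal.ofReal (4 * (2 * C ^ 2) ^ (3 / 2 : ℝ)) := by
  have hk1 : (1 : ℝ) ≤ k := by exact_mod_cast hk
  have hk0 : (0 : ℝ) < k := by linarith
  have h1 : (∫⁻ ω, ‖Z i ω‖ₑ ^ 6 ∂P) ^ (1 / 2 : ℝ) ≤
      4 * (ENNReal.ofReal ((2 * C ^ 2) ^ (3 / 2 : ℝ)) * ENNReal.ofReal ((k : ℝ) ^ (3 / 2 : ℝ))) := by
    refine (hm.lintegral_pow_six_rpow_le i).trans (mul_le_mul_right ?_ _)
    rw [← ENNReal.ofReal_mul_nat_pow_three_rpow (by positivity)]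
    exact ENNReal.rpow_le_rpow (hm.lintegral_enorm_pow_six_le hk i) (by norm_num)
  refine (mul_le_mul_right h1 _).trans ?_
  rw [show (4 : ℝ≥0∞) = ENNReal.ofReal 4 by norm_num, ← ENNReal.ofReal_mul (by positivity),
    ← ENNReal.ofReal_mul (by norm_num), ← ENNReal.ofReal_mul (by positivity)]
  refine ENNReal.ofReal_le_ofReal ?_
  have h2 : (k : ℝ) ^ (3 / 2 : ℝ) ≤ (k : ℝ) ^ 3 := by
    rw [← Real.rpow_natCast]
    exact Real.rpow_le_rpow_of_exponent_le hk1 (by norm_num)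
  have h3 : 1 / (k : ℝ) ^ 3 * (k : ℝ) ^ (3 / 2 : ℝ) ≤ 1 := by
    rw [one_div, inv_mul_le_iff₀ (by positivity), mul_one]
    exact h2
  calc _ = (4 * (2 * C ^ 2) ^ (3 / 2 : ℝ)) * (1 / (k : ℝ) ^ 3 * (k : ℝ) ^ (3 / 2 : ℝ)) := by ring
    _ ≤ (4 * (2 * C ^ 2) ^ (3 / 2 : ℝ)) * 1 := by gcongr
    _ = _ := mul_one _

end Unaugmented

/-! ### The theorem, assembled from the estimates above. -/

theorem mainTheorem11
    -- numbers of augmentations and dimensions, as functions of the sample size `n`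
    (k d b : ℕ → ℕ) (hk : ∀ n, 0 < k n) (hd : ∀ n, 0 < d n) (hb : ∀ n, 0 < b n)
    (lam : ℝ) (hlam : 0 < lam)
    -- for each `n`: probability space, labelled transformations, data and augmentations
    {Ω : ℕ → Type*} [∀ n, MeasurableSpace (Ω n)]
    (P : ∀ n, Measure (Ω n)) [∀ n, IsProbabilityMeasure (P n)]
    {Θ : ℕ → Type*} [∀ n, MeasurableSpace (Θ n)]
    (π : ∀ n, Θ n → Vec (d n) → Vec (d n)) (hπ : ∀ n, Measurable (Function.uncurry (π n)))
    (τ : ∀ n, Θ n → Vec (b n) → Vec (b n)) (hτ : ∀ n, Measurable (Function.uncurry (τ n)))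
    (μ : ∀ n, Measure (Vec (d n) × Vec (b n))) [∀ n, IsProbabilityMeasure (μ n)]
    (ρ : ∀ n, Measure (Θ n)) [∀ n, IsProbabilityMeasure (ρ n)]
    (X : ∀ n, Fin n → Ω n → Vec (d n) × Vec (b n))
    (φ : ∀ n, Fin n → Fin (k n) → Ω n → Θ n)
    (hsample : ∀ n, IsAugmentedSample (P n) (μ n) (ρ n) (X n) (φ n))
    -- Gaussian surrogates with `δ = 0`
    (Z : ∀ n, Fin n → Ω n → Block (k n) (d n) (b n))
    (hZ : ∀ n, IsGaussianSurrogate (P n) (augData (π n) (τ n) (X n) (φ n)) (Z n)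
      (augMean (μ n) (ρ n) (π n) (τ n)) (sigma11 (μ n) (ρ n) (π n) (τ n))
      (sigma12 (μ n) (ρ n) (π n) (τ n)))
    -- growth and decay assumptions
    (hgrowth : (fun n : ℕ => ((b n : ℝ) + (d n : ℝ)) ^ (3 / 2 : ℝ) * (k n : ℝ) ^ (1 / 2 : ℝ))
      =o[atTop] (fun n : ℕ => (n : ℝ)))
    (hdecay : ∃ C : ℝ, ∀ n, CoordinateDecay (P n) (augData (π n) (τ n) (X n) (φ n)) C) :
    -- (i)
    ((∀ n, ContDiff ℝ 3
        (ridgeVec lam : (Fin n → Block (k n) (d n) (b n)) → EuclideanSpace ℝ (Fin (d n) × Fin (b n)))) ∧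
      SmoothnessCondition k (fun n => alpha (P n)
        (ridgeVec lam : (Fin n → Block (k n) (d n) (b n)) → EuclideanSpace ℝ (Fin (d n) × Fin (b n)))
        (augData (π n) (τ n) (X n) (φ n)) (Z n)) ∧
      (∀ n, MemLp (fun ω => ridgeVec lam (fun i => augData (π n) (τ n) (X n) (φ n) i ω)) 2 (P n) ∧
        MemLp (fun ω => ridgeVec lam (fun i => Z n i ω)) 2 (P n)) ∧
      Tendsto (fun n => frob
        (covMat (P n) (fun ω => ridgeVec lam (fun i => augData (π n) (τ n) (X n) (φ n) i ω)) -
          covMat (P n) (fun ω => ridgeVec lam (fun i => Z n i ω)))) atTop (𝓝 0)) ∧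
    -- (ii)
    ((fun n : ℕ => (b n : ℝ) + (d n : ℝ)) =o[atTop]
        (fun n : ℕ => (n : ℝ) * (k n : ℝ) ^ (1 / 4 : ℝ)) →
      -- law of `(V_new, Y_new)`, with second moments `O(1)`
      ∀ (ν : ∀ n, Measure (Vec (d n) × Vec (b n))), (∀ n, IsProbabilityMeasure (ν n)) →
      (∃ C : ℝ, ∀ n, eLpNorm (fun p : Vec (d n) × Vec (b n) => p.1) 2 (ν n) ≤ ENNReal.ofReal C ∧
        eLpNorm (fun p : Vec (d n) × Vec (b n) => p.2) 2 (ν n) ≤ ENNReal.ofReal C) →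
      ((∀ n, ContDiff ℝ 3 (ridgeRisk lam (ν n) : (Fin n → Block (k n) (d n) (b n)) → ℝ)) ∧
        SmoothnessCondition k (fun n => alpha (P n)
          (ridgeRisk lam (ν n) : (Fin n → Block (k n) (d n) (b n)) → ℝ)
          (augData (π n) (τ n) (X n) (φ n)) (Z n)) ∧
        DistHTendstoZero P
          (fun n ω => ridgeRisk lam (ν n) (fun i => augData (π n) (τ n) (X n) (φ n) i ω))
          (fun n ω => ridgeRisk lam (ν n) (fun i => Z n i ω))) ∧
      -- no augmentation: the raw data satisfy the decay assumption
      ((∃ C : ℝ, ∀ n, CoordinateDecay (P n) (repData (k n) (X n)) C) →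
        ∀ (Zt : ∀ n, Fin n → Ω n → Block (k n) (d n) (b n)),
        (∀ n, IsGaussianSurrogate (P n) (repData (k n) (X n)) (Zt n)
          (fun a => ∫ x, toPoint x a ∂(μ n)) (covMat (μ n) toPoint) (covMat (μ n) toPoint)) →
        SmoothnessCondition k (fun n => alpha (P n)
          (ridgeRisk lam (ν n) : (Fin n → Block (k n) (d n) (b n)) → ℝ)
          (repData (k n) (X n)) (Zt n)) ∧
        (∀ n (i : Fin n) (h : ℝ → ℝ), ThriceDifferentiable h → gammaThree h ≠ ∞ →
          Integrable (fun ω => h (ridgeRisk lam (ν n) (fun i => repData (k n) (X n) i ω))) (P n) ∧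
          Integrable (fun ω => h (ridgeRisk lam (ν n) (fun i => Zt n i ω))) (P n) ∧
          ENNReal.ofReal
              |(∫ ω, h (ridgeRisk lam (ν n) (fun i => repData (k n) (X n) i ω)) ∂(P n)) -
                ∫ ω, h (ridgeRisk lam (ν n) (fun i => Zt n i ω)) ∂(P n)| ≤
            ENNReal.ofReal ((n : ℝ) * (k n : ℝ) ^ (3 / 2 : ℝ)) *
              lambdaTwo h (alpha (P n)
                (ridgeRisk lam (ν n) : (Fin n → Block (k n) (d n) (b n)) → ℝ)
                (repData (k n) (X n)) (Zt n)) *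
              ((∫⁻ x, ‖toPoint x‖ₑ ^ 6 ∂(μ n)) ^ (1 / 2 : ℝ) +
                ENNReal.ofReal (1 / (k n : ℝ) ^ 3) *
                  (∫⁻ ω, ‖Zt n i ω‖ₑ ^ 6 ∂(P n)) ^ (1 / 2 : ℝ))) ∧
        (∃ C : ℝ, ∀ n (i : Fin n), ENNReal.ofReal (1 / (k n : ℝ) ^ 3) *
          (∫⁻ ω, ‖Zt n i ω‖ₑ ^ 6 ∂(P n)) ^ (1 / 2 : ℝ) ≤ ENNReal.ofReal C) ∧
        DistHTendstoZero P
          (fun n ω => ridgeRisk lam (ν n) (fun i => repData (k n) (X n) i ω))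
          (fun n ω => ridgeRisk lam (ν n) (fun i => Zt n i ω)))) := by
  obtain ⟨C, hC⟩ := hdecay
  have hm : ∀ n, GaussianMatch (P n) (augData (π n) (τ n) (X n) (φ n)) (Z n) |C| := fun n =>
    gaussianMatch_augData (hπ n) (hτ n) (hsample n) (hZ n) (hC n)
  refine ⟨⟨fun n => contDiff_ridgeVec (hk n) hlam,
    smoothnessCondition_ridge (Q := fun n B => B) hk hm hlam hgrowth
      (fun n => isQuadraticBounded_id),
    memLp_ridgeVec hk hm hlam, tendsto_frob_covMat_ridgeVec_sub hk hm hlam hgrowth⟩, ?_⟩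
  rintro - ν hν ⟨D, hD⟩
  -- The distribution of the new point enters only through this uniform bound on the coefficients of
  -- the risk, which serves both the augmented and the unaugmented case.
  have hQ : ∀ n, IsQuadraticBounded (flatRisk (ν n)) (2 * D ^ 2) := fun n =>
    isQuadraticBounded_flatRisk (hD n).1 (hD n).2
  simp only [ridgeRisk_eq_flatRisk]
  refine ⟨⟨fun n => (hQ n).contDiff_ridge (hk n) hlam,
    smoothnessCondition_ridge hk hm hlam hgrowth hQ,
    distH_ridge_tendsto_zero hk hm hlam hgrowth hQ⟩, ?_⟩
  rintro ⟨C', hC'⟩ Zt hZt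
  have hm' : ∀ n, GaussianMatch (P n) (repData (k n) (X n)) (Zt n) |C'| := fun n =>
    gaussianMatch_repData (hsample n) (hZt n) (hC' n)
  refine ⟨smoothnessCondition_ridge hk hm' hlam hgrowth hQ, fun n i h hh hγ => ?_,
    ⟨_, fun n i => (hm' n).gaussian_moment_le (hk n) i⟩,
    distH_ridge_tendsto_zero hk hm' hlam hgrowth hQ⟩
  obtain ⟨h1, h2, h3⟩ := (hm' n).lindeberg ((hQ n).contDiff_ridge (hk n) hlam)
    (fun r hr => ne_top_of_le_ne_top ENNReal.ofReal_ne_top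
      (alpha_ridge_le hk hm' hlam hQ n (by omega) le_rfl)) hh hγ
  exact ⟨h1, h2, h3.trans (sum_lindeberg_le (hsample n).law_X _ _)⟩
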